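/- A game graph $G=(V,E)$ is a finite directed graph in which every vertex has at least one outgoing edge and whose vertices are partitioned into $V=V_0\uplus V_1$; let $E_0$ be the set of edges starting in $V_0$. Plays are infinite paths. A strategy of player $0$ maps every $hv\in V^*V_0$ to a successor of $v$, and it is memoryless if its value depends only on $v$. Given a priority function $\mathbb P:V\to\mathbb N$, the parity objective $\mathit{Parity}(\mathbb P)$ consists of the plays on which, for every odd $i$ such that priority $i$ occurs infinitely often, some even priority $j>i$ occurs infinitely often (i.e. the maximal priority seen infinitely often is even). A persistent live group is a triple $(S,C,T)$ with $T\subseteq S\subseteq V$ and $C\subseteq E_0$; it represents the LTL assumption $$\psi(S,C,T)=\square\Big(\square\big(S\wedge\textstyle\bigwedge_{(u,v)\in C}(u\Rightarrow\bigcirc v)\big)\Rightarrow\lozenge T\Big).$$ For a finite collection $\Lambda$ of persistent live groups, the augmented parity game $(G,\mathit{Parity}(\mathbb P),\Lambda)$ is the game on $G$ with objective $\bigwedge_{(S,C,T)\in\Lambda}\psi(S,C,T)\Rightarrow\mathit{Parity}(\mathbb P)$ for player $0$. The winning region of player $0$ is the set of vertices from which player $0$ has a strategy all of whose compliant plays satisfy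 this objective. **Theorem.** Parity games augmented with persistent live groups can be solved in quasi-polynomial time: there are an algorithm and a constant $c$ such that, for every game graph $G$, priority function $\mathbb P$ and finite collection $\Lambda$ of persistent live groups, the algorithm, given $(G,\mathbb P,\Lambda)$, computes the winning region of player $0$ in the augmented game together with a memoryless strategy of player $0$ that is winning from every vertex of that region, in at most $2^{c(\log_2(N+2))^{c}}$ steps (with $\log_2$ rounded down), where $N$ is the bit length of the input (adjacency-matrix representation of $G$, priorities in binary, characteristic vectors of $S$, $C$, $T$ for each group). Here an algorithm is a program of a random access machine with finitely many registers and arrays of natural numbers, with assignment, addition, truncated subtraction, indirect load and store, branching and loops on the test "$\neq 0$", at unit cost per instruction and per test (this model is polynomially equivalent to Turing machines). -/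

import Mathlib

/-! ### Linear temporal logic on infinite words -/

namespace LTL

variable {V : Type*}

/-- The atomic proposition given by a set of vertices: the first letter lies in `A`. -/
def atom (A : Set V) : (ℕ → V) → Prop := fun ρ => ρ 0 ∈ A

/-- The operator `○` (next). -/
def next (φ : (ℕ → V) → Prop) : (ℕ → V) → Prop := fun ρ => φ (fun i => ρ (i + 1))

/-- The operator `□` (always): every suffix satisfies `φ`. -/
def always (φ : (ℕ → V) → Prop) : (ℕ → V) → Prop := fun ρ => ∀ k, φ (fun i => ρ (k + i))

/-- The operator `◇` (eventually): some suffix satisfies `φ`. -/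
def eventually (φ : (ℕ → V) → Prop) : (ℕ → V) → Prop := fun ρ => ∃ k, φ (fun i => ρ (k + i))

end LTL

/-! ### Game graphs, strategies, winning -/

/-- A game graph on the vertex set `V`: the vertices are partitioned between the players `0` and `1`
by `owner`, and every vertex has a successor (so that plays can always be prolonged). -/
structure GameGraph (V : Type*) where
  owner : V → Fin 2
  edge : V → V → Prop
  exists_edge : ∀ v, ∃ w, edge v w

namespace GameGraph

variable {V : Type*} (G : GameGraph V)

/-- Infinite plays. -/
def IsPlay (ρ : ℕ → V) : Prop := ∀ k, G.edge (ρ k) (ρ (k + 1))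

/-- `σ h v` is the move chosen at the current vertex `v` after the history `h`. -/
def IsStrategy (i : Fin 2) (σ : List V → V → V) : Prop :=
  ∀ h v, G.owner v = i → G.edge v (σ h v)

/-- The sequence `ρ` follows the strategy `σ` of player `i`. -/
def Compliant (i : Fin 2) (σ : List V → V → V) (ρ : ℕ → V) : Prop :=
  ∀ k, G.owner (ρ k) = i → ρ (k + 1) = σ (List.ofFn fun j : Fin k => ρ j) (ρ k)

/-- `σ` is a strategy of player `0` that wins from `v` for the objective `Φ`. -/
def WinsFrom (Φ : (ℕ → V) → Prop) (σ : List V → V → V) (v : V) : Prop :=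
  G.IsStrategy 0 σ ∧ ∀ ρ, G.IsPlay ρ → ρ 0 = v → G.Compliant 0 σ ρ → Φ ρ

/-- The winning region of player `0` for the objective `Φ`. -/
def winningRegion (Φ : (ℕ → V) → Prop) : Set V := {v | ∃ σ, G.WinsFrom Φ σ v}

/-- A persistent live group `(S, C, T)` of `G`: `S, T ⊆ V`, `C ⊆ E₀` and `T ⊆ S`. -/
structure PersLiveGroup where
  S : Set V
  C : Set (V × V)
  T : Set V
  C_sub : ∀ e ∈ C, G.edge e.1 e.2 ∧ G.owner e.1 = 0
  T_sub : T ⊆ S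

end GameGraph

/-- The formula `⋀_{(u,v) ∈ C} (u ⇒ ○ v)`. -/
def contAssumption {V : Type*} (C : Set (V × V)) : (ℕ → V) → Prop :=
  fun ρ => ∀ e ∈ C, LTL.atom {e.1} ρ → LTL.next (LTL.atom {e.2}) ρ

/-- The formula `□ (□ (S ∧ ⋀_{(u,v) ∈ C} (u ⇒ ○ v)) ⇒ ◇ T)`. -/
def GameGraph.PersLiveGroup.assumption {V : Type*} {G : GameGraph V} (g : G.PersLiveGroup) :
    (ℕ → V) → Prop :=
  LTL.always fun ρ =>
    LTL.always (fun ρ' => LTL.atom g.S ρ' ∧ contAssumption g.C ρ') ρ →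
      LTL.eventually (LTL.atom g.T) ρ

/-- The parity objective: for every odd `i`, if priority `i` is seen infinitely often, then so is
some even priority `j > i` (the maximal priority seen infinitely often is even). -/
def parityObjective {V : Type*} (prio : V → ℕ) : (ℕ → V) → Prop :=
  fun ρ => ∀ i, Odd i → LTL.always (LTL.eventually (LTL.atom {v | prio v = i})) ρ →
    ∃ j, Even j ∧ i < j ∧ LTL.always (LTL.eventually (LTL.atom {v | prio v = j})) ρ

/-- A finite parity game augmented with a finite family of persistent live groups. -/
structure PersParityGame where
  n : ℕ
  graph : GameGraph (Fin n)
  prio : Fin n → ℕ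
  groups : List graph.PersLiveGroup

/-! ### Random access machines -/

namespace RAM

/-- Programs of a random access machine with registers and (finitely many) arrays of natural
numbers; the only arithmetic operations are addition and truncated subtraction. -/
inductive Prog where
  /-- `r_x := k` -/
  | const (x k : ℕ)
  /-- `r_x := r_y` -/
  | copy (x y : ℕ)
  /-- `r_x := r_y + r_z` -/
  | add (x y z : ℕ)
  /-- `r_x := r_y - r_z` (truncated) -/
  | sub (x y z : ℕ)
  /-- `r_x := A_a[r_y]` -/
  | load (x a y : ℕ)
  /-- `A_a[r_x] := r_y` -/
  | store (a x y : ℕ)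
  /-- run `p`, then `q` -/
  | seq (p q : Prog)
  /-- if `r_x ≠ 0` then run `p`, else run `q` -/
  | ite (x : ℕ) (p q : Prog)
  /-- while `r_x ≠ 0` run `p` -/
  | while (x : ℕ) (p : Prog)

/-- Contents of the registers and of the arrays. -/
structure State where
  reg : ℕ → ℕ
  arr : ℕ → ℕ → ℕ

/-- Write `k` into register `x`. -/
def State.setReg (s : State) (x k : ℕ) : State :=
  { s with reg := Function.update s.reg x k }

/-- Write `k` into cell `i` of array `a`. -/
def State.setArr (s : State) (a i k : ℕ) : State :=
  { s with arr := Function.update s.arr a (Function.update (s.arr a) i k) }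

/-- `Exec p s t s'`: started in `s`, the program `p` halts in `s'` after exactly `t` steps.
Every elementary instruction and every test costs one step. -/
inductive Exec : Prog → State → ℕ → State → Prop where
  | const (s x k) : Exec (.const x k) s 1 (s.setReg x k)
  | copy (s x y) : Exec (.copy x y) s 1 (s.setReg x (s.reg y))
  | add (s x y z) : Exec (.add x y z) s 1 (s.setReg x (s.reg y + s.reg z))
  | sub (s x y z) : Exec (.sub x y z) s 1 (s.setReg x (s.reg y - s.reg z))
  | load (s x a y) : Exec (.load x a y) s 1 (s.setReg x (s.arr a (s.reg y)))
  | store (s a x y) : Exec (.store a x y) s 1 (s.setArr a (s.reg x) (s.reg y))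
  | seq {p q s s' s'' t t'} : Exec p s t s' → Exec q s' t' s'' → Exec (.seq p q) s (t + t') s''
  | ite_pos {x p q s s' t} : s.reg x ≠ 0 → Exec p s t s' → Exec (.ite x p q) s (t + 1) s'
  | ite_neg {x p q s s' t} : s.reg x = 0 → Exec q s t s' → Exec (.ite x p q) s (t + 1) s'
  | while_done {x p s} : s.reg x = 0 → Exec (.while x p) s 1 s
  | while_step {x p s s' s'' t t'} : s.reg x ≠ 0 → Exec p s t s' →
      Exec (.while x p) s' t' s'' → Exec (.while x p) s (t + t' + 1) s''

/-- The machine is deterministic: the final state and the number of steps are determined by the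
program and the initial state. -/
theorem Exec.unique {p : Prog} {s s₁ s₂ : State} {t₁ t₂ : ℕ} (h₁ : Exec p s t₁ s₁)
    (h₂ : Exec p s t₂ s₂) : t₁ = t₂ ∧ s₁ = s₂ := by
  induction h₁ generalizing t₂ s₂ with
  | const | copy | add | sub | load | store => cases h₂; exact ⟨rfl, rfl⟩
  | seq _ _ ih ih' =>
    cases h₂ with
    | seq k k' =>
      obtain ⟨rfl, rfl⟩ := ih k
      obtain ⟨rfl, rfl⟩ := ih' k'
      exact ⟨rfl, rfl⟩
  | ite_pos hx _ ih =>
    cases h₂ with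
    | ite_pos _ k => obtain ⟨rfl, rfl⟩ := ih k; exact ⟨rfl, rfl⟩
    | ite_neg hx' _ => exact absurd hx' hx
  | ite_neg hx _ ih =>
    cases h₂ with
    | ite_pos hx' _ => exact absurd hx hx'
    | ite_neg _ k => obtain ⟨rfl, rfl⟩ := ih k; exact ⟨rfl, rfl⟩
  | while_done hx =>
    cases h₂ with
    | while_done => exact ⟨rfl, rfl⟩
    | while_step hx' _ _ => exact absurd hx hx'
  | while_step hx _ _ ih ih' =>
    cases h₂ with
    | while_done hx' => exact absurd hx' hx
    | while_step _ k k' =>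
      obtain ⟨rfl, rfl⟩ := ih k
      obtain ⟨rfl, rfl⟩ := ih' k'
      exact ⟨rfl, rfl⟩

/-- The initial state on input `l`: the list is stored in array `0`, its length in register `0`, and
everything else is zero. -/
def State.input (l : List ℕ) : State where
  reg := fun x => if x = 0 then l.length else 0
  arr := fun a i => if a = 0 then l.getD i 0 else 0

/-- The state `s` displays the output `l`: array `0` starts with `l`, and register `0` holds the
length of `l`. -/
def State.Outputs (s : State) (l : List ℕ) : Prop :=
  s.reg 0 = l.length ∧ ∀ i < l.length, s.arr 0 i = l.getD i 0

/-- The size of an input: the total length of the binary expansions, with one separator each. -/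
def bitLength (l : List ℕ) : ℕ := (l.map fun a => a.size + 1).sum

/-- The search problem with instances `I`, input encoding `enc` and set `Sol x` of correct outputs on
the instance `x` is solvable in quasi-polynomial time: some program halts on every instance with a
correct output after at most `2 ^ (c * (log N) ^ c)` steps, `N` being the size of the input. -/
def SolvableInQP {I : Type*} (enc : I → List ℕ) (Sol : I → Set (List ℕ)) : Prop :=
  ∃ (p : Prog) (c : ℕ), ∀ x : I, ∃ (t : ℕ) (s : State) (out : List ℕ),
    Exec p (State.input (enc x)) t s ∧
    t ≤ 2 ^ (c * Nat.log 2 (bitLength (enc x) + 2) ^ c) ∧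
    s.Outputs out ∧ out ∈ Sol x

end RAM

/-! ### Solving augmented parity games -/

open Classical in
/-- The bit `1` if `p` holds, and `0` otherwise. -/
noncomputable def bit (p : Prop) : ℕ := if p then 1 else 0

/-- Characteristic vector of a set of vertices. -/
noncomputable def encodeSet {n : ℕ} (A : Set (Fin n)) : List ℕ :=
  List.ofFn fun v => bit (v ∈ A)

/-- Adjacency matrix of a set of edges, row by row. -/
noncomputable def encodeRel {n : ℕ} (E : Set (Fin n × Fin n)) : List ℕ :=
  (List.finRange n).flatMap fun u => List.ofFn fun v => bit ((u, v) ∈ E)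

namespace PersParityGame

/-- The input format: number of vertices, number of live groups, owners, priorities, adjacency
matrix, and then `S`, `C`, `T` for each of the live groups. -/
noncomputable def encode (𝔊 : PersParityGame) : List ℕ :=
  [𝔊.n, 𝔊.groups.length] ++ List.ofFn (fun v => (𝔊.graph.owner v : ℕ)) ++ List.ofFn 𝔊.prio ++
    encodeRel {e | 𝔊.graph.edge e.1 e.2} ++
    𝔊.groups.flatMap fun g => encodeSet g.S ++ encodeRel g.C ++ encodeSet g.T

/-- The objective of the augmented game: if the assumption of every persistent live group holds, then
the parity objective holds. -/
def objective (𝔊 : PersParityGame) : (ℕ → Fin 𝔊.n) → Prop :=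
  fun ρ => (∀ g ∈ 𝔊.groups, g.assumption ρ) → parityObjective 𝔊.prio ρ

/-- The correct outputs: the winning region `W` of player `0` in the augmented game, followed by a
memoryless strategy `f` of player `0` that is winning from every vertex of `W`. -/
def solutions (𝔊 : PersParityGame) : Set (List ℕ) :=
  {out | ∃ f : Fin 𝔊.n → Fin 𝔊.n,
    𝔊.graph.IsStrategy 0 (fun _ v => f v) ∧
    (∀ v ∈ 𝔊.graph.winningRegion 𝔊.objective, 𝔊.graph.WinsFrom 𝔊.objective (fun _ v => f v) v) ∧
    out = encodeSet (𝔊.graph.winningRegion 𝔊.objective) ++ List.ofFn (fun v => (f v : ℕ))}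

end PersParityGame

/-! Whether a play violates the objective depends only on the set of edges it takes infinitely
often. Say that a group allows a move that starts in `S \ T` and obeys `C`; its assumption fails
exactly when from some point on all moves are allowed. A play is lost for player `0` if the top
priority among the recurring edges is odd and no group allows all of them. Such bad sets are closed
under union: the larger of two odd maxima is the new maximum, and an edge that is not allowed stays
in the union. This closure makes memoryless strategies sufficient for player `0`
(`GameGraph.exists_memoryless`); player `1` may need memory, which is carried by the states of a
`Refutation`.

With an optimal memoryless strategy fixed, all infinite paths from its safe vertices are good. This
is certified by a measure whose values are positions in one fixed word of pairs (level, label). A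
move of rank `2 * c + o` may not increase the number of positions of level above `c` up to the
current one, and must decrease it if `o = 1`. From a position that carries a label and a level above
`c` it must instead descend, or stay if the labelling group allows the move (`MoveOK`). Such a
measure forces good paths (`not_badSet_of_moveOK`).

Conversely, a quasi-polynomially long word hosts a measure for every good graph
(`exists_measure_univWord`). A set of fewer than `2 * N` vertices splits into `A`, `K`, `B` with `A`
and `B` smaller than `N`, no move from an earlier part to a later one, and `K` strongly connected
(`exists_decomposition`). If `K` contains an edge, some path in `K` sees all its edges infinitely
often. So if `K` has a move of the maximal odd rank, one group allows all of `K`, which then fits on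
a single labelled letter; otherwise `K` is handled one level lower. The parts `A` and `B` are
handled by the word for half the size. There are logarithmically many halvings, and each multiplies
the length by a polynomial factor.

Consequently the winning region is where the least measure stays below an added top position
(`Table.solution`), and simple lifting finds this measure in time polynomial in the length of the
word. The algorithm is written in a small structured language, which is compiled to the machine with
verified semantics and step counts. -/

open Filter

/-! ### Edges seen infinitely often -/

/-- The pairs of consecutive letters that occur infinitely often in `ρ`. -/
def infEdges {V : Type*} (ρ : ℕ → V) : Set (V × V) := {e | ∃ᶠ k in atTop, (ρ k, ρ (k + 1)) = e}

theorem infEdges_shift {V : Type*} (ρ : ℕ → V) (j : ℕ) :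
    infEdges (fun k => ρ (j + k)) = infEdges ρ := by
  ext e
  simp only [infEdges, Set.mem_ofPred_eq, Nat.frequently_atTop_iff_infinite]
  constructor
  · intro h
    refine Set.infinite_of_forall_exists_gt fun N => ?_
    obtain ⟨k, hk, hk'⟩ := h.exists_gt N
    exact ⟨j + k, by simpa [add_assoc] using hk, by omega⟩
  · intro h
    refine Set.infinite_of_forall_exists_gt fun N => ?_
    obtain ⟨k, hk, hk'⟩ := h.exists_gt (N + j)
    refine ⟨k - j, ?_, by omega⟩
    have h1 : j + (k - j) = k := by omega
    have h2 : j + (k - j + 1) = k + 1 := by omega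
    simpa [h1, h2] using hk

/-- Pigeonhole: there are finitely many pairs, so a property that recurs along the play recurs on
one fixed pair. -/
theorem frequently_iff_exists_infEdges {V : Type*} [Finite V] (ρ : ℕ → V) (P : V × V → Prop) :
    (∃ᶠ k in atTop, P (ρ k, ρ (k + 1))) ↔ ∃ e ∈ infEdges ρ, P e := by
  constructor
  · intro h
    by_contra! hc
    have : ∀ e : V × V, ∀ᶠ k in atTop, ¬ (P e ∧ (ρ k, ρ (k + 1)) = e) := by
      intro e
      by_cases he : e ∈ infEdges ρ
      · exact Eventually.of_forall fun k hk => hc e he hk.1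
      · simp only [infEdges, Set.mem_ofPred_eq, not_frequently] at he
        exact he.mono fun k hk hk' => hk hk'.2
    have := eventually_all.2 this
    obtain ⟨k, hk, hk'⟩ := (h.and_eventually this).exists
    exact hk' _ ⟨hk, rfl⟩
  · rintro ⟨e, he, hP⟩
    exact he.mono fun k hk => hk ▸ hP

/-! ### Half-positional determinacy for union-closed families of bad edge sets -/

namespace GameGraph

variable {V : Type*}

/-- The moves that remain when player `0` plays the memoryless strategy `f`. -/
def Follows (G : GameGraph V) (f : V → V) (u v : V) : Prop :=
  G.edge u v ∧ (G.owner u = 0 → v = f u)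

/-- Every play from `v` against the memoryless strategy `f` avoids `Bad`. -/
def SafeFrom (G : GameGraph V) (Bad : Set (V × V) → Prop) (f : V → V) (v : V) : Prop :=
  ∀ ρ : ℕ → V, ρ 0 = v → (∀ k, G.Follows f (ρ k) (ρ (k + 1))) → ¬ Bad (infEdges ρ)

/-- A strategy of player `1` with arbitrary memory, given as a labelled graph in which the moves of
player `0` are unrestricted and all of whose infinite paths are `Bad`. -/
structure Refutation (G : GameGraph V) (Bad : Set (V × V) → Prop) where
  Q : Type
  lab : Q → V
  R : Q → Q → Prop
  move_zero : ∀ q, G.owner (lab q) = 0 → ∀ w, G.edge (lab q) w → ∃ q', R q q' ∧ lab q' = w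
  move_one : ∀ q, G.owner (lab q) ≠ 0 → ∃ q', R q q' ∧ G.edge (lab q) (lab q')
  bad : ∀ π : ℕ → Q, (∀ k, R (π k) (π (k + 1))) → Bad (infEdges (lab ∘ π))

/-- A path through a refutation that is compliant with a given strategy. -/
theorem Refutation.exists_play {G : GameGraph V} {Bad : Set (V × V) → Prop}
    (r : G.Refutation Bad) {σ : List V → V → V} (hσ : G.IsStrategy 0 σ) (q : r.Q) :
    ∃ ρ : ℕ → V, ρ 0 = r.lab q ∧ G.IsPlay ρ ∧ G.Compliant 0 σ ρ ∧ Bad (infEdges ρ) := by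
  have step : ∀ (h : List V) (q : r.Q), ∃ q', r.R q q' ∧ G.edge (r.lab q) (r.lab q') ∧
      (G.owner (r.lab q) = 0 → r.lab q' = σ h (r.lab q)) := by
    intro h q
    by_cases h0 : G.owner (r.lab q) = 0
    · obtain ⟨q', h1, h2⟩ := r.move_zero q h0 _ (hσ h _ h0)
      exact ⟨q', h1, h2 ▸ hσ h _ h0, fun _ => h2⟩
    · obtain ⟨q', h1, h2⟩ := r.move_one q h0
      exact ⟨q', h1, h2, fun h => absurd h h0⟩
  choose nxt hR hE hC using step
  let st : ℕ → List V × r.Q := fun k =>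
    Nat.rec ([], q) (fun _ p => (p.1 ++ [r.lab p.2], nxt p.1 p.2)) k
  have hst : ∀ k, st (k + 1) = ((st k).1 ++ [r.lab (st k).2], nxt (st k).1 (st k).2) :=
    fun _ => rfl
  have hist : ∀ k, (st k).1 = List.ofFn fun j : Fin k => r.lab (st j).2 := by
    intro k
    induction k with
    | zero => rfl
    | succ k ih =>
      rw [hst, List.ofFn_succ', List.concat_eq_append]
      simp only [Fin.val_castSucc, Fin.val_last]
      rw [← ih]
  refine ⟨fun k => r.lab (st k).2, rfl, fun k => ?_, fun k hk => ?_, ?_⟩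
  · simp only [hst]; exact hE _ _
  · simp only [hst]; rw [hC _ _ hk, hist]
  · exact r.bad (fun k => (st k).2) fun k => by simp only [hst]; exact hR _ _

theorem Refutation.not_safeFrom {G : GameGraph V} {Bad : Set (V × V) → Prop}
    (r : G.Refutation Bad) {f : V → V} (hf : G.IsStrategy 0 fun _ v => f v) (q : r.Q) :
    ¬ G.SafeFrom Bad f (r.lab q) := by
  intro h
  obtain ⟨ρ, h0, hp, hc, hb⟩ := r.exists_play hf q
  exact h ρ h0 (fun k => ⟨hp k, hc k⟩) hb

/-- A sequence that follows `R` at the times in `S` and stutters elsewhere. -/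
theorem Refutation.bad_of_stutter {G : GameGraph V} {Bad : Set (V × V) → Prop}
    (r : G.Refutation Bad) (q : ℕ → r.Q) (S : Set ℕ) (hS : S.Infinite)
    (hR : ∀ k ∈ S, r.R (q k) (q (k + 1))) (hstay : ∀ k ∉ S, q (k + 1) = q k) :
    Bad {e | ∃ᶠ k in atTop, k ∈ S ∧ (r.lab (q k), r.lab (q (k + 1))) = e} := by
  classical
  let p : ℕ → Prop := (· ∈ S)
  have hp : (Set.ofPred p).Infinite := hS
  have hrange : ∀ k ∈ S, ∃ i, Nat.nth p i = k := fun k hk => by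
    have : k ∈ Set.range (Nat.nth p) := by rw [Nat.range_nth_of_infinite hp]; exact hk
    exact this
  -- Between consecutive times of `S` the state is frozen. Hence the states at the times enumerated
  -- by `Nat.nth` form a genuine path of `r`, with the same edges recurring.
  have hnext : ∀ j, q (Nat.nth p (j + 1)) = q (Nat.nth p j + 1) := by
    intro j
    have hlt : Nat.nth p j < Nat.nth p (j + 1) := (Nat.nth_strictMono hp) (Nat.lt_succ_self j)
    have : ∀ d, Nat.nth p j + 1 + d ≤ Nat.nth p (j + 1) →
        q (Nat.nth p j + 1 + d) = q (Nat.nth p j + 1) := by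
      intro d
      induction d with
      | zero => intro _; rfl
      | succ d ih =>
        intro hd
        rw [← ih (by omega)]
        refine hstay _ fun hmem => ?_
        have h1 : Nat.nth p j + 1 + d < Nat.nth p (j + 1) := by omega
        obtain ⟨i, hi⟩ := hrange _ hmem
        change _ = Nat.nth p j + 1 + d at hi
        rw [← hi] at h1
        have h2 := (Nat.nth_strictMono hp).lt_iff_lt.1 h1
        have h3 : Nat.nth p j < Nat.nth p i := by omega
        have h4 := (Nat.nth_strictMono hp).lt_iff_lt.1 h3
        omega
    have h := this (Nat.nth p (j + 1) - (Nat.nth p j + 1)) (by omega)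
    rwa [show Nat.nth p j + 1 + (Nat.nth p (j + 1) - (Nat.nth p j + 1)) = Nat.nth p (j + 1) by
      omega] at h
  have hb := r.bad (fun j => q (Nat.nth p j)) fun j => by
    rw [hnext]; exact hR _ (Nat.nth_mem_of_infinite hp j)
  convert hb using 1
  ext e
  simp only [infEdges, Set.mem_ofPred_eq, Function.comp, hnext, frequently_atTop]
  constructor
  · intro h N
    obtain ⟨k, hk, hkS, hke⟩ := h (Nat.nth p N)
    obtain ⟨i, rfl⟩ := hrange _ hkS
    exact ⟨i, (Nat.nth_strictMono hp).le_iff_le.1 hk, hke⟩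
  · intro h N
    obtain ⟨j, hj, hje⟩ := h N
    exact ⟨Nat.nth p j, hj.trans ((Nat.nth_strictMono hp).le_apply), Nat.nth_mem_of_infinite hp j,
      hje⟩

/-- The subgame with the edges in `P` only. -/
def restrict (G : GameGraph V) (P : V → V → Prop) (h : ∀ v, ∃ w, G.edge v w ∧ P v w) :
    GameGraph V where
  owner := G.owner
  edge v w := G.edge v w ∧ P v w
  exists_edge := h

/-- Two refutations of the subgames obtained by splitting the moves at `v₀` that both contain `v₀`
can be mixed. -/
theorem Refutation.exists_mix {G G₁ G₂ : GameGraph V} {Bad : Set (V × V) → Prop}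
    (hBad : ∀ A B, Bad A → Bad B → Bad (A ∪ B)) (v₀ : V) (h₀ : G.owner v₀ = 0)
    (ho₁ : G₁.owner = G.owner) (ho₂ : G₂.owner = G.owner)
    (hle₁ : ∀ u v, G₁.edge u v → G.edge u v)
    (he₁ : ∀ u v, u ≠ v₀ → G.edge u v → G₁.edge u v)
    (hle₂ : ∀ u v, G₂.edge u v → G.edge u v)
    (he₂ : ∀ u v, u ≠ v₀ → G.edge u v → G₂.edge u v)
    (hsplit : ∀ v, G.edge v₀ v → G₁.edge v₀ v ∨ G₂.edge v₀ v)
    (r₁ : G₁.Refutation Bad) (r₂ : G₂.Refutation Bad) (q₂ : r₂.Q) (hq₂ : r₂.lab q₂ = v₀) :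
    ∃ r : G.Refutation Bad, ∀ q : r₁.Q, ∃ q' : r.Q, r.lab q' = r₁.lab q := by
  -- The flag names the active refutation; the invariant says that the other one waits at `v₀`. In
  -- `R` the flag of the target decides which refutation moves. Switching is permitted at `v₀` only,
  -- where both refutations sit, so the move of player `0` there decides which of them continues.
  let lab : Bool × r₁.Q × r₂.Q → V := fun p => if p.1 then r₁.lab p.2.1 else r₂.lab p.2.2
  let inv : Bool × r₁.Q × r₂.Q → Prop := fun p => if p.1 then r₂.lab p.2.2 = v₀ else r₁.lab p.2.1 = v₀
  let R : Bool × r₁.Q × r₂.Q → Bool × r₁.Q × r₂.Q → Prop := fun p p' =>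
    (if p'.1 then r₁.R p.2.1 p'.2.1 ∧ p'.2.2 = p.2.2 else r₂.R p.2.2 p'.2.2 ∧ p'.2.1 = p.2.1)
  have hcur₁ : ∀ p, inv p → lab p = v₀ → r₁.lab p.2.1 = v₀ ∧ r₂.lab p.2.2 = v₀ := by
    rintro ⟨b, a, c⟩ h1 h2
    cases b <;> simp_all [lab, inv]
  refine ⟨⟨{p // inv p}, fun p => lab p, fun p p' => R p p' ∧ (p.1.1 ≠ p'.1.1 → lab p = v₀),
    ?_, ?_, ?_⟩, fun q => ⟨⟨(true, q, q₂), by simp [inv, hq₂]⟩, by simp [lab]⟩⟩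
  · rintro ⟨p, hp⟩ hp0 w hw
    by_cases hv : lab p = v₀
    · obtain ⟨h1, h2⟩ := hcur₁ p hp hv
      simp only [hv] at hw
      rcases hsplit w hw with h | h
      · obtain ⟨q', hq', rfl⟩ := r₁.move_zero p.2.1 (by rw [ho₁, h1, h₀]) w (h1 ▸ h)
        exact ⟨⟨(true, q', p.2.2), by simpa [inv] using h2⟩, ⟨by simpa [R] using hq', fun _ => hv⟩,
          by simp [lab]⟩
      · obtain ⟨q', hq', rfl⟩ := r₂.move_zero p.2.2 (by rw [ho₂, h2, h₀]) w (h2 ▸ h)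
        exact ⟨⟨(false, p.2.1, q'), by simpa [inv] using h1⟩, ⟨by simpa [R] using hq', fun _ => hv⟩,
          by simp [lab]⟩
    · obtain ⟨b, a, c⟩ := p
      cases b
      · simp only [lab, inv, Bool.false_eq_true, if_false] at hp hp0 hw hv
        obtain ⟨q', hq', rfl⟩ := r₂.move_zero c (by rw [ho₂, hp0]) w (he₂ _ _ hv hw)
        exact ⟨⟨(false, a, q'), by simpa [inv] using hp⟩, ⟨by simpa [R] using hq', by simp⟩,
          by simp [lab]⟩
      · simp only [lab, inv, if_true] at hp hp0 hw hv
        obtain ⟨q', hq', rfl⟩ := r₁.move_zero a (by rw [ho₁, hp0]) w (he₁ _ _ hv hw)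
        exact ⟨⟨(true, q', c), by simpa [inv] using hp⟩, ⟨by simpa [R] using hq', by simp⟩,
          by simp [lab]⟩
  · rintro ⟨⟨b, a, c⟩, hp⟩ hp1
    cases b
    · simp only [lab, inv, Bool.false_eq_true, if_false] at hp hp1
      obtain ⟨q', hq', hE⟩ := r₂.move_one c (by rwa [ho₂])
      exact ⟨⟨(false, a, q'), by simpa [inv] using hp⟩, ⟨by simpa [R] using hq', by simp⟩,
        by simpa [lab] using hle₂ _ _ hE⟩
    · simp only [lab, inv, if_true] at hp hp1
      obtain ⟨q', hq', hE⟩ := r₁.move_one a (by rwa [ho₁])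
      exact ⟨⟨(true, q', c), by simpa [inv] using hp⟩, ⟨by simpa [R] using hq', by simp⟩,
        by simpa [lab] using hle₁ _ _ hE⟩
  · intro π hπ
    let b : ℕ → Bool := fun k => (π k).1.1
    let S₁ : Set ℕ := {k | b (k + 1) = true}
    let S₂ : Set ℕ := {k | b (k + 1) = false}
    let a₁ : ℕ → r₁.Q := fun k => (π k).1.2.1
    let a₂ : ℕ → r₂.Q := fun k => (π k).1.2.2
    have hR₁ : ∀ k ∈ S₁, r₁.R (a₁ k) (a₁ (k + 1)) ∧ a₂ (k + 1) = a₂ k := by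
      intro k hk
      have h := (hπ k).1
      have hk' : (π (k + 1)).1.1 = true := hk
      simpa [R, hk'] using h
    have hR₂ : ∀ k ∈ S₂, r₂.R (a₂ k) (a₂ (k + 1)) ∧ a₁ (k + 1) = a₁ k := by
      intro k hk
      have h := (hπ k).1
      have hk' : (π (k + 1)).1.1 = false := hk
      simpa [R, hk'] using h
    have hcompl : ∀ k, k ∈ S₁ ↔ k ∉ S₂ := by intro k; simp [S₁, S₂]
    -- At a switch the visible label comes from the previously active refutation, but both labels
    -- are `v₀` there. So every edge can be attributed to the refutation that moves.
    have hlab : ∀ k, (k ∈ S₁ → lab (π k) = r₁.lab (a₁ k)) ∧ (k ∈ S₂ → lab (π k) = r₂.lab (a₂ k)) := by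
      intro k
      have hi := (π k).2
      have hs := (hπ k).2
      constructor
      · intro hk
        have hk' : (π (k + 1)).1.1 = true := hk
        cases hb : (π k).1.1
        · rw [hb, hk'] at hs
          rw [hs (by simp), (hcur₁ _ hi (hs (by simp))).1]
        · simp [lab, hb, a₁]
      · intro hk
        have hk' : (π (k + 1)).1.1 = false := hk
        cases hb : (π k).1.1
        · simp [lab, hb, a₂]
        · rw [hb, hk'] at hs
          rw [hs (by simp), (hcur₁ _ hi (hs (by simp))).2]
    have hlab' : ∀ k, (k ∈ S₁ → lab (π (k + 1)) = r₁.lab (a₁ (k + 1))) ∧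
        (k ∈ S₂ → lab (π (k + 1)) = r₂.lab (a₂ (k + 1))) := by
      intro k
      constructor
      · intro hk
        have hk' : (π (k + 1)).1.1 = true := hk
        simp [lab, hk', a₁]
      · intro hk
        have hk' : (π (k + 1)).1.1 = false := hk
        simp [lab, hk', a₂]
    let A₁ : Set (V × V) := {e | ∃ᶠ k in atTop, k ∈ S₁ ∧ (r₁.lab (a₁ k), r₁.lab (a₁ (k + 1))) = e}
    let A₂ : Set (V × V) := {e | ∃ᶠ k in atTop, k ∈ S₂ ∧ (r₂.lab (a₂ k), r₂.lab (a₂ (k + 1))) = e}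
    have hunion : infEdges ((fun p : {p // inv p} => lab p) ∘ π) = A₁ ∪ A₂ := by
      ext e
      simp only [infEdges, A₁, A₂, Set.mem_ofPred_eq, Set.mem_union, Function.comp,
        ← frequently_or_distrib]
      refine frequently_congr (Eventually.of_forall fun k => ?_)
      by_cases hk : k ∈ S₁
      · have : k ∉ S₂ := (hcompl k).1 hk
        simp [hk, this, (hlab k).1 hk, (hlab' k).1 hk]
      · have h2 : k ∈ S₂ := by by_contra h; exact hk ((hcompl k).2 h)
        simp [hk, h2, (hlab k).2 h2, (hlab' k).2 h2]
    have hB₁ : S₁.Infinite → Bad A₁ := fun h => r₁.bad_of_stutter a₁ S₁ h (fun k hk => (hR₁ k hk).1)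
      fun k hk => (hR₂ k (by by_contra h; exact hk ((hcompl k).2 h))).2
    have hB₂ : S₂.Infinite → Bad A₂ := fun h => r₂.bad_of_stutter a₂ S₂ h (fun k hk => (hR₂ k hk).1)
      fun k hk => (hR₁ k ((hcompl k).2 hk)).2
    -- A refutation that moves only finitely often contributes no recurring edge; both cannot stop,
    -- and if both keep moving, closure under union applies.
    have hE₁ : ¬ S₁.Infinite → A₁ = ∅ := by
      intro h
      refine Set.eq_empty_of_forall_notMem fun e he => h ?_
      exact Nat.frequently_atTop_iff_infinite.1 (he.mono fun k hk => hk.1)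
    have hE₂ : ¬ S₂.Infinite → A₂ = ∅ := by
      intro h
      refine Set.eq_empty_of_forall_notMem fun e he => h ?_
      exact Nat.frequently_atTop_iff_infinite.1 (he.mono fun k hk => hk.1)
    show Bad (infEdges ((fun p : {p // inv p} => lab p) ∘ π))
    rw [hunion]
    by_cases h1 : S₁.Infinite <;> by_cases h2 : S₂.Infinite
    · exact hBad _ _ (hB₁ h1) (hB₂ h2)
    · rw [hE₂ h2, Set.union_empty]; exact hB₁ h1
    · rw [hE₁ h1, Set.empty_union]; exact hB₂ h2
    · exfalso
      have : (Set.univ : Set ℕ) ⊆ S₁ ∪ S₂ := by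
        intro k _
        by_cases hk : k ∈ S₁
        · exact Or.inl hk
        · exact Or.inr (by by_contra h; exact hk ((hcompl k).2 h))
      exact Set.infinite_univ (((Set.not_infinite.1 h1).union (Set.not_infinite.1 h2)).subset this)

/-- A refutation of a subgame in which only moves at `v₀` are missing, and which avoids `v₀`. -/
def Refutation.extend {G G₁ : GameGraph V} {Bad : Set (V × V) → Prop} (v₀ : V)
    (ho₁ : G₁.owner = G.owner) (hle₁ : ∀ u v, G₁.edge u v → G.edge u v)
    (he₁ : ∀ u v, u ≠ v₀ → G.edge u v → G₁.edge u v)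
    (r : G₁.Refutation Bad) (hr : ∀ q, r.lab q ≠ v₀) : G.Refutation Bad where
  Q := r.Q
  lab := r.lab
  R := r.R
  move_zero q hq w hw := r.move_zero q (by rwa [ho₁]) w (he₁ _ _ (hr q) hw)
  move_one q hq := by
    obtain ⟨q', h1, h2⟩ := r.move_one q (by rwa [ho₁])
    exact ⟨q', h1, hle₁ _ _ h2⟩
  bad := r.bad

/-- Half-positional determinacy: for an objective given by a family of edge sets closed under
unions, player `0` has a memoryless strategy that is safe wherever player `1` has no refutation. -/
theorem exists_memoryless [Finite V] (Bad : Set (V × V) → Prop)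
    (hBad : ∀ A B, Bad A → Bad B → Bad (A ∪ B)) (G : GameGraph V) :
    ∃ f : V → V, (∀ v, G.edge v (f v)) ∧
      ∀ v, G.SafeFrom Bad f v ∨ ∃ (r : G.Refutation Bad) (q : r.Q), r.lab q = v := by
  induction hN : Set.ncard {e : V × V | G.edge e.1 e.2} using Nat.strong_induction_on
    generalizing G with
  | _ N ih =>
  by_cases hbase : ∀ v, G.owner v = 0 → ∀ a b, G.edge v a → G.edge v b → a = b
  · choose f hf using G.exists_edge
    refine ⟨f, hf, fun v => ?_⟩
    by_cases hs : G.SafeFrom Bad f v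
    · exact Or.inl hs
    · right
      simp only [SafeFrom, not_forall, not_not] at hs
      obtain ⟨ρ, h0, hρ, hb⟩ := hs
      -- Player `0` has no choice, so the bad play itself, with times as states, is a refutation.
      refine ⟨⟨ℕ, ρ, fun i j => j = i + 1, fun k hk w hw => ⟨k + 1, rfl, ?_⟩,
        fun k _ => ⟨k + 1, rfl, (hρ k).1⟩, fun π hπ => ?_⟩, (0 : ℕ), h0⟩
      · exact hbase _ hk _ _ (hρ k).1 hw
      · have : π = fun k => π 0 + k := by
          funext k
          induction k with
          | zero => rfl
          | succ k ih => rw [hπ, ih, add_assoc]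
        rw [this]
        exact (infEdges_shift ρ (π 0)).symm ▸ hb
  · push Not at hbase
    obtain ⟨v₀, h₀, a, b, ha, hb, hab⟩ := hbase
    -- The moves at a vertex with a real choice are split into `a` alone and all the others. Both
    -- subgames lose an edge, so induction on the number of edges applies to each.
    let G₁ := G.restrict (fun u v => u = v₀ → v = a) (fun v => by
      by_cases h : v = v₀
      · exact ⟨a, h ▸ ha, fun _ => rfl⟩
      · obtain ⟨w, hw⟩ := G.exists_edge v; exact ⟨w, hw, fun h' => absurd h' h⟩)
    let G₂ := G.restrict (fun u v => u = v₀ → v ≠ a) (fun v => by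
      by_cases h : v = v₀
      · exact ⟨b, h ▸ hb, fun _ => hab.symm⟩
      · obtain ⟨w, hw⟩ := G.exists_edge v; exact ⟨w, hw, fun h' => absurd h' h⟩)
    have hle₁ : ∀ u v, G₁.edge u v → G.edge u v := fun _ _ h => h.1
    have hle₂ : ∀ u v, G₂.edge u v → G.edge u v := fun _ _ h => h.1
    have he₁ : ∀ u v, u ≠ v₀ → G.edge u v → G₁.edge u v := fun _ _ h h' => ⟨h', fun e => absurd e h⟩
    have he₂ : ∀ u v, u ≠ v₀ → G.edge u v → G₂.edge u v := fun _ _ h h' => ⟨h', fun e => absurd e h⟩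
    have hc₁ : Set.ncard {e : V × V | G₁.edge e.1 e.2} < N := by
      rw [← hN]
      refine Set.ncard_lt_ncard ⟨fun e he => he.1, fun h => ?_⟩ (Set.toFinite _)
      exact hab ((h (show (v₀, b) ∈ {e : V × V | G.edge e.1 e.2} from hb)).2 rfl).symm
    have hc₂ : Set.ncard {e : V × V | G₂.edge e.1 e.2} < N := by
      rw [← hN]
      refine Set.ncard_lt_ncard ⟨fun e he => he.1, fun h => ?_⟩ (Set.toFinite _)
      exact (h (show (v₀, a) ∈ {e : V × V | G.edge e.1 e.2} from ha)).2 rfl rfl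
    obtain ⟨f₁, hf₁, hd₁⟩ := ih _ hc₁ G₁ rfl
    obtain ⟨f₂, hf₂, hd₂⟩ := ih _ hc₂ G₂ rfl
    have lift : ∀ (G' : GameGraph V) (f : V → V), G'.owner = G.owner →
        (∀ u v, u ≠ v₀ → G.edge u v → G'.edge u v) → (∀ v, G'.edge v (f v)) →
        ∀ v, G'.SafeFrom Bad f v → G.SafeFrom Bad f v := by
      intro G' f ho he hf v hs ρ hρ0 hρ
      refine hs ρ hρ0 fun k => ⟨?_, ho ▸ (hρ k).2⟩
      by_cases hk : ρ k = v₀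
      · rw [(hρ k).2 (by rw [hk, h₀])]; exact hf _
      · exact he _ _ hk (hρ k).1
    -- If `v₀` is safe in the subgame, no refutation of the subgame can contain `v₀`; the missing
    -- moves are then irrelevant to it, and it refutes in `G` too.
    have easy : ∀ (G' : GameGraph V) (f : V → V), G'.owner = G.owner →
        (∀ u v, G'.edge u v → G.edge u v) →
        (∀ u v, u ≠ v₀ → G.edge u v → G'.edge u v) → (∀ v, G'.edge v (f v)) →
        (∀ v, G'.SafeFrom Bad f v ∨ ∃ (r : G'.Refutation Bad) (q : r.Q), r.lab q = v) →
        G'.SafeFrom Bad f v₀ →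
        ∀ v, G.SafeFrom Bad f v ∨ ∃ (r : G.Refutation Bad) (q : r.Q), r.lab q = v := by
      intro G' f ho hle he hf hd hs v
      rcases hd v with h | ⟨r, q, hq⟩
      · exact Or.inl (lift G' f ho he hf v h)
      · right
        refine ⟨r.extend (G := G) (G₁ := G') v₀ ho hle he fun q' hq' => ?_, q, hq⟩
        exact r.not_safeFrom (fun _ v _ => hf v) q' (hq' ▸ hs)
    rcases hd₁ v₀ with h1 | -
    · exact ⟨f₁, fun v => (hf₁ v).1, easy G₁ f₁ rfl hle₁ he₁ hf₁ hd₁ h1⟩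
    rcases hd₂ v₀ with h2 | ⟨r₂, q₂, hq₂⟩
    · exact ⟨f₂, fun v => (hf₂ v).1, easy G₂ f₂ rfl hle₂ he₂ hf₂ hd₂ h2⟩
    have hsplit : ∀ v, G.edge v₀ v → G₁.edge v₀ v ∨ G₂.edge v₀ v := by
      intro v hv
      by_cases h : v = a
      · exact Or.inl ⟨hv, fun _ => h⟩
      · exact Or.inr ⟨hv, fun _ => h⟩
    refine ⟨f₁, fun v => (hf₁ v).1, fun v => ?_⟩
    rcases hd₁ v with h | ⟨r, q, hq⟩
    · exact Or.inl (lift G₁ f₁ rfl he₁ hf₁ v h)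
    · right
      obtain ⟨r', hr'⟩ := Refutation.exists_mix (G := G) (G₁ := G₁) (G₂ := G₂) hBad v₀ h₀ rfl rfl
        hle₁ he₁ hle₂ he₂ hsplit r r₂ q₂ hq₂
      obtain ⟨q', hq'⟩ := hr' q
      exact ⟨r', q', hq'.trans hq⟩

end GameGraph

open Filter

/-! ### Edge sets that violate the objective -/

/-- The maximal priority `p` of the sources in `A` is odd, and no set `al g` with `g < m`
contains `A`. -/
def BadSet {V : Type*} (p : V → ℕ) (al : ℕ → V × V → Prop) (m : ℕ) (A : Set (V × V)) : Prop :=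
  (∃ e₀ ∈ A, Odd (p e₀.1) ∧ ∀ e ∈ A, Even (p e.1) → p e.1 < p e₀.1) ∧
    ∀ g < m, ∃ e ∈ A, ¬ al g e

theorem BadSet.union {V : Type*} {p : V → ℕ} {al : ℕ → V × V → Prop} {m : ℕ} (A B : Set (V × V))
    (hA : BadSet p al m A) (hB : BadSet p al m B) : BadSet p al m (A ∪ B) := by
  obtain ⟨⟨a, ha, hao, ha'⟩, hAg⟩ := hA
  obtain ⟨⟨b, hb, hbo, hb'⟩, -⟩ := hB
  refine ⟨?_, fun g hg => ?_⟩
  · rcases le_total (p a.1) (p b.1) with h | h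
    · refine ⟨b, Or.inr hb, hbo, ?_⟩
      rintro e (he | he) hev
      · exact (ha' e he hev).trans_le h
      · exact hb' e he hev
    · refine ⟨a, Or.inl ha, hao, ?_⟩
      rintro e (he | he) hev
      · exact ha' e he hev
      · exact (hb' e he hev).trans_le h
  · obtain ⟨e, he, h⟩ := hAg g hg
    exact ⟨e, Or.inl he, h⟩

/-- Only the parity and the relative order of priorities matter; this permits replacing large
priorities by small ranks. -/
theorem BadSet.congr_prio {V : Type*} {p q : V → ℕ} {al : ℕ → V × V → Prop} {m : ℕ}
    (hpar : ∀ v, Even (p v) ↔ Even (q v)) (hlt : ∀ u v, p u < p v → q u < q v)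
    {A : Set (V × V)} (h : BadSet p al m A) : BadSet q al m A := by
  obtain ⟨⟨a, ha, hao, ha'⟩, hg⟩ := h
  refine ⟨⟨a, ha, ?_, fun e he hev => hlt _ _ (ha' e he ((hpar _).2 hev))⟩, hg⟩
  rw [← Nat.not_even_iff_odd] at hao ⊢
  rwa [← hpar]

/-- The moves that keep the assumption of `g` violated. -/
def GameGraph.PersLiveGroup.Allowed {V : Type*} {G : GameGraph V} (g : G.PersLiveGroup)
    (e : V × V) : Prop :=
  e.1 ∈ g.S ∧ e.1 ∉ g.T ∧ ∀ w, (e.1, w) ∈ g.C → w = e.2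

/-- Negating the formula yields a suffix that stays in `S`, obeys `C` and never meets `T`, that is,
a suffix of allowed moves only. -/
theorem GameGraph.PersLiveGroup.assumption_iff {V : Type*} {G : GameGraph V}
    (g : G.PersLiveGroup) (ρ : ℕ → V) :
    g.assumption ρ ↔ ∃ᶠ k in atTop, ¬ g.Allowed (ρ k, ρ (k + 1)) := by
  rw [← not_iff_not, not_frequently, eventually_atTop]
  simp only [assumption, LTL.always, LTL.eventually, LTL.atom, LTL.next, contAssumption, Allowed,
    not_not, not_forall, not_exists, Prod.forall, Set.mem_singleton_iff, exists_prop, add_zero]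
  refine exists_congr fun k => ⟨?_, ?_⟩
  · rintro ⟨h1, h2⟩ j hj
    obtain ⟨i, rfl⟩ := Nat.exists_eq_add_of_le hj
    refine ⟨(h1 i).1, h2 i, fun w hw => ?_⟩
    have := (h1 i).2 _ _ hw rfl
    rw [← this, add_assoc]
  · intro h
    refine ⟨fun i => ⟨(h (k + i) (by omega)).1, fun a b hab ha => ?_⟩, fun i =>
      (h (k + i) (by omega)).2.1⟩
    rw [← add_assoc, (h (k + i) (by omega)).2.2 b (by rw [ha]; exact hab)]

namespace PersParityGame

/-- The moves allowed by the `g`-th live group. -/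
def al (𝔊 : PersParityGame) (g : ℕ) (e : Fin 𝔊.n × Fin 𝔊.n) : Prop :=
  ∃ h : g < 𝔊.groups.length, (𝔊.groups[g]).Allowed e

theorem not_objective_iff (𝔊 : PersParityGame) (ρ : ℕ → Fin 𝔊.n) :
    ¬ 𝔊.objective ρ ↔ BadSet 𝔊.prio 𝔊.al 𝔊.groups.length (infEdges ρ) := by
  have hinf : ∀ i, LTL.always (LTL.eventually (LTL.atom {v | 𝔊.prio v = i})) ρ ↔
      ∃ e ∈ infEdges ρ, 𝔊.prio e.1 = i := by
    intro i
    rw [← frequently_iff_exists_infEdges ρ fun e => 𝔊.prio e.1 = i, frequently_atTop]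
    simp only [LTL.always, LTL.eventually, LTL.atom, Set.mem_ofPred_eq, add_zero]
    refine forall_congr' fun k => ⟨?_, ?_⟩
    · rintro ⟨j, hj⟩; exact ⟨k + j, by omega, hj⟩
    · rintro ⟨j, hj, h⟩
      obtain ⟨i, rfl⟩ := Nat.exists_eq_add_of_le hj
      exact ⟨i, h⟩
  unfold objective BadSet parityObjective
  simp only [hinf, Classical.not_imp, not_forall, not_exists, not_and]
  rw [and_comm]
  refine and_congr ⟨?_, ?_⟩ ⟨?_, ?_⟩
  · rintro ⟨i, hi, ⟨e, he, rfl⟩, h⟩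
    refine ⟨e, he, hi, fun e' he' hev => ?_⟩
    by_contra! hlt
    rcases hlt.lt_or_eq with h' | h'
    · exact h _ hev h' e' he' rfl
    · rw [← h', ← Nat.not_odd_iff_even] at hev; exact hev hi
  · rintro ⟨e, he, hi, h⟩
    exact ⟨_, hi, ⟨e, he, rfl⟩, fun j hj hlt e' he' hee => by
      have := h e' he' (hee ▸ hj); omega⟩
  · intro h g hg
    have := (GameGraph.PersLiveGroup.assumption_iff _ ρ).1 (h 𝔊.groups[g] (List.getElem_mem hg))
    obtain ⟨e, he, hne⟩ := (frequently_iff_exists_infEdges ρ fun e => ¬ 𝔊.groups[g].Allowed e).1 this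
    exact ⟨e, he, fun ⟨_, h⟩ => hne h⟩
  · intro h g hg
    obtain ⟨i, hi, rfl⟩ := List.getElem_of_mem hg
    obtain ⟨e, he, hne⟩ := h i hi
    rw [GameGraph.PersLiveGroup.assumption_iff]
    exact (frequently_iff_exists_infEdges ρ fun e => ¬ 𝔊.groups[i].Allowed e).2 ⟨e, he, fun h => hne ⟨hi, h⟩⟩

end PersParityGame

/-! ### Progress measures -/

/-- The number of positions `z ≤ x` whose level is at least `θ`. -/
def comp (lev : ℕ → ℕ) (θ x : ℕ) : ℕ := ((Finset.range (x + 1)).filter fun z => θ ≤ lev z).card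

theorem comp_succ (lev : ℕ → ℕ) (θ x : ℕ) :
    comp lev θ (x + 1) = comp lev θ x + if θ ≤ lev (x + 1) then 1 else 0 := by
  unfold comp
  rw [Finset.range_add_one, Finset.filter_insert]
  split_ifs with h
  · rw [Finset.card_insert_of_notMem (by simp)]
  · rfl

theorem comp_mono (lev : ℕ → ℕ) (θ : ℕ) : Monotone (comp lev θ) :=
  monotone_nat_of_le_succ fun x => by rw [comp_succ]; omega

theorem comp_lt (lev : ℕ → ℕ) {θ x y : ℕ} (h : y < x) (hx : θ ≤ lev x) :
    comp lev θ y < comp lev θ x := by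
  obtain ⟨z, rfl⟩ := Nat.exists_eq_add_of_lt h
  rw [comp_succ, if_pos hx]
  have := comp_mono lev θ (show y ≤ y + z by omega)
  omega

/-- Positions counted by the higher threshold are also counted by the lower one, so between `x` and
`y` the lower count grows at least as much. -/
theorem comp_add_comp_le (lev : ℕ → ℕ) {θ θ' x y : ℕ} (hθ : θ ≤ θ') (h : x ≤ y) :
    comp lev θ' y + comp lev θ x ≤ comp lev θ y + comp lev θ' x := by
  induction y, h using Nat.le_induction with
  | base => omega
  | succ y _ ih =>
    rw [comp_succ, comp_succ]
    split_ifs <;> omega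

/-- The condition on the values `x` at `e.1` and `y` at `e.2` of a progress measure for a move `e`
whose source has rank `2 * θ - 2 + o`. -/
def MoveOK {V : Type*} (lev lab : ℕ → ℕ) (al : ℕ → V × V → Prop) (θ o : ℕ) (e : V × V)
    (x y : ℕ) : Prop :=
  (lab x ≠ 0 ∧ θ ≤ lev x ∧ (y < x ∨ (y = x ∧ al (lab x - 1) e))) ∨
    (¬ (lab x ≠ 0 ∧ θ ≤ lev x) ∧ comp lev θ y + o ≤ comp lev θ x)

/-- Lowering the value of the target preserves the condition. This is what gives a least measure. -/
theorem MoveOK.antitone {V : Type*} {lev lab : ℕ → ℕ} {al : ℕ → V × V → Prop} {θ o : ℕ}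
    {e : V × V} {x y y' : ℕ} (h : MoveOK lev lab al θ o e x y) (hy : y' ≤ y) :
    MoveOK lev lab al θ o e x y' := by
  rcases h with ⟨h1, h2, h3⟩ | ⟨h1, h2⟩
  · refine Or.inl ⟨h1, h2, ?_⟩
    rcases h3 with h3 | ⟨rfl, h3⟩
    · exact Or.inl (hy.trans_lt h3)
    · rcases hy.lt_or_eq with h | h
      · exact Or.inl h
      · exact Or.inr ⟨h, h3⟩
  · exact Or.inr ⟨h1, by have := comp_mono lev θ hy; omega⟩

/-- A move of low rank does not increase the counts for higher thresholds. In the unlabelled case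
the position itself may go up, but then an increase of a higher count would entail one for `θ`. -/
theorem MoveOK.comp_le {V : Type*} {lev lab : ℕ → ℕ} {al : ℕ → V × V → Prop} {θ o : ℕ}
    {e : V × V} {x y θ' : ℕ} (h : MoveOK lev lab al θ o e x y) (hθ : θ ≤ θ') :
    comp lev θ' y ≤ comp lev θ' x := by
  rcases h with ⟨_, _, h3⟩ | ⟨_, h2⟩
  · exact comp_mono _ _ (by omega)
  · rcases le_total y x with h | h
    · exact comp_mono _ _ h
    · have := comp_add_comp_le lev hθ h; omega

/-- A sequence that respects a progress measure satisfies the objective. -/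
theorem not_badSet_of_moveOK {V : Type*} [Finite V] {lev lab : ℕ → ℕ} {al : ℕ → V × V → Prop}
    {m : ℕ} {c o : V → ℕ} (ho : ∀ v, o v < 2) {μ : V → ℕ} {ρ : ℕ → V}
    (hlab : ∀ k, lab (μ (ρ k)) ≤ m)
    (h : ∀ k, MoveOK lev lab al (c (ρ k) + 1) (o (ρ k)) (ρ k, ρ (k + 1)) (μ (ρ k)) (μ (ρ (k + 1)))) :
    ¬ BadSet (fun v => 2 * c v + o v) al m (infEdges ρ) := by
  rintro ⟨⟨a, ha, hao, ha'⟩, hg⟩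
  -- Among the recurring edges of odd rank the largest is selected; by badness it dominates all
  -- recurring edges.
  obtain ⟨e₀, ⟨he₀, ho₀⟩, hmax⟩ := Set.exists_max_image
    {e ∈ infEdges ρ | Odd (2 * c e.1 + o e.1)} (fun e => 2 * c e.1 + o e.1) (Set.toFinite _)
    ⟨a, ha, hao⟩
  have hle : ∀ e ∈ infEdges ρ, 2 * c e.1 + o e.1 ≤ 2 * c e₀.1 + o e₀.1 := by
    intro e he
    rcases Nat.even_or_odd (2 * c e.1 + o e.1) with hev | hod
    · exact (ha' e he hev).le.trans (hmax a ⟨ha, hao⟩)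
    · exact hmax e ⟨he, hod⟩
  have ho₁ : o e₀.1 = 1 := by
    have := ho e₀.1
    rw [Nat.odd_iff] at ho₀; omega
  have hev : ∀ᶠ k in atTop, c (ρ k) ≤ c e₀.1 := by
    by_contra hc
    rw [not_eventually] at hc
    obtain ⟨e, he, hlt⟩ := (frequently_iff_exists_infEdges ρ fun e => ¬ c e.1 ≤ c e₀.1).1
      hc
    have := hle e he; have := ho e₀.1; omega
  obtain ⟨T, hT⟩ := eventually_atTop.1 hev
  -- Once only ranks up to that of `e₀` occur, this count never increases, hence it is eventually
  -- constant.
  set d : ℕ → ℕ := fun k => comp lev (c e₀.1 + 1) (μ (ρ k)) with hd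
  have hmono : ∀ k ≥ T, d (k + 1) ≤ d k := fun k hk =>
    (h k).comp_le (Nat.succ_le_succ (hT k hk))
  have hanti : ∀ j k, T ≤ j → j ≤ k → d k ≤ d j := by
    intro j k hj hjk
    induction k, hjk using Nat.le_induction with
    | base => rfl
    | succ k hk ih => exact (hmono k (hj.trans hk)).trans ih
  obtain ⟨T', hT', hconst⟩ : ∃ T' ≥ T, ∀ k ≥ T', d k = d T' := by
    obtain ⟨T', hT', hmin⟩ := exists_minimal_of_wellFoundedLT (P := fun v => ∃ k ≥ T, d k = v)
      ⟨d T, T, le_rfl, rfl⟩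
    obtain ⟨k₀, hk₀, rfl⟩ := hT'
    refine ⟨k₀, hk₀, fun k hk => le_antisymm (hanti _ _ hk₀ hk) ?_⟩
    exact hmin ⟨k, hk₀.trans hk, rfl⟩ (hanti _ _ hk₀ hk)
  obtain ⟨k, hk, hke⟩ := frequently_atTop.1 he₀ T'
  have hk1 : ρ k = e₀.1 := by rw [← hke]
  have hstep : ∀ j ≥ k, d (j + 1) = d j := fun j hj => by
    rw [hconst _ (by omega), hconst j (by omega)]
  -- At an occurrence of the odd edge `e₀` the unlabelled clause would force a strict decrease of
  -- `d`, so the labelled clause must apply.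
  obtain ⟨hx, hxl⟩ : lab (μ (ρ k)) ≠ 0 ∧ c e₀.1 + 1 ≤ lev (μ (ρ k)) := by
    rcases h k with ⟨h1, h2, -⟩ | ⟨-, h2⟩
    · exact ⟨h1, hk1 ▸ h2⟩
    · have := hstep k le_rfl
      simp only [hd] at this
      rw [hk1, ho₁, ← hk1] at h2
      rw [← hk1] at this
      omega
  -- The position itself is counted by `d`, so descending from it would lower `d`. The play is
  -- therefore stuck on one letter, and from then on its group allows every move.
  have hstay : ∀ j ≥ k, μ (ρ j) = μ (ρ k) →
      μ (ρ (j + 1)) = μ (ρ j) ∧ al (lab (μ (ρ k)) - 1) (ρ j, ρ (j + 1)) := by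
    intro j hj hμ
    rcases h j with ⟨h1, h2, h3 | h3⟩ | ⟨h1, h2⟩
    · have hlt := comp_lt lev h3 (hμ ▸ hxl)
      have := hstep j hj
      simp only [hd] at this
      omega
    · exact ⟨h3.1, hμ ▸ h3.2⟩
    · have := hT j (by omega)
      exact absurd ⟨hμ ▸ hx, hμ ▸ (by omega)⟩ h1
  have hall : ∀ j ≥ k, μ (ρ j) = μ (ρ k) := by
    intro j hj
    induction j, hj using Nat.le_induction with
    | base => rfl
    | succ j hj ih => rw [(hstay j hj ih).1, ih]
  obtain ⟨e, he, hne⟩ := hg (lab (μ (ρ k)) - 1) (by have := hlab k; omega)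
  obtain ⟨j, hj, hje⟩ := frequently_atTop.1 he k
  exact hne (hje ▸ (hstay j hj (hall j hj)).2)

open Filter

/-! ### Closed walks in strongly connected sets -/

/-- `w` restricted to `{0, …, n}` is a walk from `x` to `y`. -/
def IsWalk {V : Type*} (R : V → V → Prop) (x y : V) (n : ℕ) (w : ℕ → V) : Prop :=
  w 0 = x ∧ w n = y ∧ ∀ i < n, R (w i) (w (i + 1))

theorem IsWalk.exists_append {V : Type*} {R : V → V → Prop} {x y z : V} {n n' : ℕ} {w w' : ℕ → V}
    (h : IsWalk R x y n w) (h' : IsWalk R y z n' w') :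
    ∃ w'', IsWalk R x z (n + n') w'' ∧ (∀ i < n, (w'' i, w'' (i + 1)) = (w i, w (i + 1))) ∧
      ∀ i < n', (w'' (n + i), w'' (n + i + 1)) = (w' i, w' (i + 1)) := by
  have key : ∀ i, (if n + i ≤ n then w (n + i) else w' (n + i - n)) = w' i := by
    intro i
    split_ifs with hi
    · obtain rfl : i = 0 := by omega
      rw [add_zero, h.2.1, h'.1]
    · rw [Nat.add_sub_cancel_left]
  have key' : ∀ i ≤ n, (if i ≤ n then w i else w' (i - n)) = w i := fun i hi => if_pos hi
  refine ⟨fun i => if i ≤ n then w i else w' (i - n), ⟨?_, ?_, fun i hi => ?_⟩, fun i hi => ?_,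
    fun i hi => ?_⟩
  · exact (key' 0 (by omega)).trans h.1
  · exact (key n').trans h'.2.1
  · by_cases hin : i < n
    · beta_reduce
      rw [key' i (by omega), key' (i + 1) (by omega)]
      exact h.2.2 i hin
    · obtain ⟨j, rfl⟩ := Nat.exists_eq_add_of_le (not_lt.1 hin)
      beta_reduce
      rw [key j, add_assoc, key (j + 1)]
      exact h'.2.2 j (by omega)
  · beta_reduce
    rw [key' i (by omega), key' (i + 1) (by omega)]
  · beta_reduce
    rw [key i, add_assoc, key (i + 1)]

theorem IsWalk.single {V : Type*} {R : V → V → Prop} {x y : V} (h : R x y) :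
    IsWalk R x y 1 fun i => if i = 0 then x else y := by
  refine ⟨rfl, rfl, fun i hi => ?_⟩
  obtain rfl : i = 0 := by omega
  simpa using h

theorem exists_isWalk {V : Type*} {R : V → V → Prop} {x y : V} (h : Relation.ReflTransGen R x y) :
    ∃ n w, IsWalk R x y n w := by
  induction h with
  | refl => exact ⟨0, fun _ => x, rfl, rfl, by simp⟩
  | tail _ hyz ih =>
    obtain ⟨n, w, hw⟩ := ih
    obtain ⟨w', hw', -⟩ := hw.exists_append (IsWalk.single hyz)
    exact ⟨_, w', hw'⟩

/-- A closed walk through finitely many prescribed edges. -/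
theorem exists_closed_walk {V : Type*} {R : V → V → Prop} {K : Set V}
    (hK : ∀ x ∈ K, ∀ y ∈ K, Relation.ReflTransGen R x y) {x : V} (hx : x ∈ K)
    (F : Finset (V × V)) (hF : ∀ e ∈ F, R e.1 e.2 ∧ e.1 ∈ K ∧ e.2 ∈ K) :
    ∃ n w, IsWalk R x x n w ∧ ∀ e ∈ F, ∃ i < n, (w i, w (i + 1)) = e := by
  classical
  induction F using Finset.induction_on with
  | empty => exact ⟨0, fun _ => x, ⟨rfl, rfl, by simp⟩, by simp⟩
  | insert e F _ ih =>
    obtain ⟨n, w, hw, hwF⟩ := ih fun e he => hF e (Finset.mem_insert_of_mem he)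
    obtain ⟨he, h1, h2⟩ := hF e (Finset.mem_insert_self _ _)
    obtain ⟨n₁, w₁, hw₁⟩ := exists_isWalk (hK x hx e.1 h1)
    obtain ⟨n₂, w₂, hw₂⟩ := exists_isWalk (hK e.2 h2 x hx)
    obtain ⟨w₃, hw₃, hl₃, -⟩ := (IsWalk.single he).exists_append hw₂
    obtain ⟨w₄, hw₄, -, hr₄⟩ := hw₁.exists_append hw₃
    obtain ⟨w₅, hw₅, hl₅, hr₅⟩ := hw.exists_append hw₄
    refine ⟨_, w₅, hw₅, fun e' he' => ?_⟩
    rcases Finset.mem_insert.1 he' with rfl | he'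
    · refine ⟨n + n₁, by omega, ?_⟩
      rw [hr₅ n₁ (by omega)]
      have := hr₄ 0 (by omega)
      rw [add_zero] at this
      rw [this, hl₃ 0 (by omega)]
      simp
    · obtain ⟨i, hi, hie⟩ := hwF e' he'
      exact ⟨i, by omega, by rw [hl₅ i hi, hie]⟩

/-- In a strongly connected set with an edge, some path sees exactly all edges infinitely often. -/
theorem exists_infEdges_eq {V : Type*} [Finite V] {R : V → V → Prop} {K : Set V}
    (hR : ∀ x y, R x y → x ∈ K ∧ y ∈ K)
    (hK : ∀ x ∈ K, ∀ y ∈ K, Relation.ReflTransGen R x y) {e₀ : V × V} (he₀ : R e₀.1 e₀.2) :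
    ∃ ρ : ℕ → V, (∀ k, R (ρ k) (ρ (k + 1))) ∧ infEdges ρ = {e | R e.1 e.2} := by
  obtain ⟨n, w, hw, hwF⟩ := exists_closed_walk hK (hR _ _ he₀).1
    (Set.toFinite {e : V × V | R e.1 e.2}).toFinset (by simpa using fun a b h => ⟨h, hR a b h⟩)
  have hn : 0 < n := by
    obtain ⟨i, hi, -⟩ := hwF e₀ (by simpa using he₀)
    omega
  -- Repeating the closed walk: at the end of a period the index wraps to `0`, and `w n = w 0`.
  have hstep : ∀ k, (w (k % n), w ((k + 1) % n)) = (w (k % n), w (k % n + 1)) := by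
    intro k
    have hlt := Nat.mod_lt k hn
    rcases Nat.lt_or_ge (k % n + 1) n with h | h
    · rw [Nat.add_mod, Nat.mod_eq_of_lt (show 1 < n by omega), Nat.mod_eq_of_lt h]
    · have h' : k % n + 1 = n := by omega
      have : (k + 1) % n = 0 := by
        rw [← Nat.mod_add_mod, h', Nat.mod_self]
      rw [this, h', hw.1, hw.2.1]
  have hRk : ∀ k, R (w (k % n)) (w ((k + 1) % n)) := by
    intro k
    have := hw.2.2 (k % n) (Nat.mod_lt k hn)
    have h' : w ((k + 1) % n) = w (k % n + 1) := (Prod.ext_iff.1 (hstep k)).2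
    rwa [← h'] at this
  refine ⟨fun k => w (k % n), hRk, ?_⟩
  ext e
  simp only [infEdges, Set.mem_ofPred_eq, frequently_atTop]
  constructor
  · intro h
    obtain ⟨k, -, rfl⟩ := h 0
    exact hRk k
  · intro h N
    obtain ⟨i, hi, hie⟩ := hwF e (by simpa using h)
    refine ⟨i + n * N, by nlinarith, ?_⟩
    rw [hstep, Nat.add_mul_mod_self_left, Nat.mod_eq_of_lt hi, hie]

/-! ### A balanced decomposition -/

/-- A set with fewer than `2 * N` elements splits into two parts with fewer than `N` elements each
and a strongly connected part in between. -/
theorem exists_decomposition {V : Type*} [DecidableEq V] (H : V → V → Prop) (X : Finset V) {N : ℕ}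
    (hN : 0 < N) (hX : X.card < 2 * N) :
    ∃ A K B : Finset V, X = A ∪ (K ∪ B) ∧ A.card < N ∧ B.card < N ∧
      (∀ u ∈ A, ∀ v ∈ K ∪ B, ¬ H u v) ∧ (∀ u ∈ K, ∀ v ∈ B, ¬ H u v) ∧
      ∀ x ∈ K, ∀ y ∈ K, Relation.ReflTransGen (fun u v => H u v ∧ u ∈ K ∧ v ∈ K) x y := by
  classical
  let closed : Finset V → Prop := fun C => C ⊆ X ∧ ∀ u ∈ C, ∀ v ∈ X, H u v → v ∈ C
  -- `A` is a largest successor-closed subset with fewer than `N` elements.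
  obtain ⟨A, hA, hAmax⟩ := Finset.exists_max_image
    (X.powerset.filter fun C => closed C ∧ C.card < N) Finset.card
    ⟨∅, by simp [closed, hN]⟩
  simp only [Finset.mem_filter, Finset.mem_powerset] at hA hAmax
  obtain ⟨-, hAc, hAN⟩ := hA
  by_cases hAX : A = X
  · exact ⟨A, ∅, ∅, by simp [hAX], hAN, by simpa using hN, by simp, by simp, by simp⟩
  -- `A'` is a smallest successor-closed proper superset of `A`. By maximality of `A` it has at
  -- least `N` elements, which leaves fewer than `N` for `B = X \ A'`; the middle part is `K = A' \
  -- A`.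
  obtain ⟨A', hA', hAmin⟩ := Finset.exists_min_image
    (X.powerset.filter fun C => closed C ∧ A ⊂ C) Finset.card
    ⟨X, by simp [closed, (Finset.ssubset_iff_subset_ne.2 ⟨hAc.1, hAX⟩)]; tauto⟩
  simp only [Finset.mem_filter, Finset.mem_powerset] at hA' hAmin
  obtain ⟨-, hAc', hAA'⟩ := hA'
  have hN' : N ≤ A'.card := by
    by_contra! h
    have := hAmax A' ⟨hAc'.1, hAc', h⟩
    exact absurd (Finset.card_lt_card hAA') (by omega)
  refine ⟨A, A' \ A, X \ A', ?_, hAN, ?_, ?_, ?_, ?_⟩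
  · ext v
    have h1 := @hAc.1 v
    have h2 := @hAc'.1 v
    have h3 := @hAA'.1 v
    simp only [Finset.mem_union, Finset.mem_sdiff]
    tauto
  · rw [Finset.card_sdiff_of_subset hAc'.1]; omega
  · intro u hu v hv huv
    have hvX : v ∈ X := by
      simp only [Finset.mem_union, Finset.mem_sdiff] at hv
      rcases hv with h | h
      · exact hAc'.1 h.1
      · exact h.1
    have hvA := hAc.2 u hu v hvX huv
    have hvA' := hAA'.1 hvA
    simp only [Finset.mem_union, Finset.mem_sdiff] at hv
    tauto
  · intro u hu v hv huv
    simp only [Finset.mem_sdiff] at hu hv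
    exact hv.2 (hAc'.2 u hu.1 v hv.1 huv)
  · intro x hx y hy
    let R : V → V → Prop := fun u v => H u v ∧ u ∈ A' \ A ∧ v ∈ A' \ A
    -- Adding to `A` what is reachable from `x` inside `K` gives a successor-closed set strictly
    -- above `A`. By minimality it is all of `A'`, so `x` reaches every vertex of `K`.
    let C : Finset V := A ∪ (A' \ A).filter fun z => Relation.ReflTransGen R x z
    have hxC : x ∈ C := by
      simp only [C, Finset.mem_union, Finset.mem_filter]
      exact Or.inr ⟨hx, .refl⟩
    have hCA' : C ⊆ A' := by
      intro z hz
      simp only [C, Finset.mem_union, Finset.mem_filter, Finset.mem_sdiff] at hz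
      rcases hz with h | h
      · exact hAA'.1 h
      · exact h.1.1
    have hcl : closed C := by
      refine ⟨hCA'.trans hAc'.1, fun u hu v hv huv => ?_⟩
      have hu' := hu
      simp only [C, Finset.mem_union, Finset.mem_filter] at hu ⊢
      rcases hu with h | ⟨h, h'⟩
      · exact Or.inl (hAc.2 u h v hv huv)
      · by_cases hvA : v ∈ A
        · exact Or.inl hvA
        · have hvA' := hAc'.2 u (hCA' hu') v hv huv
          have hvK : v ∈ A' \ A := Finset.mem_sdiff.2 ⟨hvA', hvA⟩
          exact Or.inr ⟨hvK, h'.tail ⟨huv, h, hvK⟩⟩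
    have hle := hAmin C ⟨hcl.1, hcl, Finset.ssubset_iff_subset_ne.2 ⟨Finset.subset_union_left,
      fun h => (Finset.mem_sdiff.1 hx).2 (h ▸ hxC)⟩⟩
    have hEq := Finset.eq_of_subset_of_card_le hCA' hle
    have hyC : y ∈ C := hEq ▸ (Finset.mem_sdiff.1 hy).1
    simp only [C, Finset.mem_union, Finset.mem_filter] at hyC
    rcases hyC with h | h
    · exact absurd h (Finset.mem_sdiff.1 hy).2
    · exact h.2

/-! ### Words of levels and labels -/

/-- The level at position `x`; position `0` precedes the first letter. -/
def wlev (w : List (ℕ × ℕ)) (x : ℕ) : ℕ := (((0, 0) :: w).getD x (0, 0)).1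

/-- The label at position `x`; position `0` precedes the first letter. -/
def wlab (w : List (ℕ × ℕ)) (x : ℕ) : ℕ := (((0, 0) :: w).getD x (0, 0)).2

theorem wlev_append_left {w w' : List (ℕ × ℕ)} {x : ℕ} (hx : x ≤ w.length) :
    wlev (w ++ w') x = wlev w x := by
  unfold wlev
  rw [← List.cons_append, List.getD_append _ _ _ _ (by simp; omega)]

theorem wlab_append_left {w w' : List (ℕ × ℕ)} {x : ℕ} (hx : x ≤ w.length) :
    wlab (w ++ w') x = wlab w x := by
  unfold wlab
  rw [← List.cons_append, List.getD_append _ _ _ _ (by simp; omega)]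

theorem wlev_append_right {w w' : List (ℕ × ℕ)} {x : ℕ} (hx : x ≠ 0) :
    wlev (w ++ w') (w.length + x) = wlev w' x := by
  obtain ⟨x, rfl⟩ := Nat.exists_eq_succ_of_ne_zero hx
  change (((0, 0) :: (w ++ w')).getD (w.length + x + 1) (0, 0)).1 =
    (((0, 0) :: w').getD (x + 1) (0, 0)).1
  rw [List.getD_cons_succ, List.getD_cons_succ, List.getD_append_right _ _ _ _ (by omega),
    Nat.add_sub_cancel_left]

theorem wlab_append_right {w w' : List (ℕ × ℕ)} {x : ℕ} (hx : x ≠ 0) :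
    wlab (w ++ w') (w.length + x) = wlab w' x := by
  obtain ⟨x, rfl⟩ := Nat.exists_eq_succ_of_ne_zero hx
  change (((0, 0) :: (w ++ w')).getD (w.length + x + 1) (0, 0)).2 =
    (((0, 0) :: w').getD (x + 1) (0, 0)).2
  rw [List.getD_cons_succ, List.getD_cons_succ, List.getD_append_right _ _ _ _ (by omega),
    Nat.add_sub_cancel_left]

theorem wlev_zero (w : List (ℕ × ℕ)) : wlev w 0 = 0 := rfl

theorem wlab_zero (w : List (ℕ × ℕ)) : wlab w 0 = 0 := rfl

theorem comp_congr {l l' : ℕ → ℕ} {θ x : ℕ} (h : ∀ z ≤ x, l z = l' z) :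
    comp l θ x = comp l' θ x := by
  unfold comp
  congr 1
  refine Finset.filter_congr fun z hz => ?_
  rw [h z (by simpa [Nat.lt_succ_iff] using hz)]

theorem comp_zero {l : ℕ → ℕ} {θ : ℕ} (h : l 0 < θ) : comp l θ 0 = 0 := by
  unfold comp
  rw [Finset.card_eq_zero, Finset.filter_eq_empty_iff]
  intro z hz
  obtain rfl : z = 0 := by simpa using hz
  omega

theorem comp_wlev_zero {w : List (ℕ × ℕ)} {θ : ℕ} (h : 0 < θ) : comp (wlev w) θ 0 = 0 :=
  comp_zero (by simpa [wlev_zero] using h)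

theorem comp_append_left {w w' : List (ℕ × ℕ)} {θ x : ℕ} (hx : x ≤ w.length) :
    comp (wlev (w ++ w')) θ x = comp (wlev w) θ x :=
  comp_congr fun _ hz => wlev_append_left (hz.trans hx)

/-- Counts add under concatenation because the initial position `0` has level `0` and is not counted
for positive thresholds. -/
theorem comp_append_right {w w' : List (ℕ × ℕ)} {θ : ℕ} (hθ : 0 < θ) (x : ℕ) :
    comp (wlev (w ++ w')) θ (w.length + x) = comp (wlev w) θ w.length + comp (wlev w') θ x := by
  induction x with
  | zero => rw [add_zero, comp_append_left le_rfl, comp_wlev_zero hθ, add_zero]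
  | succ x ih => rw [← add_assoc, comp_succ, ih, add_assoc w.length,
      wlev_append_right (Nat.succ_ne_zero x), comp_succ, add_assoc]

theorem comp_anti {l : ℕ → ℕ} {θ θ' x : ℕ} (h : θ ≤ θ') : comp l θ' x ≤ comp l θ x :=
  Finset.card_le_card (Finset.monotone_filter_right _ fun _ _ h₁ => h.trans h₁)

/-! ### Placing vertex sets into words -/

/-- An embedding `μ` of the vertices in `X` into the positions of `w` that respects all moves
inside `X` and stays above the first letter of level at least `h`. -/
structure Placed {V : Type*} (H : V → V → Prop) (al : ℕ → V × V → Prop) (c o : V → ℕ)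
    (w : List (ℕ × ℕ)) (h : ℕ) (X : Finset V) (μ : V → ℕ) : Prop where
  le : ∀ u ∈ X, μ u ≤ w.length
  ok : ∀ u ∈ X, ∀ v ∈ X, H u v → MoveOK (wlev w) (wlab w) al (c u + 1) (o u) (u, v) (μ u) (μ v)
  pos : ∀ u ∈ X, 1 ≤ comp (wlev w) h (μ u)

section Placement

variable {V : Type*} {H : V → V → Prop} {al : ℕ → V × V → Prop} {c o : V → ℕ}

theorem MoveOK.append_left {w w' : List (ℕ × ℕ)} {θ o x y : ℕ} {e : V × V}
    (h : MoveOK (wlev w) (wlab w) al θ o e x y) (hx : x ≤ w.length) (hy : y ≤ w.length) :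
    MoveOK (wlev (w ++ w')) (wlab (w ++ w')) al θ o e x y := by
  unfold MoveOK at h ⊢
  rwa [wlev_append_left hx, wlab_append_left hx, comp_append_left hx, comp_append_left hy]

/-- Position `0` of `w'` becomes the last letter of `w`. The value `x = 0` is harmless only if that
letter has no label, whence the alternative in the last hypothesis. -/
theorem MoveOK.append_right {w w' : List (ℕ × ℕ)} {θ o x y : ℕ} {e : V × V} (hθ : 0 < θ)
    (h : MoveOK (wlev w') (wlab w') al θ o e x y) (hx : x ≠ 0 ∨ wlab w w.length = 0) :
    MoveOK (wlev (w ++ w')) (wlab (w ++ w')) al θ o e (w.length + x) (w.length + y) := by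
  rcases eq_or_ne x 0 with rfl | hx0
  · have hl : wlab (w ++ w') (w.length + 0) = 0 := by
      rw [add_zero, wlab_append_left le_rfl]; tauto
    rcases h with ⟨h1, -⟩ | ⟨-, h2⟩
    · exact absurd (wlab_zero w') h1
    · refine Or.inr ⟨fun h => h.1 hl, ?_⟩
      rw [comp_append_right hθ, comp_append_right hθ]; omega
  · unfold MoveOK at h ⊢
    rw [wlev_append_right hx0, wlab_append_right hx0, comp_append_right hθ, comp_append_right hθ]
    rcases h with ⟨h1, h2, h3⟩ | ⟨h1, h2⟩
    · exact Or.inl ⟨h1, h2, h3.imp (by omega) fun h => ⟨by omega, h.2⟩⟩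
    · exact Or.inr ⟨h1, by omega⟩

/-- A move back into the earlier word drops below a letter of level at least `h`. All relevant
counts decrease strictly, which satisfies even and odd ranks alike. -/
theorem MoveOK.append_cross {w w' : List (ℕ × ℕ)} {θ o h x y : ℕ} {e : V × V} (hθ : 0 < θ)
    (hθh : θ ≤ h) (ho : o < 2) (hy : y ≤ w.length) (hx : 1 ≤ comp (wlev w') h x) :
    MoveOK (wlev (w ++ w')) (wlab (w ++ w')) al θ o e (w.length + x) y := by
  have hx0 : x ≠ 0 := by
    rintro rfl
    rw [comp_wlev_zero (by omega)] at hx; omega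
  by_cases hc : wlab (w ++ w') (w.length + x) ≠ 0 ∧ θ ≤ wlev (w ++ w') (w.length + x)
  · exact Or.inl ⟨hc.1, hc.2, Or.inl (by omega)⟩
  · refine Or.inr ⟨hc, ?_⟩
    rw [comp_append_left hy, comp_append_right hθ]
    have := comp_mono (wlev w) θ hy
    have := comp_anti (l := wlev w') (x := x) hθh
    omega

theorem Placed.empty (w : List (ℕ × ℕ)) (h : ℕ) (μ : V → ℕ) :
    Placed H al c o w h (∅ : Finset V) μ := ⟨by simp, by simp, by simp⟩

/-- Moves from `B` to `A` cost nothing by `MoveOK.append_cross`, and moves from `A` to `B` are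
excluded, so the two placements may simply be put side by side. -/
theorem Placed.append [DecidableEq V] (ho : ∀ v, o v < 2) {w w' : List (ℕ × ℕ)} {h : ℕ}
    {A B : Finset V} {μ μ' : V → ℕ}
    (hA : Placed H al c o w h A μ) (hB : Placed H al c o w' h B μ') (hc : ∀ u ∈ B, c u < h)
    (hAB : ∀ u ∈ A, ∀ v ∈ B, ¬ H u v) :
    ∃ ν, Placed H al c o (w ++ w') h (A ∪ B) ν := by
  have hμ' : ∀ u ∈ B, μ' u ≠ 0 := by
    intro u hu h0
    have h1 := hB.pos u hu
    rw [h0, comp_wlev_zero (by have := hc u hu; omega)] at h1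
    omega
  have hB' : ∀ u ∈ A ∪ B, u ∉ A → u ∈ B := fun u hu hn => (Finset.mem_union.1 hu).resolve_left hn
  refine ⟨fun u => if u ∈ A then μ u else w.length + μ' u, fun u hu => ?_, fun u hu v hv huv => ?_,
    fun u hu => ?_⟩
  · rw [List.length_append]
    split_ifs with h1
    · have := hA.le u h1; omega
    · have := hB.le u (hB' u hu h1); omega
  · split_ifs with h1 h2 h2
    · exact (hA.ok u h1 v h2 huv).append_left (hA.le u h1) (hA.le v h2)
    · exact absurd huv (hAB u h1 v (hB' v hv h2))
    · exact MoveOK.append_cross (Nat.succ_pos _) (hc u (hB' u hu h1)) (ho u) (hA.le v h2)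
        (hB.pos u (hB' u hu h1))
    · exact (hB.ok u (hB' u hu h1) v (hB' v hv h2) huv).append_right (Nat.succ_pos _)
        (Or.inl (hμ' u (hB' u hu h1)))
  · split_ifs with h1
    · rw [comp_append_left (hA.le u h1)]; exact hA.pos u h1
    · have := hB.pos u (hB' u hu h1)
      rw [comp_append_right (by have := hc u (hB' u hu h1); omega)]
      omega

theorem Placed.pad [DecidableEq V] (ho : ∀ v, o v < 2) {w : List (ℕ × ℕ)} {h : ℕ}
    {X : Finset V} {μ : V → ℕ} (hX : Placed H al c o w h X μ) (hc : ∀ u ∈ X, c u < h)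
    (w₁ w₂ : List (ℕ × ℕ)) : ∃ ν, Placed H al c o (w₁ ++ (w ++ w₂)) h X ν := by
  obtain ⟨ν, hν⟩ := hX.append ho (Placed.empty w₂ h μ) (by simp) (by simp)
  obtain ⟨ν', hν'⟩ := (Placed.empty w₁ h μ).append ho hν (by simpa using hc) (by simp)
  exact ⟨ν', by simpa using hν'⟩

end Placement

/-! ### Universal words -/

/-- Every infinite path inside `X` is good. -/
def GoodOn {V : Type*} (H : V → V → Prop) (al : ℕ → V × V → Prop) (c o : V → ℕ) (m : ℕ)
    (X : Finset V) : Prop :=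
  ∀ ρ : ℕ → V, (∀ k, ρ k ∈ X) → (∀ k, H (ρ k) (ρ (k + 1))) →
    ¬ BadSet (fun v => 2 * c v + o v) al m (infEdges ρ)

/-- The word `w` hosts every good set of fewer than `N` vertices of rank below `2 * h`. -/
def Universal {V : Type*} (H : V → V → Prop) (al : ℕ → V × V → Prop) (c o : V → ℕ) (m : ℕ)
    (w : List (ℕ × ℕ)) (h N : ℕ) : Prop :=
  ∀ X : Finset V, X.card < N → GoodOn H al c o m X → (∀ u ∈ X, c u < h) →
    ∃ μ, Placed H al c o w h X μ

/-- One letter of level `h` for each label, and one without label. -/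
def midWord (m h : ℕ) : List (ℕ × ℕ) := (List.range m).map (fun g => (h, g + 1)) ++ [(h, 0)]

/-- Lower all levels to at most `h`. -/
def capWord (h : ℕ) (w : List (ℕ × ℕ)) : List (ℕ × ℕ) := w.map fun l => (min l.1 h, l.2)

/-- Blocks `capWord j w ++ midWord m j` for `j = h, …, 1, 1, …, h`. -/
def blockWord (m : ℕ) (w : List (ℕ × ℕ)) : ℕ → List (ℕ × ℕ)
  | 0 => []
  | h + 1 => (capWord (h + 1) w ++ midWord m (h + 1)) ++ blockWord m w h ++
      (capWord (h + 1) w ++ midWord m (h + 1))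

/-- A word that hosts all good sets with fewer than `2 ^ i` vertices. -/
def univWord (m n : ℕ) : ℕ → List (ℕ × ℕ)
  | 0 => []
  | i + 1 => blockWord m (univWord m n i) n

section Universality

variable {V : Type*} {H : V → V → Prop} {al : ℕ → V × V → Prop} {c o : V → ℕ} {m : ℕ}

theorem GoodOn.mono {X Y : Finset V} (h : GoodOn H al c o m X) (hY : Y ⊆ X) :
    GoodOn H al c o m Y := fun ρ hρ => h ρ fun k => hY (hρ k)

/-- Placement of a good set whose moves have rank at most `2 * h`; position `0` may be used. -/
theorem Universal.exists_measure (ho : ∀ v, o v < 2) {w : List (ℕ × ℕ)} {h N : ℕ}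
    (hw : Universal H al c o m w h N) (hlev : ∀ l ∈ w, l.1 ≤ h) {X : Finset V} (hX : X.card < N)
    (hg : GoodOn H al c o m X) (hr : ∀ u ∈ X, ∀ v ∈ X, H u v → 2 * c u + o u ≤ 2 * h) :
    ∃ μ : V → ℕ, (∀ u ∈ X, μ u ≤ w.length) ∧ ∀ u ∈ X, ∀ v ∈ X, H u v →
      MoveOK (wlev w) (wlab w) al (c u + 1) (o u) (u, v) (μ u) (μ v) := by
  have hwlev : ∀ x, wlev w x ≤ h := by
    intro x
    unfold wlev
    rcases Nat.lt_or_ge x ((0, 0) :: w).length with hx | hx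
    · rw [List.getD_eq_getElem _ _ hx]
      rcases List.mem_cons.1 (List.getElem_mem hx) with h0 | h0
      · rw [h0]; exact Nat.zero_le _
      · exact hlev _ h0
    · rw [List.getD_eq_default _ _ hx]; exact Nat.zero_le _
  have hcomp : ∀ x, comp (wlev w) (h + 1) x = 0 := by
    intro x
    unfold comp
    rw [Finset.card_eq_zero, Finset.filter_eq_empty_iff]
    intro z _
    have := hwlev z; omega
  obtain ⟨μ, hμ⟩ := hw (X.filter fun u => c u < h) ((Finset.card_filter_le _ _).trans_lt hX)
    (hg.mono (Finset.filter_subset _ _)) (by simp)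
  -- Any move inside `X` from a vertex sent to position `0` has rank exactly `2 * h`. It compares
  -- counts of positions of level at least `h + 1`, and there are none in `w`.
  refine ⟨fun u => if c u < h then μ u else 0, fun u hu => ?_, fun u hu v hv huv => ?_⟩
  · dsimp only
    split_ifs with h1
    · exact hμ.le u (by simp [hu, h1])
    · exact Nat.zero_le _
  · dsimp only
    have hle := hr u hu v hv huv
    split_ifs with h1 h2 h2
    · exact hμ.ok u (by simp [hu, h1]) v (by simp [hv, h2]) huv
    · have hpos := hμ.pos u (by simp [hu, h1])
      have := MoveOK.append_cross (al := al) (w := []) (w' := w) (e := (u, v)) (y := 0)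
        (Nat.succ_pos (c u)) h1 (ho u) le_rfl hpos
      simpa using this
    · have hcu : c u = h := by omega
      have hou : o u = 0 := by omega
      exact Or.inr ⟨by simp [wlab_zero], by simp [hcu, hou, hcomp]⟩
    · have hcu : c u = h := by omega
      have hou : o u = 0 := by omega
      exact Or.inr ⟨by simp [wlab_zero], by simp [hcu, hou, hcomp]⟩

theorem Universal.pad [DecidableEq V] (ho : ∀ v, o v < 2) {w : List (ℕ × ℕ)} {h N : ℕ}
    (hw : Universal H al c o m w h N) (w₁ w₂ : List (ℕ × ℕ)) :
    Universal H al c o m (w₁ ++ (w ++ w₂)) h N := fun X h1 h2 h3 => by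
  obtain ⟨μ, hμ⟩ := hw X h1 h2 h3
  exact hμ.pad ho h3 w₁ w₂

theorem placed_singleton_of_labelled {K : Finset V} {h g : ℕ} (hc : ∀ u ∈ K, c u < h)
    (hK : ∀ u ∈ K, ∀ v ∈ K, H u v → al g (u, v)) :
    Placed H al c o [(h, g + 1)] h K fun _ => 1 := by
  refine ⟨by simp, fun u hu v hv huv => Or.inl ⟨?_, ?_, Or.inr ⟨rfl, ?_⟩⟩, fun u hu => ?_⟩
  · simp [wlab]
  · simpa [wlev] using hc u hu
  · simpa [wlab] using hK u hu v hv huv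
  · have := comp_lt (wlev [(h, g + 1)]) (θ := h) (x := 1) (y := 0) (by omega) (by simp [wlev])
    omega

theorem placed_cons_of_measure {K : Finset V} {w : List (ℕ × ℕ)} {h : ℕ} {μ : V → ℕ}
    (hle : ∀ u ∈ K, μ u ≤ w.length) (hok : ∀ u ∈ K, ∀ v ∈ K, H u v →
      MoveOK (wlev w) (wlab w) al (c u + 1) (o u) (u, v) (μ u) (μ v)) :
    Placed H al c o ([(h, 0)] ++ w) h K fun u => [(h, 0)].length + μ u := by
  refine ⟨fun u hu => ?_, fun u hu v hv huv => ?_, fun u hu => ?_⟩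
  · have := hle u hu; simp; omega
  · exact (hok u hu v hv huv).append_right (Nat.succ_pos _) (Or.inr (by simp [wlab]))
  · have := comp_lt (wlev ([(h, 0)] ++ w)) (θ := h) (x := 1) (y := 0) (by omega) (by simp [wlev])
    have := comp_mono (wlev ([(h, 0)] ++ w)) h (show 1 ≤ [(h, 0)].length + μ u by simp)
    omega

/-- A strongly connected good set is placed behind a letter of level `h + 1`. -/
theorem exists_placed_of_strongly_connected [DecidableEq V] [Finite V] (ho : ∀ v, o v < 2) {w : List (ℕ × ℕ)} {h N : ℕ}
    (hw : Universal H al c o m w h N) (hlev : ∀ l ∈ w, l.1 ≤ h) {K : Finset V} (hK : K.card < N)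
    (hg : GoodOn H al c o m K) (hc : ∀ u ∈ K, c u < h + 1)
    (hsc : ∀ x ∈ K, ∀ y ∈ K, Relation.ReflTransGen (fun u v => H u v ∧ u ∈ K ∧ v ∈ K) x y) :
    ∃ μ, Placed H al c o (midWord m (h + 1) ++ w) (h + 1) K μ := by
  by_cases hr : ∀ u ∈ K, ∀ v ∈ K, H u v → 2 * c u + o u ≤ 2 * h
  -- Without moves of rank `2 * h + 1` the word `w` of lower level suffices. It is entered behind
  -- the unlabelled last letter of `midWord`, so that position `0` of `w` is usable.
  · obtain ⟨μ, hle, hok⟩ := hw.exists_measure ho hlev hK hg hr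
    obtain ⟨ν, hν⟩ := (placed_cons_of_measure (h := h + 1) hle hok).pad ho hc
      ((List.range m).map fun g => (h + 1, g + 1)) []
    exact ⟨ν, by simpa [midWord] using hν⟩
  · push Not at hr
    obtain ⟨u₀, hu₀, v₀, hv₀, huv₀, hlt⟩ := hr
    -- A path through all moves of `K` has the odd maximal rank `2 * h + 1`. It is good, so some
    -- group `g` must allow every move of `K`, and all of `K` is placed on the one letter labelled
    -- `g + 1`.
    obtain ⟨ρ, hρ, hinf⟩ := exists_infEdges_eq (R := fun u v => H u v ∧ u ∈ K ∧ v ∈ K)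
      (K := (K : Set V)) (fun _ _ h => h.2) hsc (e₀ := (u₀, v₀)) ⟨huv₀, hu₀, hv₀⟩
    have hnb := hg ρ (fun k => (hρ k).2.1) fun k => (hρ k).1
    rw [hinf, BadSet, not_and_or] at hnb
    rcases hnb with hnb | hnb
    · refine absurd ⟨(u₀, v₀), ⟨huv₀, hu₀, hv₀⟩, ?_, ?_⟩ hnb
      · have := hc u₀ hu₀; have := ho u₀
        rw [Nat.odd_iff]; dsimp only; omega
      · rintro e ⟨-, he, -⟩ hev
        have := hc _ he; have := ho e.1
        rw [Nat.even_iff] at hev; dsimp only at hev ⊢; omega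
    · push Not at hnb
      obtain ⟨g, hgm, hal⟩ := hnb
      obtain ⟨s, t, hst⟩ := List.append_of_mem (List.mem_range.2 hgm)
      obtain ⟨ν, hν⟩ := (placed_singleton_of_labelled (H := H) (o := o) (g := g) hc
        fun u hu v hv huv => hal _ ⟨huv, hu, hv⟩).pad ho hc (s.map fun g => (h + 1, g + 1))
        (t.map (fun g => (h + 1, g + 1)) ++ [(h + 1, 0)] ++ w)
      refine ⟨ν, ?_⟩
      simpa [midWord, hst] using hν

/-- In the balanced decomposition `A` goes to the first copy of `F`, the strongly connected part `K`
to `midWord` followed by `w`, and `B` to the second copy of `F`. The order fits because moves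
between the parts lead only to earlier ones. -/
theorem Universal.block [DecidableEq V] [Finite V] (ho : ∀ v, o v < 2) {F w : List (ℕ × ℕ)} {h N : ℕ} (hN : 0 < N)
    (hF : Universal H al c o m F (h + 1) N) (hw : Universal H al c o m w h (2 * N))
    (hlev : ∀ l ∈ w, l.1 ≤ h) :
    Universal H al c o m ((F ++ midWord m (h + 1)) ++ w ++ (F ++ midWord m (h + 1))) (h + 1)
      (2 * N) := by
  intro X hX hg hc
  obtain ⟨A, K, B, rfl, hA, hB, hAK, hKB, hsc⟩ := exists_decomposition H X hN hX
  have hKs : K ⊆ A ∪ (K ∪ B) := Finset.subset_union_left.trans Finset.subset_union_right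
  have hBs : B ⊆ A ∪ (K ∪ B) := Finset.subset_union_right.trans Finset.subset_union_right
  obtain ⟨μA, hμA⟩ := hF A hA (hg.mono Finset.subset_union_left)
    fun u hu => hc u (Finset.mem_union_left _ hu)
  obtain ⟨μB, hμB⟩ := hF B hB (hg.mono hBs) fun u hu => hc u (hBs hu)
  obtain ⟨μK, hμK⟩ := exists_placed_of_strongly_connected ho hw hlev
    ((Finset.card_le_card hKs).trans_lt hX) (hg.mono hKs) (fun u hu => hc u (hKs hu)) hsc
  obtain ⟨μ₁, hμ₁⟩ := hμK.append ho hμB (fun u hu => hc u (hBs hu)) hKB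
  obtain ⟨μ₂, hμ₂⟩ := hμA.append ho hμ₁ (fun u hu => hc u (Finset.mem_union_right _ hu)) hAK
  -- The final `midWord` hosts nothing; it gives all blocks the same shape, so that one loop can
  -- generate them.
  obtain ⟨μ₃, hμ₃⟩ := hμ₂.pad ho hc [] (midWord m (h + 1))
  exact ⟨μ₃, by simpa using hμ₃⟩

theorem capWord_append (h : ℕ) (w w' : List (ℕ × ℕ)) :
    capWord h (w ++ w') = capWord h w ++ capWord h w' := by simp [capWord]

theorem capWord_eq_self {h : ℕ} {w : List (ℕ × ℕ)} (hw : ∀ l ∈ w, l.1 ≤ h) : capWord h w = w := by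
  unfold capWord
  conv_rhs => rw [← List.map_id w]
  exact List.map_congr_left fun l hl => Prod.ext (min_eq_left (hw l hl)) rfl

theorem blockWord_le (m : ℕ) (w : List (ℕ × ℕ)) (h : ℕ) : ∀ l ∈ blockWord m w h, l.1 ≤ h := by
  induction h with
  | zero => simp [blockWord]
  | succ h ih =>
    intro l hl
    have key : l ∈ capWord (h + 1) w ++ midWord m (h + 1) → l.1 ≤ h + 1 := by
      intro hl
      simp only [capWord, midWord, List.mem_append, List.mem_map, List.mem_singleton] at hl
      rcases hl with ⟨l', -, rfl⟩ | ⟨g, -, rfl⟩ | rfl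
      · exact min_le_right _ _
      · exact le_rfl
      · exact le_rfl
    simp only [blockWord] at hl
    rcases List.mem_append.1 hl with h1 | h1
    · rcases List.mem_append.1 h1 with h2 | h2
      · exact key h2
      · exact (ih l h2).trans (Nat.le_succ h)
    · exact key h1

theorem univWord_le (m n i : ℕ) : ∀ l ∈ univWord m n i, l.1 ≤ n := by
  cases i with
  | zero => simp [univWord]
  | succ i => exact blockWord_le m _ n

/-- The blocks are nested around the centre with levels growing outwards, so capping at `h` leaves
the inner word intact. One word thus serves all levels `h` at once. -/
theorem capWord_blockWord (m : ℕ) (w : List (ℕ × ℕ)) {h h' : ℕ} (hh : h ≤ h') :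
    ∃ s t, capWord h (blockWord m w h') = s ++ (blockWord m w h ++ t) := by
  induction h', hh using Nat.le_induction with
  | base => exact ⟨[], [], by simpa using capWord_eq_self (blockWord_le m w h)⟩
  | succ h' _ ih =>
    obtain ⟨s, t, hst⟩ := ih
    rw [blockWord, capWord_append, capWord_append, hst]
    exact ⟨capWord h (capWord (h' + 1) w ++ midWord m (h' + 1)) ++ s,
      t ++ capWord h (capWord (h' + 1) w ++ midWord m (h' + 1)), by simp only [List.append_assoc]⟩

theorem universal_univWord [DecidableEq V] [Finite V] (ho : ∀ v, o v < 2) (n i : ℕ) :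
    ∀ h ≤ n, Universal H al c o m (capWord h (univWord m n i)) h (2 ^ i) := by
  induction i with
  | zero =>
    intro h _ X hX _ _
    obtain rfl : X = ∅ := by simpa using hX
    exact ⟨fun _ => 0, Placed.empty _ _ _⟩
  | succ i ih =>
    have hb : ∀ h ≤ n, Universal H al c o m (blockWord m (univWord m n i) h) h (2 * 2 ^ i) := by
      intro h
      induction h with
      | zero =>
        intro _ X _ _ hc
        obtain rfl : X = ∅ := Finset.eq_empty_of_forall_notMem fun u hu => absurd (hc u hu) (by omega)
        exact ⟨fun _ => 0, Placed.empty _ _ _⟩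
      | succ h ihh =>
        intro hh
        exact Universal.block ho (by positivity) (ih _ hh) (ihh (by omega)) (blockWord_le m _ h)
    intro h hh
    obtain ⟨s, t, hst⟩ := capWord_blockWord m (univWord m n i) hh
    rw [univWord, hst, pow_succ']
    exact (hb h hh).pad ho s t

/-- A good finite graph has a progress measure into the positions of `univWord m n i`. -/
theorem exists_measure_univWord [DecidableEq V] [Finite V] (ho : ∀ v, o v < 2) {n i : ℕ} {X : Finset V} (hX : X.card < 2 ^ i)
    (hg : GoodOn H al c o m X) (hc : ∀ v, c v < n) :
    ∃ μ : V → ℕ, (∀ u ∈ X, μ u ≤ (univWord m n i).length) ∧ ∀ u ∈ X, ∀ v ∈ X, H u v →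
      MoveOK (wlev (univWord m n i)) (wlab (univWord m n i)) al (c u + 1) (o u) (u, v)
        (μ u) (μ v) := by
  have h := universal_univWord (H := H) (al := al) (c := c) (m := m) ho n i n le_rfl
  rw [capWord_eq_self (univWord_le m n i)] at h
  refine h.exists_measure ho (univWord_le m n i) hX hg fun u _ v _ _ => ?_
  have := hc u; have := ho u; omega

end Universality

namespace RAM

/-! ### Registers of the source language and scratch registers -/

/-- The machine register of the variable `r`. -/
def usr (r : ℕ) : ℕ := 2 * r

/-- The `b`-th scratch register. -/
def scr (b : ℕ) : ℕ := 2 * b + 1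

@[simp] theorem usr_inj {r r' : ℕ} : usr r = usr r' ↔ r = r' := by unfold usr; omega
@[simp] theorem scr_inj {b b' : ℕ} : scr b = scr b' ↔ b = b' := by unfold scr; omega
@[simp] theorem usr_ne_scr {r b : ℕ} : usr r ≠ scr b := by unfold usr scr; omega
@[simp] theorem scr_ne_usr {r b : ℕ} : scr b ≠ usr r := by unfold usr scr; omega

theorem State.ext_iff' {s s' : State} : s = s' ↔ s.reg = s'.reg ∧ s.arr = s'.arr := by
  cases s; cases s'; simp

@[simp] theorem State.setReg_reg (s : State) (x k y : ℕ) :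
    (s.setReg x k).reg y = if y = x then k else s.reg y := Function.update_apply _ _ _ _

@[simp] theorem State.setReg_arr (s : State) (x k : ℕ) : (s.setReg x k).arr = s.arr := rfl

@[simp] theorem State.setArr_reg (s : State) (a i k : ℕ) : (s.setArr a i k).reg = s.reg := rfl

@[simp] theorem State.setArr_arr (s : State) (a i k b j : ℕ) :
    (s.setArr a i k).arr b j = if b = a ∧ j = i then k else s.arr b j := by
  unfold State.setArr
  by_cases h : b = a
  · subst h; simp [Function.update_apply]
  · simp [h]

@[simp] theorem State.setReg_setReg (s : State) (x k k' : ℕ) :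
    (s.setReg x k).setReg x k' = s.setReg x k' := by
  unfold State.setReg; simp

@[simp] theorem State.setReg_self (s : State) (x : ℕ) : s.setReg x (s.reg x) = s := by
  unfold State.setReg; simp

/-- The variables and the arrays of a machine state. -/
def view (s : State) : State := ⟨fun r => s.reg (usr r), s.arr⟩

@[simp] theorem view_reg (s : State) (r : ℕ) : (view s).reg r = s.reg (usr r) := rfl

@[simp] theorem view_arr (s : State) : (view s).arr = s.arr := rfl

@[simp] theorem view_setReg_usr (s : State) (r k : ℕ) :
    view (s.setReg (usr r) k) = (view s).setReg r k := by
  rw [State.ext_iff']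
  refine ⟨funext fun x => ?_, rfl⟩
  simp

@[simp] theorem view_setReg_scr (s : State) (b k : ℕ) : view (s.setReg (scr b) k) = view s := by
  rw [State.ext_iff']
  refine ⟨funext fun x => ?_, rfl⟩
  simp

@[simp] theorem view_setArr (s : State) (a i k : ℕ) :
    view (s.setArr a i k) = (view s).setArr a i k := rfl

/-! ### Expressions -/

/-- Expressions with bounded sums; `sum i r e` is the sum of `e` for the variable `i` running from
`0` to the value of the variable `r`, exclusively. -/
inductive Expr where
  | lit (k : ℕ)
  | var (r : ℕ)
  | add (e e' : Expr)
  | sub (e e' : Expr)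
  | get (a : ℕ) (e : Expr)
  | ite (e e₁ e₂ : Expr)
  | sum (i r : ℕ) (e : Expr)

namespace Expr

/-- The value of an expression. -/
def eval : Expr → State → ℕ
  | lit k, _ => k
  | var r, s => s.reg r
  | add e e', s => e.eval s + e'.eval s
  | sub e e', s => e.eval s - e'.eval s
  | get a e, s => s.arr a (e.eval s)
  | ite e e₁ e₂, s => if e.eval s ≠ 0 then e₁.eval s else e₂.eval s
  | sum i r e, s => ∑ k ∈ Finset.range (s.reg r), e.eval (s.setReg i k)

/-- A bound on the number of steps of the compiled expression. -/
def time : Expr → State → ℕ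
  | lit _, _ => 1
  | var _, _ => 1
  | add e e', s => e.time s + e'.time s + 1
  | sub e e', s => e.time s + e'.time s + 1
  | get _ e, s => e.time s + 1
  | ite e e₁ e₂, s => e.time s + e₁.time s + e₂.time s + 1
  | sum i r e, s => ∑ k ∈ Finset.range (s.reg r), (e.time (s.setReg i k) + 4) + 7

/-- Compilation; the value is left in the scratch register `B`, and the lower scratch registers
are preserved. -/
def compile : Expr → ℕ → Prog
  | lit k, B => .const (scr B) k
  | var r, B => .copy (scr B) (usr r)
  | add e e', B => .seq (e.compile B) (.seq (e'.compile (B + 1))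
      (.add (scr B) (scr B) (scr (B + 1))))
  | sub e e', B => .seq (e.compile B) (.seq (e'.compile (B + 1))
      (.sub (scr B) (scr B) (scr (B + 1))))
  | get a e, B => .seq (e.compile B) (.load (scr B) a (scr B))
  | ite e e₁ e₂, B => .seq (e.compile B) (.ite (scr B) (e₁.compile B) (e₂.compile B))
  | sum i r e, B => .seq (.const (scr B) 0) (.seq (.copy (scr (B + 1)) (usr r))
      (.seq (.copy (scr (B + 2)) (usr i)) (.seq (.const (scr (B + 3)) 1) (.seq (.const (usr i) 0)
        (.seq (.while (scr (B + 1)) (.seq (e.compile (B + 4))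
          (.seq (.add (scr B) (scr B) (scr (B + 4))) (.seq (.add (usr i) (usr i) (scr (B + 3)))
            (.sub (scr (B + 1)) (scr (B + 1)) (scr (B + 3)))))))
        (.copy (usr i) (scr (B + 2))))))))

/-- Correctness of compiled expressions. -/
def CompileSpec (e : Expr) : Prop := ∀ B s, ∃ t s', Exec (e.compile B) s t s' ∧
  t ≤ e.time (view s) ∧ view s' = view s ∧ s'.reg (scr B) = e.eval (view s) ∧
  ∀ b < B, s'.reg (scr b) = s.reg (scr b)

/-- The initial value of the summation variable is arbitrary so that induction on the number `j` of
remaining rounds goes through. Scratch `B` accumulates, `B + 1` counts down, `B + 2` saves the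
variable, `B + 3` holds one and `B + 4` receives each summand. -/
theorem CompileSpec.sum_loop {e : Expr} (he : e.CompileSpec) (B i j : ℕ) :
    ∀ (s : State), s.reg (scr (B + 1)) = j → s.reg (scr (B + 3)) = 1 →
    ∃ t s', Exec (.while (scr (B + 1)) (.seq (e.compile (B + 4))
          (.seq (.add (scr B) (scr B) (scr (B + 4))) (.seq (.add (usr i) (usr i) (scr (B + 3)))
            (.sub (scr (B + 1)) (scr (B + 1)) (scr (B + 3))))))) s t s' ∧
      t ≤ ∑ k ∈ Finset.range j, (e.time ((view s).setReg i (s.reg (usr i) + k)) + 4) + 1 ∧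
      view s' = (view s).setReg i (s.reg (usr i) + j) ∧
      s'.reg (scr B) = s.reg (scr B) +
        ∑ k ∈ Finset.range j, e.eval ((view s).setReg i (s.reg (usr i) + k)) ∧
      s'.reg (scr (B + 2)) = s.reg (scr (B + 2)) ∧
      ∀ b < B, s'.reg (scr b) = s.reg (scr b) := by
  induction j with
  | zero =>
    intro s hj _
    refine ⟨1, s, .while_done hj, by simp, ?_, by simp, rfl, fun _ _ => rfl⟩
    rw [add_zero, ← view_reg, State.setReg_self]
  | succ j ih =>
    intro s hj h1
    obtain ⟨t, s₁, hx, ht, hv, hr, hb⟩ := he (B + 4) s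
    have hbB := hb B (by omega)
    have hb1 := hb (B + 1) (by omega)
    have hb2 := hb (B + 2) (by omega)
    have hb3 := hb (B + 3) (by omega)
    have hvi : s₁.reg (usr i) = s.reg (usr i) := by rw [← view_reg, hv, view_reg]
    set s₂ := s₁.setReg (scr B) (s₁.reg (scr B) + s₁.reg (scr (B + 4))) with hs₂
    set s₃ := s₂.setReg (usr i) (s₂.reg (usr i) + s₂.reg (scr (B + 3))) with hs₃
    set s₄ := s₃.setReg (scr (B + 1)) (s₃.reg (scr (B + 1)) - s₃.reg (scr (B + 3))) with hs₄
    have hi₄ : s₄.reg (usr i) = s.reg (usr i) + 1 := by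
      simp [hs₄, hs₃, hs₂, hb3, h1, hvi]
    have hv₄ : view s₄ = (view s).setReg i (s.reg (usr i) + 1) := by
      simp [hs₄, hs₃, hs₂, hv, hb3, h1, hvi]
    obtain ⟨t', s', hx', ht', hv', hr', h2', hb'⟩ := ih s₄
      (by simp [hs₄, hs₃, hs₂, hb1, hb3, h1, hj]) (by simp [hs₄, hs₃, hs₂, hb3, h1])
    have hself : (view s).setReg i (s.reg (usr i)) = view s := by
      rw [← view_reg, State.setReg_self]
    have hassoc : ∀ k, s.reg (usr i) + 1 + k = s.reg (usr i) + (k + 1) := fun k => by omega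
    simp only [hv₄, hi₄, State.setReg_setReg, hassoc] at ht' hv' hr'
    refine ⟨_, s', .while_step (by rw [hj]; omega) (.seq hx (.seq (.add _ _ _ _)
      (.seq (.add _ _ _ _) (.sub _ _ _ _)))) hx', ?_, ?_, ?_, ?_, ?_⟩
    · rw [Finset.sum_range_succ', add_zero, hself]
      omega
    · rw [hv']
    · rw [hr', Finset.sum_range_succ', add_zero, hself]
      simp [hs₄, hs₃, hs₂, hbB, hr]
      ring
    · rw [h2']
      simp [hs₄, hs₃, hs₂, hb2]
    · intro b hbb
      rw [hb' b hbb]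
      have := hb b (by omega)
      simp [hs₄, hs₃, hs₂, this, show b ≠ B by omega, show b ≠ B + 1 by omega]

theorem compileSpec (e : Expr) : e.CompileSpec := by
  induction e with
  | lit k =>
    intro B s
    exact ⟨1, _, .const _ _ _, le_rfl, by simp, by simp [eval], fun b hb => by
      simp [hb.ne]⟩
  | var r =>
    intro B s
    exact ⟨1, _, .copy _ _ _, le_rfl, by simp, by simp [eval], fun b hb => by
      simp [hb.ne]⟩
  | add e e' ih ih' =>
    intro B s
    obtain ⟨t, s₁, hx, ht, hv, hr, hb⟩ := ih B s
    obtain ⟨t', s₂, hx', ht', hv', hr', hb'⟩ := ih' (B + 1) s₁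
    refine ⟨_, _, .seq hx (.seq hx' (.add _ _ _ _)), ?_, ?_, ?_, ?_⟩
    · simp only [time]; rw [hv] at ht'; omega
    · simp [hv', hv]
    · simp [eval, hb' B, hr, hr', hv]
    · intro b hbb
      simp [hbb.ne, hb' b (by omega), hb b hbb]
  | sub e e' ih ih' =>
    intro B s
    obtain ⟨t, s₁, hx, ht, hv, hr, hb⟩ := ih B s
    obtain ⟨t', s₂, hx', ht', hv', hr', hb'⟩ := ih' (B + 1) s₁
    refine ⟨_, _, .seq hx (.seq hx' (.sub _ _ _ _)), ?_, ?_, ?_, ?_⟩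
    · simp only [time]; rw [hv] at ht'; omega
    · simp [hv', hv]
    · simp [eval, hb' B, hr, hr', hv]
    · intro b hbb
      simp [hbb.ne, hb' b (by omega), hb b hbb]
  | get a e ih =>
    intro B s
    obtain ⟨t, s₁, hx, ht, hv, hr, hb⟩ := ih B s
    have ha : s₁.arr = s.arr := by rw [← view_arr, hv, view_arr]
    refine ⟨_, _, .seq hx (.load _ _ _ _), ?_, ?_, ?_, ?_⟩
    · simp only [time]; omega
    · simp [hv]
    · simp [eval, hr, ha]
    · intro b hbb
      simp [hbb.ne, hb b hbb]
  | ite e e₁ e₂ ih ih₁ ih₂ =>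
    intro B s
    obtain ⟨t, s₁, hx, ht, hv, hr, hb⟩ := ih B s
    by_cases h : e.eval (view s) = 0
    · obtain ⟨t', s₂, hx', ht', hv', hr', hb'⟩ := ih₂ B s₁
      refine ⟨_, _, .seq hx (.ite_neg (by rw [hr, h]) hx'), ?_, ?_, ?_, ?_⟩
      · simp only [time]; rw [hv] at ht'; omega
      · rw [hv', hv]
      · simp [eval, h, hr', hv]
      · intro b hbb
        rw [hb' b hbb, hb b hbb]
    · obtain ⟨t', s₂, hx', ht', hv', hr', hb'⟩ := ih₁ B s₁
      refine ⟨_, _, .seq hx (.ite_pos (by rwa [hr]) hx'), ?_, ?_, ?_, ?_⟩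
      · simp only [time]; rw [hv] at ht'; omega
      · rw [hv', hv]
      · simp [eval, h, hr', hv]
      · intro b hbb
        rw [hb' b hbb, hb b hbb]
  | sum i r e ih =>
    intro B s
    set s₁ := s.setReg (scr B) 0 with hs₁
    set s₂ := s₁.setReg (scr (B + 1)) (s₁.reg (usr r)) with hs₂
    set s₃ := s₂.setReg (scr (B + 2)) (s₂.reg (usr i)) with hs₃
    set s₄ := s₃.setReg (scr (B + 3)) 1 with hs₄
    set s₅ := s₄.setReg (usr i) 0 with hs₅
    have hv₅ : view s₅ = (view s).setReg i 0 := by simp [hs₅, hs₄, hs₃, hs₂, hs₁]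
    obtain ⟨t, s', hx, ht, hv, hr, h2, hb⟩ := ih.sum_loop B i (s.reg (usr r)) s₅
      (by simp [hs₅, hs₄, hs₃, hs₂, hs₁]) (by simp [hs₅, hs₄])
    have hi₅ : s₅.reg (usr i) = 0 := by simp [hs₅]
    simp only [hv₅, hi₅, zero_add, State.setReg_setReg] at ht hv hr
    refine ⟨_, _, .seq (.const _ _ _) (.seq (.copy _ _ _) (.seq (.copy _ _ _) (.seq (.const _ _ _)
      (.seq (.const _ _ _) (.seq hx (.copy _ _ _)))))), ?_, ?_, ?_, ?_⟩
    · simp only [time, view_reg]; omega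
    · rw [view_setReg_usr, hv, State.setReg_setReg, h2]
      have : s₅.reg (scr (B + 2)) = (view s).reg i := by simp [hs₅, hs₄, hs₃, hs₂, hs₁]
      rw [this, State.setReg_self]
    · simp only [State.setReg_reg, scr_ne_usr, if_false, hr, eval, view_reg]
      simp [hs₅, hs₄, hs₃, hs₂, hs₁]
    · intro b hbb
      simp only [State.setReg_reg, scr_ne_usr, if_false, hb b hbb]
      simp [hs₅, hs₄, hs₃, hs₂, hs₁, show b ≠ B by omega, show b ≠ B + 1 by omega,
        show b ≠ B + 2 by omega, show b ≠ B + 3 by omega]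

end Expr

/-! ### Parity of a number in logarithmic time -/

/-- Double `t` while it stays below `v`; the scratch registers hold `v`, a test, `t`, `2 * t`, a
test and the number one. -/
def doubleLoop (B : ℕ) : Prog :=
  .while (scr (B + 4)) (.seq (.copy (scr (B + 2)) (scr (B + 3)))
    (.seq (.add (scr (B + 3)) (scr (B + 2)) (scr (B + 2)))
      (.seq (.add (scr (B + 4)) (scr B) (scr (B + 5)))
        (.sub (scr (B + 4)) (scr (B + 4)) (scr (B + 3))))))

/-- Subtract maximal powers of two as long as the value is at least two. -/
def halveLoop (B : ℕ) : Prog :=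
  .while (scr (B + 1)) (.seq (.const (scr (B + 2)) 2)
    (.seq (.add (scr (B + 3)) (scr (B + 2)) (scr (B + 2)))
      (.seq (.add (scr (B + 4)) (scr B) (scr (B + 5)))
        (.seq (.sub (scr (B + 4)) (scr (B + 4)) (scr (B + 3)))
          (.seq (doubleLoop B) (.seq (.sub (scr B) (scr B) (scr (B + 2)))
            (.sub (scr (B + 1)) (scr B) (scr (B + 5)))))))))

/-- The test register holds `v + 1 - 2 * t`, which is nonzero exactly when `2 * t ≤ v`. Evenness of
`t` is kept so that subtracting it preserves the parity of `v`; `f` bounds the number of doublings.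
-/
theorem doubleLoop_spec (B f : ℕ) : ∀ s : State, s.reg (scr (B + 5)) = 1 →
    0 < s.reg (scr (B + 2)) → Even (s.reg (scr (B + 2))) → s.reg (scr (B + 2)) ≤ s.reg (scr B) →
    s.reg (scr (B + 3)) = 2 * s.reg (scr (B + 2)) →
    s.reg (scr (B + 4)) = s.reg (scr B) + 1 - s.reg (scr (B + 3)) →
    s.reg (scr B) < s.reg (scr (B + 2)) * 2 ^ f →
    ∃ t s', Exec (doubleLoop B) s t s' ∧ t ≤ 5 * f + 1 ∧ view s' = view s ∧
      s'.reg (scr (B + 5)) = 1 ∧ s'.reg (scr B) = s.reg (scr B) ∧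
      Even (s'.reg (scr (B + 2))) ∧ s'.reg (scr (B + 2)) ≤ s.reg (scr B) ∧
      s.reg (scr B) < 2 * s'.reg (scr (B + 2)) ∧ ∀ b < B, s'.reg (scr b) = s.reg (scr b) := by
  induction f with
  | zero => intro s _ _ _ h4 _ _ h7; simp at h7; omega
  | succ f ih =>
    intro s h1 h2 h3 h4 h5 h6 h7
    by_cases hc : s.reg (scr (B + 4)) = 0
    · exact ⟨1, s, .while_done hc, by omega, rfl, h1, rfl, h3, h4, by omega, fun _ _ => rfl⟩
    · set s₁ := s.setReg (scr (B + 2)) (s.reg (scr (B + 3))) with hs₁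
      set s₂ := s₁.setReg (scr (B + 3)) (s₁.reg (scr (B + 2)) + s₁.reg (scr (B + 2))) with hs₂
      set s₃ := s₂.setReg (scr (B + 4)) (s₂.reg (scr B) + s₂.reg (scr (B + 5))) with hs₃
      set s₄ := s₃.setReg (scr (B + 4)) (s₃.reg (scr (B + 4)) - s₃.reg (scr (B + 3))) with hs₄
      have r0 : s₄.reg (scr B) = s.reg (scr B) := by simp [hs₄, hs₃, hs₂, hs₁]
      have r2 : s₄.reg (scr (B + 2)) = s.reg (scr (B + 3)) := by simp [hs₄, hs₃, hs₂, hs₁]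
      have r3 : s₄.reg (scr (B + 3)) = 2 * s.reg (scr (B + 3)) := by
        simp [hs₄, hs₃, hs₂, hs₁]; ring
      have r4 : s₄.reg (scr (B + 4)) = s.reg (scr B) + 1 - 2 * s.reg (scr (B + 3)) := by
        simp [hs₄, hs₃, hs₂, hs₁, h1, two_mul]
      have r5 : s₄.reg (scr (B + 5)) = 1 := by simp [hs₄, hs₃, hs₂, hs₁, h1]
      obtain ⟨t, s', hx, ht, hv, g1, g2, g3, g4, g5, g6⟩ := ih s₄ r5 (by omega)
        (by rw [r2, h5]; exact even_two_mul _) (by omega) (by omega) (by omega)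
        (by rw [r0, r2, h5]; rw [pow_succ'] at h7; nlinarith)
      refine ⟨_, s', .while_step hc (.seq (.copy _ _ _) (.seq (.add _ _ _ _) (.seq (.add _ _ _ _)
        (.sub _ _ _ _)))) hx, by omega, ?_, g1, by omega, g3, by omega, by omega, fun b hb => ?_⟩
      · rw [hv]; simp [hs₄, hs₃, hs₂, hs₁]
      · rw [g6 b hb]
        simp [hs₄, hs₃, hs₂, hs₁, show b ≠ B + 2 by omega, show b ≠ B + 3 by omega,
          show b ≠ B + 4 by omega]

/-- Since `t ≤ v < 2 * t`, subtracting `t` leaves less than half of `v`, so the number of rounds is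
at most the bit length. Decrementing would be exponential, because priorities are given in binary.
-/
theorem halveLoop_spec (B f : ℕ) : ∀ s : State, s.reg (scr (B + 5)) = 1 →
    s.reg (scr (B + 1)) = s.reg (scr B) - 1 → s.reg (scr B) < 2 ^ f →
    ∃ t s', Exec (halveLoop B) s t s' ∧ t ≤ f * (5 * f + 10) + 1 ∧ view s' = view s ∧
      s'.reg (scr B) = s.reg (scr B) % 2 ∧ ∀ b < B, s'.reg (scr b) = s.reg (scr b) := by
  induction f with
  | zero =>
    intro s _ h2 h3
    exact ⟨1, s, .while_done (by omega), by omega, rfl, by omega, fun _ _ => rfl⟩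
  | succ f ih =>
    intro s h1 h2 h3
    by_cases hc : s.reg (scr (B + 1)) = 0
    · exact ⟨1, s, .while_done hc, by omega, rfl, by omega, fun _ _ => rfl⟩
    · set s₁ := s.setReg (scr (B + 2)) 2 with hs₁
      set s₂ := s₁.setReg (scr (B + 3)) (s₁.reg (scr (B + 2)) + s₁.reg (scr (B + 2))) with hs₂
      set s₃ := s₂.setReg (scr (B + 4)) (s₂.reg (scr B) + s₂.reg (scr (B + 5))) with hs₃
      set s₄ := s₃.setReg (scr (B + 4)) (s₃.reg (scr (B + 4)) - s₃.reg (scr (B + 3))) with hs₄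
      have r0 : s₄.reg (scr B) = s.reg (scr B) := by simp [hs₄, hs₃, hs₂, hs₁]
      have r2 : s₄.reg (scr (B + 2)) = 2 := by simp [hs₄, hs₃, hs₂, hs₁]
      have r3 : s₄.reg (scr (B + 3)) = 4 := by simp [hs₄, hs₃, hs₂, hs₁]
      have r4 : s₄.reg (scr (B + 4)) = s.reg (scr B) + 1 - 4 := by
        simp [hs₄, hs₃, hs₂, hs₁, h1]
      have r5 : s₄.reg (scr (B + 5)) = 1 := by simp [hs₄, hs₃, hs₂, hs₁, h1]
      obtain ⟨t, s₅, hx, ht, hv, g1, g2, g3, g4, g5, g6⟩ := doubleLoop_spec B f s₄ r5 (by omega)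
        (by rw [r2]; exact even_two) (by omega) (by omega) (by omega)
        (by rw [r0, r2, ← pow_succ']; exact h3)
      set s₆ := s₅.setReg (scr B) (s₅.reg (scr B) - s₅.reg (scr (B + 2))) with hs₆
      set s₇ := s₆.setReg (scr (B + 1)) (s₆.reg (scr B) - s₆.reg (scr (B + 5))) with hs₇
      have q0 : s₇.reg (scr B) = s.reg (scr B) - s₅.reg (scr (B + 2)) := by
        simp [hs₇, hs₆, g2, r0]
      have q1 : s₇.reg (scr (B + 1)) = s₇.reg (scr B) - 1 := by simp [hs₇, hs₆, g1]
      have q5 : s₇.reg (scr (B + 5)) = 1 := by simp [hs₇, hs₆, g1]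
      rw [pow_succ'] at h3
      obtain ⟨t', s', hx', ht', hv', k1, k2⟩ := ih s₇ q5 q1 (by omega)
      refine ⟨_, s', .while_step hc (.seq (.const _ _ _) (.seq (.add _ _ _ _) (.seq (.add _ _ _ _)
        (.seq (.sub _ _ _ _) (.seq hx (.seq (.sub _ _ _ _) (.sub _ _ _ _))))))) hx', ?_, ?_, ?_,
        fun b hb => ?_⟩
      · nlinarith
      · rw [hv']; simp [hs₇, hs₆, hv, hs₄, hs₃, hs₂, hs₁]
      · rw [k1, q0]
        obtain ⟨j, hj⟩ := g3
        omega
      · rw [k2 b hb]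
        simp [hs₇, hs₆, g6 b hb, hs₄, hs₃, hs₂, hs₁, show b ≠ B by omega, show b ≠ B + 1 by omega,
          show b ≠ B + 2 by omega, show b ≠ B + 3 by omega, show b ≠ B + 4 by omega]

/-! ### Commands -/

/-- Commands; `parity x y` assigns the parity of `y` to `x`, and `loop i r c` runs `c` for the
variable `i` from `0` to the initial value of the variable `r`, exclusively. -/
inductive Cmd where
  | assign (r : ℕ) (e : Expr)
  | store (a : ℕ) (e e' : Expr)
  | parity (x y : ℕ)
  | seq (c c' : Cmd)
  | ite (e : Expr) (c c' : Cmd)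
  | loop (i r : ℕ) (c : Cmd)

/-- Iterate `f` with the variable `i` set to the number of the iteration. -/
def iterate (f : State → State) (i : ℕ) : ℕ → State → State
  | 0, s => s
  | k + 1, s => f ((iterate f i k s).setReg i k)

namespace Cmd

/-- The effect of a command. -/
def run : Cmd → State → State
  | assign r e, s => s.setReg r (e.eval s)
  | store a e e', s => s.setArr a (e.eval s) (e'.eval s)
  | parity x y, s => s.setReg x (s.reg y % 2)
  | seq c c', s => c'.run (c.run s)
  | ite e c c', s => if e.eval s ≠ 0 then c.run s else c'.run s
  | loop i r c, s => iterate c.run i (s.reg r) s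

/-- A bound on the number of steps of the compiled command. -/
def time : Cmd → State → ℕ
  | assign _ e, s => e.time s + 1
  | store _ e e', s => e.time s + e'.time s + 1
  | parity _ y, s => (s.reg y).size * (5 * (s.reg y).size + 10) + 5
  | seq c c', s => c.time s + c'.time (c.run s)
  | ite e c c', s => e.time s + c.time s + c'.time s + 1
  | loop i r c, s =>
      ∑ k ∈ Finset.range (s.reg r), (c.time ((iterate c.run i k s).setReg i k) + 4) + 4

/-- Compilation; the scratch registers below `B` are preserved. -/
def compile : Cmd → ℕ → Prog
  | assign r e, B => .seq (e.compile B) (.copy (usr r) (scr B))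
  | store a e e', B => .seq (e.compile B) (.seq (e'.compile (B + 1))
      (.store a (scr B) (scr (B + 1))))
  | parity x y, B => .seq (.copy (scr B) (usr y)) (.seq (.const (scr (B + 5)) 1)
      (.seq (.sub (scr (B + 1)) (scr B) (scr (B + 5))) (.seq (halveLoop B)
        (.copy (usr x) (scr B)))))
  | seq c c', B => .seq (c.compile B) (c'.compile B)
  | ite e c c', B => .seq (e.compile B) (.ite (scr B) (c.compile B) (c'.compile B))
  | loop i r c, B => .seq (.copy (scr B) (usr r)) (.seq (.const (scr (B + 1)) 0)
      (.seq (.const (scr (B + 2)) 1) (.while (scr B) (.seq (.copy (usr i) (scr (B + 1)))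
        (.seq (c.compile (B + 3)) (.seq (.add (scr (B + 1)) (scr (B + 1)) (scr (B + 2)))
          (.sub (scr B) (scr B) (scr (B + 2)))))))))

/-- Correctness of compiled commands. -/
def CompileSpec (c : Cmd) : Prop := ∀ B s, ∃ t s', Exec (c.compile B) s t s' ∧
  t ≤ c.time (view s) ∧ view s' = c.run (view s) ∧ ∀ b < B, s'.reg (scr b) = s.reg (scr b)

/-- Here `k` rounds are done and `j` remain. The control registers are scratch registers below those
used by the body, so the body cannot disturb them even if it assigns `i` or the bounding variable.
-/
theorem CompileSpec.loop {c : Cmd} (hc : c.CompileSpec) (B i j : ℕ) (v : State) :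
    ∀ (k : ℕ) (s : State), s.reg (scr B) = j → s.reg (scr (B + 1)) = k →
      s.reg (scr (B + 2)) = 1 → view s = iterate c.run i k v →
    ∃ t s', Exec (.while (scr B) (.seq (.copy (usr i) (scr (B + 1)))
        (.seq (c.compile (B + 3)) (.seq (.add (scr (B + 1)) (scr (B + 1)) (scr (B + 2)))
          (.sub (scr B) (scr B) (scr (B + 2))))))) s t s' ∧
      t ≤ ∑ l ∈ Finset.range j, (c.time ((iterate c.run i (k + l) v).setReg i (k + l)) + 4) + 1 ∧
      view s' = iterate c.run i (k + j) v ∧ ∀ b < B, s'.reg (scr b) = s.reg (scr b) := by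
  induction j with
  | zero =>
    intro k s hj _ _ hv
    exact ⟨1, s, .while_done hj, by simp, hv, fun _ _ => rfl⟩
  | succ j ih =>
    intro k s hj hk h1 hv
    set s₁ := s.setReg (usr i) (s.reg (scr (B + 1))) with hs₁
    have hv₁ : view s₁ = (iterate c.run i k v).setReg i k := by simp [hs₁, hv, hk]
    obtain ⟨t, s₂, hx, ht, hv₂, hb⟩ := hc (B + 3) s₁
    have hb0 := hb B (by omega)
    have hb1 := hb (B + 1) (by omega)
    have hb2 := hb (B + 2) (by omega)
    simp only [hs₁, State.setReg_reg, scr_ne_usr, if_false] at hb0 hb1 hb2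
    set s₃ := s₂.setReg (scr (B + 1)) (s₂.reg (scr (B + 1)) + s₂.reg (scr (B + 2))) with hs₃
    set s₄ := s₃.setReg (scr B) (s₃.reg (scr B) - s₃.reg (scr (B + 2))) with hs₄
    obtain ⟨t', s', hx', ht', hv', hb'⟩ := ih (k + 1) s₄
      (by simp [hs₄, hs₃, hb0, hb2, hj, h1]) (by simp [hs₄, hs₃, hb1, hb2, hk, h1])
      (by simp [hs₄, hs₃, hb2, h1]) (by simp [hs₄, hs₃, hv₂, hv₁, iterate])
    refine ⟨_, s', .while_step (by rw [hj]; omega) (.seq (.copy _ _ _) (.seq hx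
      (.seq (.add _ _ _ _) (.sub _ _ _ _)))) hx', ?_, ?_, ?_⟩
    · rw [Finset.sum_range_succ', add_zero]
      rw [hv₁] at ht
      simp only [add_assoc k 1, add_comm 1] at ht'
      omega
    · rw [hv', add_assoc, add_comm 1]
    · intro b hbb
      rw [hb' b hbb]
      simp [hs₄, hs₃, show b ≠ B by omega, show b ≠ B + 1 by omega, hb b (by omega), hs₁]

theorem compileSpec (c : Cmd) : c.CompileSpec := by
  induction c with
  | assign r e =>
    intro B s
    obtain ⟨t, s₁, hx, ht, hv, hr, hb⟩ := e.compileSpec B s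
    exact ⟨_, _, .seq hx (.copy _ _ _), by simp only [time]; omega, by simp [run, hv, hr],
      fun b hbb => by simp [hb b hbb]⟩
  | store a e e' =>
    intro B s
    obtain ⟨t, s₁, hx, ht, hv, hr, hb⟩ := e.compileSpec B s
    obtain ⟨t', s₂, hx', ht', hv', hr', hb'⟩ := e'.compileSpec (B + 1) s₁
    rw [hv] at ht'
    exact ⟨_, _, .seq hx (.seq hx' (.store _ _ _ _)), by simp only [time]; omega,
      by simp [run, hv', hv, hb' B, hr, hr'], fun b hbb => by simp [hb' b (by omega), hb b hbb]⟩
  | parity x y =>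
    intro B s
    set s₁ := s.setReg (scr B) (s.reg (usr y)) with hs₁
    set s₂ := s₁.setReg (scr (B + 5)) 1 with hs₂
    set s₃ := s₂.setReg (scr (B + 1)) (s₂.reg (scr B) - s₂.reg (scr (B + 5))) with hs₃
    obtain ⟨t, s₄, hx, ht, hv, hr, hb⟩ := halveLoop_spec B (s.reg (usr y)).size s₃
      (by simp [hs₃, hs₂]) (by simp [hs₃, hs₂, hs₁])
      (by simpa [hs₃, hs₂, hs₁] using Nat.lt_size_self _)
    refine ⟨_, _, .seq (.copy _ _ _) (.seq (.const _ _ _) (.seq (.sub _ _ _ _) (.seq hx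
      (.copy _ _ _)))), by simp only [time, view_reg]; omega, ?_, fun b hbb => ?_⟩
    · simp [run, hv, hr, hs₃, hs₂, hs₁]
    · simp [hb b hbb, hs₃, hs₂, hs₁, show b ≠ B by omega, show b ≠ B + 1 by omega,
        show b ≠ B + 5 by omega]
  | seq c c' ih ih' =>
    intro B s
    obtain ⟨t, s₁, hx, ht, hv, hb⟩ := ih B s
    obtain ⟨t', s₂, hx', ht', hv', hb'⟩ := ih' B s₁
    rw [hv] at ht' hv'
    exact ⟨_, _, .seq hx hx', by simp only [time]; omega, by rw [hv', run],
      fun b hbb => by rw [hb' b hbb, hb b hbb]⟩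
  | ite e c c' ih ih' =>
    intro B s
    obtain ⟨t, s₁, hx, ht, hv, hr, hb⟩ := e.compileSpec B s
    by_cases h : e.eval (view s) = 0
    · obtain ⟨t', s₂, hx', ht', hv', hb'⟩ := ih' B s₁
      rw [hv] at ht' hv'
      exact ⟨_, _, .seq hx (.ite_neg (by rw [hr, h]) hx'), by simp only [time]; omega,
        by simp [hv', run, h], fun b hbb => by rw [hb' b hbb, hb b hbb]⟩
    · obtain ⟨t', s₂, hx', ht', hv', hb'⟩ := ih B s₁
      rw [hv] at ht' hv'
      exact ⟨_, _, .seq hx (.ite_pos (by rwa [hr]) hx'), by simp only [time]; omega,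
        by simp [hv', run, h], fun b hbb => by rw [hb' b hbb, hb b hbb]⟩
  | loop i r c ih =>
    intro B s
    set s₁ := s.setReg (scr B) (s.reg (usr r)) with hs₁
    set s₂ := s₁.setReg (scr (B + 1)) 0 with hs₂
    set s₃ := s₂.setReg (scr (B + 2)) 1 with hs₃
    obtain ⟨t, s₄, hx, ht, hv, hb⟩ := ih.loop B i (s.reg (usr r)) (view s) 0 s₃
      (by simp [hs₃, hs₂, hs₁]) (by simp [hs₃, hs₂, hs₁]) (by simp [hs₃])
      (by simp [hs₃, hs₂, hs₁, iterate])
    simp only [zero_add] at ht hv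
    refine ⟨_, _, .seq (.copy _ _ _) (.seq (.const _ _ _) (.seq (.const _ _ _) hx)),
      by simp only [time, view_reg]; omega, hv, fun b hbb => ?_⟩
    rw [hb b hbb]
    simp [hs₃, hs₂, hs₁, show b ≠ B by omega, show b ≠ B + 1 by omega, show b ≠ B + 2 by omega]

end Cmd

theorem view_input (l : List ℕ) : view (State.input l) = State.input l := by
  rw [State.ext_iff']
  refine ⟨funext fun x => ?_, rfl⟩
  simp [State.input, usr]

/-- A search problem is in quasi-polynomial time if a command solves it within this time. -/
theorem solvableInQP_of_cmd {I : Type*} {enc : I → List ℕ} {Sol : I → Set (List ℕ)} (c : Cmd)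
    (k : ℕ) (h : ∀ x, ∃ out ∈ Sol x, (c.run (State.input (enc x))).Outputs out ∧
      c.time (State.input (enc x)) ≤ 2 ^ (k * Nat.log 2 (bitLength (enc x) + 2) ^ k)) :
    SolvableInQP enc Sol := by
  refine ⟨c.compile 0, k, fun x => ?_⟩
  obtain ⟨out, hout, ho, ht⟩ := h x
  obtain ⟨t, s, hx, ht', hv, -⟩ := c.compileSpec 0 (State.input (enc x))
  rw [view_input] at ht' hv
  refine ⟨t, s, out, hx, ht'.trans ht, ?_, hout⟩
  rw [← hv] at ho
  exact ho

/-! ### Polynomial time bounds -/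

/-- All time bounds are powers of one base `X + 2`, so that composing programs amounts to arithmetic
on exponents which depend on the program alone. -/
theorem pow_add_pow_le {Y : ℕ} (hY : 2 ≤ Y) (a b : ℕ) : Y ^ a + Y ^ b ≤ Y ^ (a + b + 1) := by
  have h1 : Y ^ a ≤ Y ^ (a + b) := Nat.pow_le_pow_right (by omega) (by omega)
  have h2 : Y ^ b ≤ Y ^ (a + b) := Nat.pow_le_pow_right (by omega) (by omega)
  calc Y ^ a + Y ^ b ≤ Y ^ (a + b) * 2 := by omega
    _ ≤ Y ^ (a + b + 1) := by rw [pow_succ]; exact Nat.mul_le_mul_left _ hY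

theorem le_two_add_pow (X k : ℕ) : k ≤ (X + 2) ^ k :=
  (Nat.lt_two_pow_self.le).trans (Nat.pow_le_pow_left (by omega) k)

/-- `C` covers the overhead per round as well as the fixed overhead: `7` is used for sums and `4`
for loops. -/
theorem sum_range_le_pow {X n a : ℕ} (hn : n ≤ X) {f : ℕ → ℕ}
    (hf : ∀ k < n, f k ≤ (X + 2) ^ a) (C : ℕ) :
    ∑ k ∈ Finset.range n, (f k + C) + C ≤ (X + 2) ^ (a + 2 * C + 3) := by
  have h1 : ∑ k ∈ Finset.range n, (f k + C) ≤ n * ((X + 2) ^ a + C) := by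
    refine (Finset.sum_le_card_nsmul _ _ ((X + 2) ^ a + C) fun k hk => ?_).trans (by simp)
    exact Nat.add_le_add_right (hf k (Finset.mem_range.1 hk)) C
  have h2 : (X + 2) ^ a + C ≤ (X + 2) ^ (a + C + 1) :=
    (Nat.add_le_add_left (le_two_add_pow X C) _).trans (pow_add_pow_le (by omega) a C)
  have h3 : n * ((X + 2) ^ a + C) ≤ (X + 2) ^ (a + C + 2) := by
    rw [pow_succ' _ (a + C + 1)]
    exact Nat.mul_le_mul (by omega) h2
  calc _ ≤ (X + 2) ^ (a + C + 2) + (X + 2) ^ C :=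
        Nat.add_le_add (h1.trans h3) (le_two_add_pow X C)
    _ ≤ (X + 2) ^ (a + C + 2 + C + 1) := pow_add_pow_le (by omega) _ _
    _ = _ := by congr 1; ring

namespace Expr

/-- The variables that bound the sums of an expression. -/
def lims : Expr → List ℕ
  | lit _ => []
  | var _ => []
  | add e e' => e.lims ++ e'.lims
  | sub e e' => e.lims ++ e'.lims
  | get _ e => e.lims
  | ite e e₁ e₂ => e.lims ++ (e₁.lims ++ e₂.lims)
  | sum i r e => r :: e.lims.filter (· ≠ i)

theorem exists_time_le (e : Expr) : ∃ a, ∀ X s, (∀ r ∈ e.lims, s.reg r ≤ X) →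
    e.time s ≤ (X + 2) ^ a := by
  have two : ∀ a b X t t' : ℕ, t ≤ (X + 2) ^ a → t' ≤ (X + 2) ^ b →
      t + t' + 1 ≤ (X + 2) ^ (a + b + 1 + 1 + 1) := by
    intro a b X t t' h h'
    have h1 := pow_add_pow_le (Y := X + 2) (by omega) a b
    have h2 := pow_add_pow_le (Y := X + 2) (by omega) (a + b + 1) 1
    have h3 := le_two_add_pow X 1
    omega
  induction e with
  | lit k => exact ⟨0, fun X s _ => by simp [time]⟩
  | var k => exact ⟨0, fun X s _ => by simp [time]⟩
  | add e e' ih ih' =>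
    obtain ⟨a, ha⟩ := ih
    obtain ⟨b, hb⟩ := ih'
    exact ⟨_, fun X s h => two a b X _ _ (ha X s fun r hr => h r (List.mem_append_left _ hr))
      (hb X s fun r hr => h r (List.mem_append_right _ hr))⟩
  | sub e e' ih ih' =>
    obtain ⟨a, ha⟩ := ih
    obtain ⟨b, hb⟩ := ih'
    exact ⟨_, fun X s h => two a b X _ _ (ha X s fun r hr => h r (List.mem_append_left _ hr))
      (hb X s fun r hr => h r (List.mem_append_right _ hr))⟩
  | get _ e ih =>
    obtain ⟨a, ha⟩ := ih
    exact ⟨_, fun X s h => (two a 0 X (e.time s) 0 (ha X s h) (Nat.zero_le _))⟩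
  | ite e e₁ e₂ ih ih₁ ih₂ =>
    obtain ⟨a, ha⟩ := ih
    obtain ⟨b, hb⟩ := ih₁
    obtain ⟨c, hc⟩ := ih₂
    refine ⟨a + b + 1 + 1 + 1 + c + 1 + 1 + 1, fun X s h => ?_⟩
    have h1 := two a b X _ _ (ha X s fun r hr => h r (List.mem_append_left _ hr))
      (hb X s fun r hr => h r (List.mem_append_right _ (List.mem_append_left _ hr)))
    exact two _ c X (e.time s + e₁.time s) _ (Nat.le_of_succ_le h1)
      (hc X s fun r hr => h r (List.mem_append_right _ (List.mem_append_right _ hr)))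
  | sum i r e ih =>
    obtain ⟨a, ha⟩ := ih
    refine ⟨a + 2 * 7 + 3, fun X s h => ?_⟩
    have hr : s.reg r ≤ X := h r (by simp [lims])
    refine le_trans ?_ (sum_range_le_pow hr (f := fun k => e.time (s.setReg i k)) (a := a)
      (fun k hk => ha X _ fun x hx => ?_) 7)
    · simp only [time]
      gcongr
      omega
    · rw [State.setReg_reg]
      split_ifs with hxi
      · omega
      · exact h x (by simp [lims, hx, hxi])

end Expr

namespace Cmd

/-- The variables that bound the loops and sums of a command. -/
def lims : Cmd → List ℕ
  | assign _ e => e.lims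
  | store _ e e' => e.lims ++ e'.lims
  | parity _ _ => []
  | seq c c' => c.lims ++ c'.lims
  | ite e c c' => e.lims ++ (c.lims ++ c'.lims)
  | loop i r c => r :: c.lims.filter (· ≠ i)

/-- The variables that are assigned explicitly. -/
def asg : Cmd → List ℕ
  | assign r _ => [r]
  | store _ _ _ => []
  | parity x _ => [x]
  | seq c c' => c.asg ++ c'.asg
  | ite _ c c' => c.asg ++ c'.asg
  | loop _ _ c => c.asg

/-- No command `parity`, and no loop or sum is bounded by a variable that has been assigned. -/
def plain : Cmd → Bool
  | parity _ _ => false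
  | seq c c' => c.plain && c'.plain && c'.lims.all fun x => !c.asg.contains x
  | ite _ c c' => c.plain && c'.plain
  | loop _ _ c => c.plain && c.lims.all fun x => !c.asg.contains x
  | _ => true

theorem iterate_reg_le {c : Cmd} {X i n : ℕ} (hn : n ≤ X) {s : State}
    (ih : ∀ {s : State}, (∀ r ∈ c.lims, s.reg r ≤ X) → ∀ {r}, r ∉ c.asg → s.reg r ≤ X →
      (c.run s).reg r ≤ X) (hd : ∀ x ∈ c.lims, x ∉ c.asg)
    (h : ∀ r ∈ c.lims, r ≠ i → s.reg r ≤ X) {k : ℕ} (hk : k ≤ n) :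
    ∀ r ∉ c.asg, s.reg r ≤ X → (iterate c.run i k s).reg r ≤ X := by
  induction k with
  | zero => intro r _ hs; exact hs
  | succ k ihk =>
    intro r hr hs
    refine ih (fun x hx => ?_) hr ?_
    · rw [State.setReg_reg]
      split_ifs with hxi
      · omega
      · exact ihk (by omega) x (hd x hx) (h x hx hxi)
    · rw [State.setReg_reg]
      split_ifs
      · omega
      · exact ihk (by omega) r hr hs

/-- A variable that is never explicitly assigned can change only as a loop variable, and then it
stays below the limit of its loop. This is why loop variables are left out of `asg` and may
themselves bound inner loops and sums. -/
theorem reg_run_le (c : Cmd) (hd : c.plain) {X : ℕ} : ∀ {s : State},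
    (∀ r ∈ c.lims, s.reg r ≤ X) → ∀ {r}, r ∉ c.asg → s.reg r ≤ X → (c.run s).reg r ≤ X := by
  induction c with
  | assign r e =>
    intro s _ x hx hs
    simp only [asg, List.mem_singleton] at hx
    simpa [run, hx] using hs
  | store a e e' => intro s _ x _ hs; simpa [run] using hs
  | parity r y => simp [plain] at hd
  | seq c c' ih ih' =>
    intro s h x hx hs
    simp only [plain, Bool.and_eq_true, List.all_eq_true, Bool.not_eq_true', List.contains_eq_mem,
      decide_eq_false_iff_not] at hd
    simp only [lims, asg, List.mem_append, not_or] at h hx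
    have hc := fun {x} => @ih hd.1.1 s (fun r hr => h r (Or.inl hr)) x
    exact ih' hd.1.2 (fun r hr => hc (hd.2 r hr) (h r (Or.inr hr))) hx.2 (hc hx.1 hs)
  | ite e c c' ih ih' =>
    intro s h x hx hs
    simp only [plain, Bool.and_eq_true] at hd
    simp only [lims, asg, List.mem_append, not_or] at h hx
    simp only [run]
    split_ifs
    · exact ih hd.1 (fun r hr => h r (Or.inr (Or.inl hr))) hx.1 hs
    · exact ih' hd.2 (fun r hr => h r (Or.inr (Or.inr hr))) hx.2 hs
  | loop i r c ih =>
    intro s h x hx hs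
    simp only [plain, Bool.and_eq_true, List.all_eq_true, Bool.not_eq_true', List.contains_eq_mem,
      decide_eq_false_iff_not] at hd
    exact iterate_reg_le (h r (by simp [lims])) (fun h => ih hd.1 h) hd.2
      (fun y hy hyi => h y (by simp [lims, hy, hyi])) le_rfl x hx hs

/-- Plain commands run in time polynomial in the bounds of their loops and sums. -/
theorem exists_time_le (c : Cmd) (hd : c.plain) : ∃ a, ∀ X s, (∀ r ∈ c.lims, s.reg r ≤ X) →
    c.time s ≤ (X + 2) ^ a := by
  have two : ∀ a b X t t' : ℕ, t ≤ (X + 2) ^ a → t' ≤ (X + 2) ^ b →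
      t + t' + 1 ≤ (X + 2) ^ (a + b + 1 + 1 + 1) := by
    intro a b X t t' h h'
    have h1 := pow_add_pow_le (Y := X + 2) (by omega) a b
    have h2 := pow_add_pow_le (Y := X + 2) (by omega) (a + b + 1) 1
    have h3 := le_two_add_pow X 1
    omega
  induction c with
  | assign r e =>
    obtain ⟨a, ha⟩ := e.exists_time_le
    exact ⟨_, fun X s h => two a 0 X (e.time s) 0 (ha X s h) (Nat.zero_le _)⟩
  | store _ e e' =>
    obtain ⟨a, ha⟩ := e.exists_time_le
    obtain ⟨b, hb⟩ := e'.exists_time_le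
    exact ⟨_, fun X s h => two a b X _ _ (ha X s fun r hr => h r (List.mem_append_left _ hr))
      (hb X s fun r hr => h r (List.mem_append_right _ hr))⟩
  | parity r y => simp [plain] at hd
  | seq c c' ih ih' =>
    simp only [plain, Bool.and_eq_true, List.all_eq_true, Bool.not_eq_true', List.contains_eq_mem,
      decide_eq_false_iff_not] at hd
    obtain ⟨a, ha⟩ := ih hd.1.1
    obtain ⟨b, hb⟩ := ih' hd.1.2
    refine ⟨_, fun X s h => Nat.le_of_succ_le (two a b X _ _
      (ha X s fun r hr => h r (List.mem_append_left _ hr)) (hb X _ fun r hr => ?_))⟩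
    exact c.reg_run_le hd.1.1 (fun r hr => h r (List.mem_append_left _ hr)) (hd.2 r hr)
      (h r (List.mem_append_right _ hr))
  | ite e c c' ih ih' =>
    simp only [plain, Bool.and_eq_true] at hd
    obtain ⟨a, ha⟩ := e.exists_time_le
    obtain ⟨b, hb⟩ := ih hd.1
    obtain ⟨d, hd⟩ := ih' hd.2
    refine ⟨a + b + 1 + 1 + 1 + d + 1 + 1 + 1, fun X s h => ?_⟩
    have h1 := two a b X _ _ (ha X s fun r hr => h r (List.mem_append_left _ hr))
      (hb X s fun r hr => h r (List.mem_append_right _ (List.mem_append_left _ hr)))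
    exact two _ d X (e.time s + c.time s) _ (Nat.le_of_succ_le h1)
      (hd X s fun r hr => h r (List.mem_append_right _ (List.mem_append_right _ hr)))
  | loop i r c ih =>
    simp only [plain, Bool.and_eq_true, List.all_eq_true, Bool.not_eq_true', List.contains_eq_mem,
      decide_eq_false_iff_not] at hd
    obtain ⟨a, ha⟩ := ih hd.1
    refine ⟨a + 2 * 4 + 3, fun X s h => ?_⟩
    have hr : s.reg r ≤ X := h r (by simp [lims])
    refine sum_range_le_pow hr (fun k hk => ha X _ fun x hx => ?_) 4
    rw [State.setReg_reg]
    split_ifs with hxi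
    · omega
    · exact iterate_reg_le hr (fun h => c.reg_run_le hd.1 h) hd.2
        (fun y hy hyi => h y (by simp [lims, hy, hyi])) hk.le x (hd.2 x hx)
        (h x (by simp [lims, hx, hxi]))

/-- A loop rule. -/
theorem run_loop_induction {c : Cmd} {i r : ℕ} {s : State} (Inv : ℕ → State → Prop)
    (h0 : Inv 0 s) (hs : ∀ k < s.reg r, ∀ s', Inv k s' → Inv (k + 1) (c.run (s'.setReg i k))) :
    Inv (s.reg r) ((loop i r c).run s) := by
  have : ∀ k ≤ s.reg r, Inv k (iterate c.run i k s) := by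
    intro k
    induction k with
    | zero => intro _; exact h0
    | succ k ih => intro hk; exact hs k (by omega) _ (ih (by omega))
  exact this _ le_rfl

/-- A loop rule with running time. -/
theorem time_loop_le {c : Cmd} {i r : ℕ} {s : State} (Inv : ℕ → State → Prop) {X a : ℕ}
    (h0 : Inv 0 s) (hs : ∀ k < s.reg r, ∀ s', Inv k s' → Inv (k + 1) (c.run (s'.setReg i k)))
    (hr : s.reg r ≤ X)
    (ht : ∀ k < s.reg r, ∀ s', Inv k s' → c.time (s'.setReg i k) ≤ (X + 2) ^ a) :
    (loop i r c).time s ≤ (X + 2) ^ (a + 11) := by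
  have : ∀ k ≤ s.reg r, Inv k (iterate c.run i k s) := by
    intro k
    induction k with
    | zero => intro _; exact h0
    | succ k ih => intro hk; exact hs k (by omega) _ (ih (by omega))
  exact sum_range_le_pow hr (fun k hk => ht k hk _ (this k hk.le)) 4

end Cmd

end RAM

open Filter

/-! ### Lifting to the least progress measure -/

section Lifting

variable {n : ℕ} (Cond : (Fin n → ℕ) → Fin n → Prop) (M : ℕ)

open Classical in
/-- Increase the value at `u` by one if it is below `M` and the condition fails at `u`. -/
noncomputable def liftAt (u : Fin n) (μ : Fin n → ℕ) : Fin n → ℕ :=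
  if μ u < M ∧ ¬ Cond μ u then Function.update μ u (μ u + 1) else μ

/-- Apply `liftAt` to the first `k` vertices in turn. -/
noncomputable def sweep : ℕ → (Fin n → ℕ) → Fin n → ℕ
  | 0, μ => μ
  | k + 1, μ => if h : k < n then liftAt Cond M ⟨k, h⟩ (sweep k μ) else sweep k μ

/-- The condition holds wherever the value is below `M`. -/
def Stable (μ : Fin n → ℕ) : Prop := ∀ u, μ u < M → Cond μ u

/-- The measure reached after sufficiently many sweeps. -/
noncomputable def leastMeasure : Fin n → ℕ := (sweep Cond M n)^[n * M + 1] 0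

variable {Cond M}

theorem liftAt_cases (u : Fin n) (μ : Fin n → ℕ) :
    (liftAt Cond M u μ = μ ∧ (μ u < M → Cond μ u)) ∨
      (liftAt Cond M u μ = Function.update μ u (μ u + 1) ∧ μ u < M ∧ ¬ Cond μ u) := by
  unfold liftAt
  split_ifs with h
  · exact Or.inr ⟨rfl, h⟩
  · exact Or.inl ⟨rfl, fun h1 => by_contra fun h2 => h ⟨h1, h2⟩⟩

theorem le_liftAt (u : Fin n) (μ : Fin n → ℕ) : μ ≤ liftAt Cond M u μ := by
  rcases liftAt_cases (Cond := Cond) (M := M) u μ with ⟨h, -⟩ | ⟨h, -⟩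
  · rw [h]
  · rw [h]; exact le_update_iff.2 ⟨Nat.le_succ _, fun _ _ => le_rfl⟩

/-- If the values at `u` already agreed, the condition for `ν` would pass to `μ`. So a failing
condition means that `μ u < ν u`, and the increment is safe. -/
theorem liftAt_le {u : Fin n} {μ ν : Fin n → ℕ} (hμ : μ ≤ ν)
    (hCond : ∀ μ : Fin n → ℕ, ∀ u, μ ≤ ν → μ u = ν u → Cond ν u → Cond μ u)
    (hν : Stable Cond M ν) : liftAt Cond M u μ ≤ ν := by
  rcases liftAt_cases (Cond := Cond) (M := M) u μ with ⟨h, -⟩ | ⟨h, hlt, hc⟩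
  · rwa [h]
  · rw [h]
    refine update_le_iff.2 ⟨?_, fun x _ => hμ x⟩
    rcases (hμ u).lt_or_eq with h' | h'
    · exact h'
    · exact absurd (hCond μ u hμ h' (hν u (h' ▸ hlt))) hc

theorem sweep_le {μ ν : Fin n → ℕ} (hμ : μ ≤ ν)
    (hCond : ∀ μ : Fin n → ℕ, ∀ u, μ ≤ ν → μ u = ν u → Cond ν u → Cond μ u)
    (hν : Stable Cond M ν) (k : ℕ) : sweep Cond M k μ ≤ ν := by
  induction k with
  | zero => exact hμ
  | succ k ih =>
    rw [sweep]
    split_ifs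
    · exact liftAt_le ih hCond hν
    · exact ih

/-- A sweep without an increment has tested all conditions against the same measure; any increment
raises the sum, and later lifts never lower it. -/
theorem sweep_cases (μ : Fin n → ℕ) (k : ℕ) :
    (sweep Cond M k μ = μ ∧ ∀ u : Fin n, (u : ℕ) < k → μ u < M → Cond μ u) ∨
      (∑ u, μ u < ∑ u, sweep Cond M k μ u ∧ ¬ Stable Cond M μ) := by
  induction k with
  | zero => exact Or.inl ⟨rfl, fun u hu => absurd hu (Nat.not_lt_zero _)⟩
  | succ k ih =>
    rw [sweep]
    split_ifs with hk
    · rcases ih with ⟨h1, h2⟩ | ⟨h1, h2⟩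
      · rw [h1]
        rcases liftAt_cases (Cond := Cond) (M := M) ⟨k, hk⟩ μ with ⟨h, hs⟩ | ⟨h, hlt, hc⟩
        · refine Or.inl ⟨h, fun u hu => ?_⟩
          rcases Nat.lt_succ_iff_lt_or_eq.1 hu with h' | h'
          · exact h2 u h'
          · obtain rfl : u = ⟨k, hk⟩ := Fin.ext h'
            exact hs
        · refine Or.inr ⟨?_, fun hst => hc (hst _ hlt)⟩
          rw [h]
          refine Finset.sum_lt_sum (fun u _ => ?_) ⟨⟨k, hk⟩, Finset.mem_univ _, by simp⟩
          by_cases hu : u = ⟨k, hk⟩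
          · subst hu; simp
          · simp [hu]
      · exact Or.inr ⟨h1.trans_le (Finset.sum_le_sum fun u _ => le_liftAt _ _ u), h2⟩
    · rcases ih with ⟨h1, h2⟩ | h
      · exact Or.inl ⟨h1, fun u _ => h2 u (by omega)⟩
      · exact Or.inr h

theorem iterate_sweep_le {μ ν : Fin n → ℕ} (hμ : μ ≤ ν)
    (hCond : ∀ μ : Fin n → ℕ, ∀ u, μ ≤ ν → μ u = ν u → Cond ν u → Cond μ u)
    (hν : Stable Cond M ν) (k : ℕ) : (sweep Cond M n)^[k] μ ≤ ν := by
  induction k with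
  | zero => exact hμ
  | succ k ih => rw [Function.iterate_succ_apply']; exact sweep_le ih hCond hν n

theorem leastMeasure_le {ν : Fin n → ℕ}
    (hCond : ∀ μ : Fin n → ℕ, ∀ u, μ ≤ ν → μ u = ν u → Cond ν u → Cond μ u)
    (hν : Stable Cond M ν) : leastMeasure Cond M ≤ ν :=
  iterate_sweep_le (fun _ => Nat.zero_le _) hCond hν _

theorem liftAt_le_bound {u : Fin n} {μ : Fin n → ℕ} (hμ : ∀ v, μ v ≤ M) (v : Fin n) :
    liftAt Cond M u μ v ≤ M := by
  rcases liftAt_cases (Cond := Cond) (M := M) u μ with ⟨h, -⟩ | ⟨h, hlt, -⟩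
  · rw [h]; exact hμ v
  · rw [h, Function.update_apply]
    split_ifs
    · exact hlt
    · exact hμ v

theorem sweep_le_bound {μ : Fin n → ℕ} (hμ : ∀ v, μ v ≤ M) (k : ℕ) (v : Fin n) :
    sweep Cond M k μ v ≤ M := by
  induction k generalizing v with
  | zero => exact hμ v
  | succ k ih =>
    rw [sweep]
    split_ifs
    · exact liftAt_le_bound ih v
    · exact ih v

theorem iterate_sweep_le_bound (k : ℕ) (v : Fin n) : (sweep Cond M n)^[k] 0 v ≤ M := by
  induction k generalizing v with
  | zero => exact Nat.zero_le _
  | succ k ih => rw [Function.iterate_succ_apply']; exact sweep_le_bound ih n v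

theorem stable_leastMeasure : Stable Cond M (leastMeasure Cond M) := by
  have key : ∀ k, Stable Cond M ((sweep Cond M n)^[k] 0) ∨
      k ≤ ∑ u, (sweep Cond M n)^[k] 0 u := by
    intro k
    induction k with
    | zero => exact Or.inr (Nat.zero_le _)
    | succ k ih =>
      rw [Function.iterate_succ_apply']
      rcases sweep_cases (Cond := Cond) (M := M) ((sweep Cond M n)^[k] 0) n with
        ⟨h1, h2⟩ | ⟨h1, h2⟩
      · rw [h1]; exact Or.inl fun u => h2 u u.2
      · exact Or.inr (by have := ih.resolve_left h2; omega)
  -- Each unstable sweep adds at least one to the sum of the values, and this sum cannot exceed `n *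
  -- M`.
  refine (key (n * M + 1)).resolve_right fun h => ?_
  have : ∑ u, (sweep Cond M n)^[n * M + 1] 0 u ≤ ∑ _u : Fin n, M :=
    Finset.sum_le_sum fun u _ => iterate_sweep_le_bound _ u
  simp only [Finset.sum_const, Finset.card_univ, Fintype.card_fin, smul_eq_mul] at this
  omega

end Lifting

/-! ### From the least measure to the winning region -/

namespace PersParityGame

variable (𝔊 : PersParityGame)

/-- The number of vertices of smaller priority. -/
def rank (u : Fin 𝔊.n) : ℕ := (Finset.univ.filter fun v => 𝔊.prio v < 𝔊.prio u).card

theorem rank_lt (u : Fin 𝔊.n) : 𝔊.rank u < 𝔊.n := by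
  have : (Finset.univ.filter fun v => 𝔊.prio v < 𝔊.prio u) ⊂ Finset.univ :=
    Finset.filter_ssubset.2 ⟨u, Finset.mem_univ _, lt_irrefl _⟩
  simpa [rank] using Finset.card_lt_card this

theorem rank_lt_rank {u v : Fin 𝔊.n} (h : 𝔊.prio u < 𝔊.prio v) : 𝔊.rank u < 𝔊.rank v := by
  refine Finset.card_lt_card (Finset.ssubset_iff_of_subset
    (Finset.monotone_filter_right _ fun w _ hw => hw.trans h) |>.2 ⟨u, by simpa using h, by simp⟩)

theorem rank_eq_rank {u v : Fin 𝔊.n} (h : 𝔊.prio u = 𝔊.prio v) : 𝔊.rank u = 𝔊.rank v := by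
  unfold rank; rw [h]

/-- Priorities may be exponential in the input size, while the levels of the word must stay below a
bound linear in the number of vertices. Ranks with the original parity are order-equivalent for this
purpose. -/
theorem badSet_rank_iff {m : ℕ} {al : ℕ → Fin 𝔊.n × Fin 𝔊.n → Prop}
    {A : Set (Fin 𝔊.n × Fin 𝔊.n)} :
    BadSet (fun v => 2 * 𝔊.rank v + 𝔊.prio v % 2) al m A ↔ BadSet 𝔊.prio al m A := by
  have hpar : ∀ v, Even (2 * 𝔊.rank v + 𝔊.prio v % 2) ↔ Even (𝔊.prio v) := fun v => by
    rw [Nat.even_iff, Nat.even_iff]; omega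
  refine ⟨BadSet.congr_prio hpar fun u v h => ?_, BadSet.congr_prio (fun v => (hpar v).symm)
    fun u v h => ?_⟩
  · by_contra! hle
    rcases hle.lt_or_eq with h' | h'
    · have := 𝔊.rank_lt_rank h'; omega
    · have := 𝔊.rank_eq_rank h'; omega
  · have := 𝔊.rank_lt_rank h; omega

/-- The condition on a move `u → v` with values `x` and `y`. -/
def OK (lev lab : ℕ → ℕ) (u v : Fin 𝔊.n) (x y : ℕ) : Prop :=
  MoveOK lev lab 𝔊.al (𝔊.rank u + 1) (𝔊.prio u % 2) (u, v) x y

/-- The condition at `u` for a progress measure `μ`. -/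
def Cond (lev lab : ℕ → ℕ) (μ : Fin 𝔊.n → ℕ) (u : Fin 𝔊.n) : Prop :=
  (𝔊.graph.owner u = 0 → ∃ v, 𝔊.graph.edge u v ∧ 𝔊.OK lev lab u v (μ u) (μ v)) ∧
    (𝔊.graph.owner u ≠ 0 → ∀ v, 𝔊.graph.edge u v → 𝔊.OK lev lab u v (μ u) (μ v))

theorem Cond.mono {lev lab : ℕ → ℕ} {μ ν : Fin 𝔊.n → ℕ} {u : Fin 𝔊.n} (hμ : μ ≤ ν)
    (hu : μ u = ν u) (h : 𝔊.Cond lev lab ν u) : 𝔊.Cond lev lab μ u := by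
  refine ⟨fun h0 => ?_, fun h1 v hv => ?_⟩
  · obtain ⟨v, hv, hok⟩ := h.1 h0
    exact ⟨v, hv, hu ▸ MoveOK.antitone hok (hμ v)⟩
  · exact hu ▸ MoveOK.antitone (h.2 h1 v hv) (hμ v)

/-- Level and label functions that extend a universal word of length `M - 1` by a last position `M`
of level at least `n`. -/
structure Table (lev lab : ℕ → ℕ) (w : List (ℕ × ℕ)) : Prop where
  lev_eq : ∀ x ≤ w.length, lev x = wlev w x
  lab_eq : ∀ x ≤ w.length, lab x = wlab w x
  top : 𝔊.n ≤ lev (w.length + 1)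
  lab_le : ∀ l ∈ w, l.2 ≤ 𝔊.groups.length

variable {𝔊} {lev lab : ℕ → ℕ} {w : List (ℕ × ℕ)}

/-- The top position has level at least `n`, so it is counted for every threshold and can only be
reached by increasing the count. Plays that respect the measure therefore never enter the top from
below. -/
theorem Table.not_ok_top (h : 𝔊.Table lev lab w) {u v : Fin 𝔊.n} {x : ℕ}
    (hx : x < w.length + 1) : ¬ 𝔊.OK lev lab u v x (w.length + 1) := by
  rintro (⟨_, _, h3⟩ | ⟨_, h2⟩)
  · omega
  · have := comp_lt lev hx (θ := 𝔊.rank u + 1) (by have := 𝔊.rank_lt u; have := h.top; omega)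
    omega

theorem Table.moveOK_iff (h : 𝔊.Table lev lab w) {θ o x y : ℕ} {e : Fin 𝔊.n × Fin 𝔊.n}
    (hx : x ≤ w.length) (hy : y ≤ w.length) :
    MoveOK lev lab 𝔊.al θ o e x y ↔ MoveOK (wlev w) (wlab w) 𝔊.al θ o e x y := by
  unfold MoveOK
  rw [h.lev_eq x hx, h.lab_eq x hx, comp_congr fun z hz => h.lev_eq z (hz.trans hx),
    comp_congr fun z hz => h.lev_eq z (hz.trans hy)]

theorem Table.lab_le' (h : 𝔊.Table lev lab w) {x : ℕ} (hx : x ≤ w.length) :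
    lab x ≤ 𝔊.groups.length := by
  rw [h.lab_eq x hx]
  unfold wlab
  rw [List.getD_eq_getElem _ _ (by simp; omega)]
  rcases List.mem_cons.1 (List.getElem_mem (l := (0, 0) :: w) (n := x) (by simp; omega)) with h0 | h0
  · rw [h0]; exact Nat.zero_le _
  · exact h.lab_le _ h0

/-- A memoryless strategy that follows a stable measure wins below the top value. -/
theorem Table.winsFrom (h : 𝔊.Table lev lab w) {μ : Fin 𝔊.n → ℕ}
    (hμ : Stable (𝔊.Cond lev lab) (w.length + 1) μ) {f : Fin 𝔊.n → Fin 𝔊.n}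
    (hμM : ∀ u, μ u ≤ w.length + 1) (hf : ∀ u, 𝔊.graph.edge u (f u))
    (hok : ∀ u, 𝔊.graph.owner u = 0 → μ u < w.length + 1 → 𝔊.OK lev lab u (f u) (μ u) (μ (f u)))
    {v : Fin 𝔊.n} (hv : μ v < w.length + 1) :
    𝔊.graph.WinsFrom 𝔊.objective (fun _ v => f v) v := by
  refine ⟨fun _ v _ => hf v, fun ρ hρ h0 hc => ?_⟩
  have step : ∀ k, μ (ρ k) < w.length + 1 →
      𝔊.OK lev lab (ρ k) (ρ (k + 1)) (μ (ρ k)) (μ (ρ (k + 1))) := by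
    intro k hk
    by_cases ho : 𝔊.graph.owner (ρ k) = 0
    · rw [hc k ho]; exact hok _ ho hk
    · exact (hμ _ hk).2 ho _ (hρ k)
  have hlt : ∀ k, μ (ρ k) < w.length + 1 := by
    intro k
    induction k with
    | zero => rw [h0]; exact hv
    | succ k ih =>
      refine (hμM _).lt_of_ne fun hne => ?_
      have := step k ih
      rw [hne] at this
      exact h.not_ok_top ih this
  by_contra hobj
  rw [not_objective_iff, ← badSet_rank_iff] at hobj
  exact not_badSet_of_moveOK (lev := lev) (lab := lab) (μ := μ) (c := 𝔊.rank)
    (o := fun v => 𝔊.prio v % 2) (fun v => Nat.mod_lt _ two_pos)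
    (fun k => h.lab_le' (by have := hlt k; omega)) (fun k => step k (hlt k)) hobj

/-- Outside the winning region the least measure takes its top value only. -/
theorem Table.leastMeasure_lt {i : ℕ} (hi : 𝔊.n < 2 ^ i)
    (h : 𝔊.Table lev lab (univWord 𝔊.groups.length 𝔊.n i)) {v : Fin 𝔊.n}
    (hv : v ∈ 𝔊.graph.winningRegion 𝔊.objective) :
    leastMeasure (𝔊.Cond lev lab) ((univWord 𝔊.groups.length 𝔊.n i).length + 1) v <
      (univWord 𝔊.groups.length 𝔊.n i).length + 1 := by
  classical
  set w := univWord 𝔊.groups.length 𝔊.n i with hw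
  set Bad := BadSet 𝔊.prio 𝔊.al 𝔊.groups.length
  obtain ⟨f, hf, hd⟩ := GameGraph.exists_memoryless Bad BadSet.union 𝔊.graph
  let X : Finset (Fin 𝔊.n) := Finset.univ.filter fun u => 𝔊.graph.SafeFrom Bad f u
  have hmem : ∀ u, u ∈ X ↔ 𝔊.graph.SafeFrom Bad f u := by simp [X]
  have hclosed : ∀ a ∈ X, ∀ b, 𝔊.graph.Follows f a b → b ∈ X := by
    intro a ha b hab
    rw [hmem] at ha ⊢
    intro ρ h0 hρ hb
    -- Prepending one vertex changes no recurring edge, so safety passes to successors.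
    refine ha (fun k => if k = 0 then a else ρ (k - 1)) rfl (fun k => ?_) ?_
    · rcases k with _ | k
      · simpa [h0] using hab
      · simpa using hρ k
    · rw [← infEdges_shift _ 1]
      convert hb using 2
      funext k
      rw [if_neg (by omega), Nat.add_sub_cancel_left]
  have hX : X.card < 2 ^ i := (Finset.card_le_univ X).trans_lt (by simpa using hi)
  have hgood : GoodOn (𝔊.graph.Follows f) 𝔊.al 𝔊.rank (fun v => 𝔊.prio v % 2)
      𝔊.groups.length X := by
    intro ρ hρX hρ hb
    exact (hmem _).1 (hρX 0) ρ rfl hρ (𝔊.badSet_rank_iff.1 hb)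
  obtain ⟨ν, hνle, hνok⟩ := exists_measure_univWord (fun v => Nat.mod_lt _ two_pos) hX hgood
    𝔊.rank_lt
  rw [← hw] at hνle hνok
  have hvX : v ∈ X := by
    rw [hmem]
    -- A refutation at `v` defeats every strategy, including the winning `σ`, which may use memory.
    refine (hd v).resolve_right ?_
    rintro ⟨r, q, rfl⟩
    obtain ⟨σ, hσ, hwin⟩ := hv
    obtain ⟨ρ, h0, hp, hc, hb⟩ := r.exists_play hσ q
    exact (𝔊.not_objective_iff ρ).2 hb (hwin ρ hp h0 hc)
  -- Outside the safe set the top value is taken, where stability demands nothing; the least measure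
  -- lies below this one.
  let ν' : Fin 𝔊.n → ℕ := fun u => if u ∈ X then ν u else w.length + 1
  have hstep : ∀ a ∈ X, ∀ b, 𝔊.graph.Follows f a b → 𝔊.OK lev lab a b (ν' a) (ν' b) := by
    intro a ha b hab
    have hb := hclosed a ha b hab
    simp only [ν', ha, hb, if_true, OK]
    rw [h.moveOK_iff (hνle a ha) (hνle b hb)]
    exact hνok a ha b hb hab
  have hst : Stable (𝔊.Cond lev lab) (w.length + 1) ν' := by
    intro u hu
    have huX : u ∈ X := by
      by_contra hn
      simp [ν', hn] at hu
    exact ⟨fun _ => ⟨f u, hf u, hstep u huX _ ⟨hf u, fun _ => rfl⟩⟩,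
      fun ho b hb => hstep u huX b ⟨hb, fun h0 => absurd h0 ho⟩⟩
  have := leastMeasure_le (fun μ u h1 h2 h3 => Cond.mono 𝔊 h1 h2 h3) hst v
  refine this.trans_lt ?_
  simp only [ν', hvX, if_true]
  exact Nat.lt_succ_of_le (hνle v hvX)

/-- The least measure solves the game. -/
theorem Table.solution {i : ℕ} (hi : 𝔊.n < 2 ^ i)
    (h : 𝔊.Table lev lab (univWord 𝔊.groups.length 𝔊.n i)) {M : ℕ}
    (hM : M = (univWord 𝔊.groups.length 𝔊.n i).length + 1) {μ : Fin 𝔊.n → ℕ}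
    (hμ : μ = leastMeasure (𝔊.Cond lev lab) M) {f : Fin 𝔊.n → Fin 𝔊.n}
    (hf : ∀ u, 𝔊.graph.edge u (f u))
    (hok : ∀ u, μ u < M → 𝔊.OK lev lab u (f u) (μ u) (μ (f u))) :
    encodeSet {u | μ u < M} ++ List.ofFn (fun v => (f v : ℕ)) ∈ 𝔊.solutions := by
  subst hM hμ
  have hwin := fun v => h.winsFrom stable_leastMeasure (fun u => iterate_sweep_le_bound _ u) hf
    (fun u _ => hok u) (v := v)
  have hreg : 𝔊.graph.winningRegion 𝔊.objective = {u | leastMeasure (𝔊.Cond lev lab)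
      ((univWord 𝔊.groups.length 𝔊.n i).length + 1) u <
        (univWord 𝔊.groups.length 𝔊.n i).length + 1} := by
    ext v
    exact ⟨fun hv => h.leastMeasure_lt hi hv, fun hv => ⟨_, hwin v hv⟩⟩
  refine ⟨f, fun _ v _ => hf v, fun v hv => hwin v (by rw [hreg] at hv; exact hv), ?_⟩
  rw [hreg]

theorem univWord_lab_le (m n i : ℕ) : ∀ l ∈ univWord m n i, l.2 ≤ m := by
  induction i with
  | zero => simp [univWord]
  | succ i ih =>
    rw [univWord]
    have key : ∀ h, ∀ l ∈ capWord h (univWord m n i) ++ midWord m h, l.2 ≤ m := by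
      intro h l hl
      simp only [capWord, midWord, List.mem_append, List.mem_map, List.mem_singleton,
        List.mem_range] at hl
      rcases hl with ⟨l', hl', rfl⟩ | ⟨g, hg, rfl⟩ | rfl
      · exact ih l' hl'
      · exact hg
      · exact Nat.zero_le _
    have : ∀ h, ∀ l ∈ blockWord m (univWord m n i) h, l.2 ≤ m := by
      intro h
      induction h with
      | zero => simp [blockWord]
      | succ h ihh =>
        intro l hl
        rw [blockWord, List.mem_append, List.mem_append] at hl
        rcases hl with (hl | hl) | hl
        · exact key _ l hl
        · exact ihh l hl
        · exact key _ l hl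
    exact this n

end PersParityGame

/-! ### Reading the input -/

theorem List.getD_append_add {α : Type*} (l l' : List α) (i : ℕ) (d : α) :
    (l ++ l').getD (l.length + i) d = l'.getD i d := by
  rw [List.getD_append_right _ _ _ _ (Nat.le_add_right _ _), Nat.add_sub_cancel_left]

theorem List.getD_flatMap {α β : Type*} (f : α → List β) (c : ℕ) (d : β) (l : List α)
    (hf : ∀ x ∈ l, (f x).length = c) {i j : ℕ} (hi : i < l.length) (hj : j < c) :
    (l.flatMap f).getD (i * c + j) d = (f l[i]).getD j d := by
  induction l generalizing i with
  | nil => simp at hi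
  | cons x l ih =>
    have hx := hf x (by simp)
    rw [List.flatMap_cons]
    cases i with
    | zero => rw [List.getD_append _ _ _ _ (by omega)]; simp
    | succ i =>
      rw [show (i + 1) * c + j = (f x).length + (i * c + j) by rw [hx]; ring,
        List.getD_append_add]
      exact ih (fun y hy => hf y (List.mem_cons_of_mem _ hy)) (by simpa using hi)

theorem List.length_flatMap_const {α β : Type*} (f : α → List β) (c : ℕ) (l : List α)
    (hf : ∀ x ∈ l, (f x).length = c) : (l.flatMap f).length = l.length * c := by
  induction l with
  | nil => simp
  | cons x l ih =>
    rw [List.flatMap_cons, List.length_append, hf x (by simp),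
      ih fun y hy => hf y (List.mem_cons_of_mem _ hy), List.length_cons]
    ring

theorem bit_ne_zero {p : Prop} : bit p ≠ 0 ↔ p := by unfold bit; split_ifs <;> simp [*]

theorem length_encodeSet {n : ℕ} (A : Set (Fin n)) : (encodeSet A).length = n := by
  simp [encodeSet]

theorem getD_encodeSet {n : ℕ} (A : Set (Fin n)) (v : Fin n) :
    (encodeSet A).getD v 0 = bit (v ∈ A) := by
  simp [encodeSet]

theorem length_encodeRel {n : ℕ} (E : Set (Fin n × Fin n)) : (encodeRel E).length = n * n := by
  unfold encodeRel
  rw [List.length_flatMap_const _ n _ (by simp), List.length_finRange]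

theorem getD_encodeRel {n : ℕ} (E : Set (Fin n × Fin n)) (u v : Fin n) :
    (encodeRel E).getD (u * n + v) 0 = bit ((u, v) ∈ E) := by
  unfold encodeRel
  rw [List.getD_flatMap _ n 0 _ (by simp) (by simp) v.2]
  simp

namespace PersParityGame

variable (𝔊 : PersParityGame)

/-- The encoding of a live group. -/
noncomputable def encodeGroup (g : 𝔊.graph.PersLiveGroup) : List ℕ :=
  encodeSet g.S ++ encodeRel g.C ++ encodeSet g.T

theorem encode_eq : 𝔊.encode = [𝔊.n, 𝔊.groups.length] ++
    ((List.ofFn fun v => (𝔊.graph.owner v : ℕ)) ++ (List.ofFn 𝔊.prio ++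
      (encodeRel {e | 𝔊.graph.edge e.1 e.2} ++ 𝔊.groups.flatMap 𝔊.encodeGroup))) := by
  have : 𝔊.encodeGroup = fun g => encodeSet g.S ++ encodeRel g.C ++ encodeSet g.T := rfl
  rw [this]
  simp only [encode, List.append_assoc]

/-- The input array. -/
noncomputable def inp (i : ℕ) : ℕ := 𝔊.encode.getD i 0

theorem inp_zero : 𝔊.inp 0 = 𝔊.n := by simp [inp, encode]

theorem inp_one : 𝔊.inp 1 = 𝔊.groups.length := by simp [inp, encode]

theorem inp_owner (u : Fin 𝔊.n) : 𝔊.inp (2 + u) = (𝔊.graph.owner u : ℕ) := by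
  rw [inp, encode_eq]
  rw [show 2 + (u : ℕ) = [𝔊.n, 𝔊.groups.length].length + u by simp, List.getD_append_add,
    List.getD_append _ _ _ _ (by simp), List.getD_eq_getElem _ _ (by simp)]
  simp

theorem inp_prio (u : Fin 𝔊.n) : 𝔊.inp (2 + 𝔊.n + u) = 𝔊.prio u := by
  rw [inp, encode_eq]
  rw [show 2 + 𝔊.n + (u : ℕ) = [𝔊.n, 𝔊.groups.length].length +
    ((List.ofFn fun v => (𝔊.graph.owner v : ℕ)).length + u) by simp; ring, List.getD_append_add,
    List.getD_append_add, List.getD_append _ _ _ _ (by simp), List.getD_eq_getElem _ _ (by simp)]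
  simp

theorem inp_edge (u v : Fin 𝔊.n) :
    𝔊.inp (2 + 𝔊.n + 𝔊.n + (u * 𝔊.n + v)) = bit (𝔊.graph.edge u v) := by
  have hlt : (u : ℕ) * 𝔊.n + v < 𝔊.n * 𝔊.n := by
    have := Nat.mul_le_mul_right 𝔊.n (show (u : ℕ) + 1 ≤ 𝔊.n from u.2)
    have := v.2
    rw [Nat.succ_mul] at *
    omega
  rw [inp, encode_eq]
  rw [show 2 + 𝔊.n + 𝔊.n + ((u : ℕ) * 𝔊.n + v) = [𝔊.n, 𝔊.groups.length].length +
    ((List.ofFn fun v => (𝔊.graph.owner v : ℕ)).length + ((List.ofFn 𝔊.prio).length +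
      (u * 𝔊.n + v))) by simp; ring, List.getD_append_add, List.getD_append_add,
    List.getD_append_add, List.getD_append _ _ _ _ (by rw [length_encodeRel]; exact hlt),
    getD_encodeRel]
  rfl

theorem length_encodeGroup (g : 𝔊.graph.PersLiveGroup) :
    (𝔊.encodeGroup g).length = 𝔊.n + 𝔊.n + 𝔊.n * 𝔊.n := by
  simp only [encodeGroup, List.length_append, length_encodeSet, length_encodeRel]
  ring

theorem inp_group {g : ℕ} (hg : g < 𝔊.groups.length) {j : ℕ} (hj : j < 𝔊.n + 𝔊.n + 𝔊.n * 𝔊.n) :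
    𝔊.inp (2 + 𝔊.n + 𝔊.n + 𝔊.n * 𝔊.n + g * (𝔊.n + 𝔊.n + 𝔊.n * 𝔊.n) + j) =
      (𝔊.encodeGroup 𝔊.groups[g]).getD j 0 := by
  rw [inp, encode_eq]
  rw [show 2 + 𝔊.n + 𝔊.n + 𝔊.n * 𝔊.n + g * (𝔊.n + 𝔊.n + 𝔊.n * 𝔊.n) + j =
    [𝔊.n, 𝔊.groups.length].length + ((List.ofFn fun v => (𝔊.graph.owner v : ℕ)).length +
      ((List.ofFn 𝔊.prio).length + ((encodeRel {e | 𝔊.graph.edge e.1 e.2}).length +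
      (g * (𝔊.n + 𝔊.n + 𝔊.n * 𝔊.n) + j)))) by
        rw [length_encodeRel]; simp; ring,
    List.getD_append_add, List.getD_append_add,
    List.getD_append_add, List.getD_append_add]
  exact List.getD_flatMap 𝔊.encodeGroup (𝔊.n + 𝔊.n + 𝔊.n * 𝔊.n) 0 𝔊.groups
    (fun g _ => 𝔊.length_encodeGroup g) hg hj

theorem inp_S {g : ℕ} (hg : g < 𝔊.groups.length) (u : Fin 𝔊.n) :
    𝔊.inp (2 + 𝔊.n + 𝔊.n + 𝔊.n * 𝔊.n + g * (𝔊.n + 𝔊.n + 𝔊.n * 𝔊.n) + u) =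
      bit (u ∈ 𝔊.groups[g].S) := by
  rw [inp_group 𝔊 hg (by have := u.2; omega), encodeGroup, List.append_assoc,
    List.getD_append _ _ _ _ (by rw [length_encodeSet]; exact u.2), getD_encodeSet]

theorem inp_C {g : ℕ} (hg : g < 𝔊.groups.length) (u v : Fin 𝔊.n) :
    𝔊.inp (2 + 𝔊.n + 𝔊.n + 𝔊.n * 𝔊.n + g * (𝔊.n + 𝔊.n + 𝔊.n * 𝔊.n) +
      (𝔊.n + (u * 𝔊.n + v))) = bit ((u, v) ∈ 𝔊.groups[g].C) := by
  have hlt : (u : ℕ) * 𝔊.n + v < 𝔊.n * 𝔊.n := by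
    have := Nat.mul_le_mul_right 𝔊.n (show (u : ℕ) + 1 ≤ 𝔊.n from u.2)
    have := v.2
    rw [Nat.succ_mul] at *
    omega
  rw [inp_group 𝔊 hg (by omega), encodeGroup, List.append_assoc,
    show 𝔊.n + ((u : ℕ) * 𝔊.n + v) = (encodeSet 𝔊.groups[g].S).length + (u * 𝔊.n + v) by
      rw [length_encodeSet], List.getD_append_add,
    List.getD_append _ _ _ _ (by rw [length_encodeRel]; exact hlt), getD_encodeRel]

theorem inp_T {g : ℕ} (hg : g < 𝔊.groups.length) (u : Fin 𝔊.n) :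
    𝔊.inp (2 + 𝔊.n + 𝔊.n + 𝔊.n * 𝔊.n + g * (𝔊.n + 𝔊.n + 𝔊.n * 𝔊.n) +
      (𝔊.n + (𝔊.n * 𝔊.n + u))) = bit (u ∈ 𝔊.groups[g].T) := by
  rw [inp_group 𝔊 hg (by have := u.2; omega), encodeGroup, List.append_assoc,
    show 𝔊.n + (𝔊.n * 𝔊.n + u) = (encodeSet 𝔊.groups[g].S).length +
      ((encodeRel 𝔊.groups[g].C).length + u) by rw [length_encodeSet, length_encodeRel],
    List.getD_append_add, List.getD_append_add, getD_encodeSet]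

theorem length_le_bitLength (l : List ℕ) : l.length ≤ RAM.bitLength l := by
  induction l with
  | nil => simp
  | cons a l ih => simp only [RAM.bitLength, List.map_cons, List.sum_cons, List.length_cons] at *; omega

theorem size_le_bitLength {l : List ℕ} {a : ℕ} (ha : a ∈ l) : a.size ≤ RAM.bitLength l := by
  induction l with
  | nil => simp at ha
  | cons b l ih =>
    simp only [RAM.bitLength, List.map_cons, List.sum_cons] at *
    rcases List.mem_cons.1 ha with rfl | ha
    · omega
    · have := ih ha; omega

theorem prio_size_le (u : Fin 𝔊.n) : (𝔊.prio u).size ≤ RAM.bitLength 𝔊.encode := by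
  refine size_le_bitLength ?_
  simp only [encode, List.mem_append, List.mem_ofFn]
  exact Or.inl (Or.inl (Or.inr ⟨u, rfl⟩))

theorem n_le_bitLength : 𝔊.n ≤ RAM.bitLength 𝔊.encode := by
  refine le_trans ?_ (length_le_bitLength _)
  simp only [encode, List.length_append, List.length_ofFn]
  omega

/-- For `n = 0` every group is encoded by the empty list, and the number of groups, given in binary,
may be exponential in the input size. This case is the reason for `RAM.numGroups`. -/
theorem groups_le_bitLength (h : 𝔊.n ≠ 0) :
    𝔊.groups.length ≤ RAM.bitLength 𝔊.encode := by
  refine le_trans ?_ (length_le_bitLength _)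
  have h0 := List.length_flatMap_const 𝔊.encodeGroup (𝔊.n + 𝔊.n + 𝔊.n * 𝔊.n) 𝔊.groups
    (fun g _ => 𝔊.length_encodeGroup g)
  have h1 : 𝔊.groups.length * 1 ≤ 𝔊.groups.length * (𝔊.n + 𝔊.n + 𝔊.n * 𝔊.n) :=
    Nat.mul_le_mul_left _ (by omega)
  rw [encode_eq]
  simp only [List.length_append, h0]
  omega

end PersParityGame

/-! ### Derived expressions -/

namespace RAM

namespace Expr

/-- The value of `e` is nonzero. -/
def Tr (e : Expr) (s : State) : Prop := e.eval s ≠ 0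

/-- `e ≤ e₁` -/
def leE (e e₁ : Expr) : Expr := ite (sub e e₁) (lit 0) (lit 1)
/-- `e < e₁` -/
def ltE (e e₁ : Expr) : Expr := ite (sub e₁ e) (lit 1) (lit 0)
/-- Negation. -/
def notE (e : Expr) : Expr := ite e (lit 0) (lit 1)
/-- Conjunction. -/
def andE (e e₁ : Expr) : Expr := ite e e₁ (lit 0)
/-- Disjunction. -/
def orE (e e₁ : Expr) : Expr := ite e (lit 1) e₁
/-- `e = e₁` -/
def eqE (e e₁ : Expr) : Expr := andE (leE e e₁) (leE e₁ e)

theorem eval_leE (e e' : Expr) (s : State) :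
    (leE e e').eval s = if e.eval s ≤ e'.eval s then 1 else 0 := by
  by_cases h : e.eval s ≤ e'.eval s
  · simp [leE, eval, h]
  · simp [leE, eval, h, Nat.sub_eq_zero_iff_le]

theorem eval_ltE (e e' : Expr) (s : State) :
    (ltE e e').eval s = if e.eval s < e'.eval s then 1 else 0 := by
  by_cases h : e.eval s < e'.eval s
  · simp [ltE, eval, h, Nat.sub_eq_zero_iff_le]
  · simp [ltE, eval, h, Nat.sub_eq_zero_iff_le]

theorem tr_leE {e e' : Expr} {s : State} : (leE e e').Tr s ↔ e.eval s ≤ e'.eval s := by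
  simp [Tr, eval_leE]

theorem tr_ltE {e e' : Expr} {s : State} : (ltE e e').Tr s ↔ e.eval s < e'.eval s := by
  simp [Tr, eval_ltE]

theorem tr_ite {e e₁ e₂ : Expr} {s : State} :
    (ite e e₁ e₂).Tr s ↔ (e.Tr s ∧ e₁.Tr s) ∨ (¬ e.Tr s ∧ e₂.Tr s) := by
  by_cases h : e.eval s = 0 <;> simp [Tr, eval, h]

theorem tr_notE {e : Expr} {s : State} : (notE e).Tr s ↔ ¬ e.Tr s := by
  by_cases h : e.eval s = 0 <;> simp [Tr, notE, eval, h]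

theorem tr_andE {e e' : Expr} {s : State} : (andE e e').Tr s ↔ e.Tr s ∧ e'.Tr s := by
  by_cases h : e.eval s = 0 <;> simp [Tr, andE, eval, h]

theorem tr_orE {e e' : Expr} {s : State} : (orE e e').Tr s ↔ e.Tr s ∨ e'.Tr s := by
  by_cases h : e.eval s = 0 <;> simp [Tr, orE, eval, h]

theorem tr_eqE {e e' : Expr} {s : State} : (eqE e e').Tr s ↔ e.eval s = e'.eval s := by
  rw [eqE, tr_andE, tr_leE, tr_leE]; omega

theorem tr_sum {i r : ℕ} {e : Expr} {s : State} :
    (sum i r e).Tr s ↔ ∃ k < s.reg r, e.Tr (s.setReg i k) := by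
  simp [Tr, eval]

theorem tr_get {a : ℕ} {e : Expr} {s : State} : (get a e).Tr s ↔ s.arr a (e.eval s) ≠ 0 := Iff.rfl

end Expr

open RAM.Expr

/-! ### The program

Variables: `1` number of vertices `n`, `2` number of groups, `3` and `4` vertices `u` and `v`, `5` and
`6` summation variables, `7` and `8` the numbers `M + 1` and `M`, `9` number of sweeps, `10` to `14`
the numbers `n * n`, offset of the edges, offset of the groups, size of a group, `n + n`, `15` and
`16` a priority and its parity, `17` and `18` a power of two and its exponent, `19` and `20` lengths
of the old and the new word, `21` a level, `22` to `25` loop variables, `26` a dummy.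
Arrays: `0` input and output, `1` rank plus one, `2` parity, `3` and `4` levels and labels of the
word, `5` and `6` levels and labels of the new word, `7` measure, `8` output. -/

/-- The value of the measure at the source of the move. -/
def xE : Expr := get 7 (var 3)
/-- The value of the measure at the target of the move. -/
def yE : Expr := get 7 (var 4)
/-- The number of positions up to `e` of level at least the one of the source. -/
def compE (e : Expr) : Expr :=
  sum 6 7 (andE (leE (var 6) e) (leE (get 1 (var 3)) (get 3 (var 6))))
/-- The offset of row `u` of a matrix. -/
def rowE : Expr := sum 6 3 (var 1)
/-- The offset of the group given by the label at the source. -/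
def groupE : Expr :=
  add (var 12) (sum 6 2 (ite (ltE (var 6) (sub (get 4 xE) (lit 1))) (var 13) (lit 0)))
/-- The move is allowed by the group given by the label at the source. -/
def allowedE : Expr :=
  andE (get 0 (add groupE (var 3))) (andE (notE (get 0 (add groupE (add (var 1) (add (var 10)
    (var 3))))))
    (notE (sum 5 1 (andE (notE (eqE (var 5) (var 4)))
      (get 0 (add groupE (add (var 1) (add rowE (var 5)))))))))
/-- The condition on a move. -/
def okE : Expr :=
  ite (andE (get 4 xE) (leE (get 1 (var 3)) (get 3 xE)))
    (orE (ltE yE xE) (andE (eqE yE xE) allowedE))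
    (leE (add (compE yE) (get 2 (var 3))) (compE xE))
/-- There is a move from `u` to `v`. -/
def adjE : Expr := get 0 (add (var 11) (add rowE (var 4)))
/-- The condition for a progress measure fails. -/
def failE : Expr :=
  ite (get 0 (add (lit 2) (var 3))) (sum 4 1 (andE adjE (notE okE)))
    (notE (sum 4 1 (andE adjE okE)))
/-- The move to `v` may be chosen. -/
def goodE : Expr := andE adjE (orE (leE (var 8) xE) okE)
/-- The first move that may be chosen. -/
def firstE : Expr := sum 25 1 (notE (sum 4 1 (andE (leE (var 4) (var 25)) goodE)))

/-- No operation. -/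
def skipC : Cmd := .assign 26 (lit 0)

/-- Read the header. -/
def headerC : Cmd :=
  .seq (.assign 1 (get 0 (lit 0))) (.assign 2 (ite (var 1) (get 0 (lit 1)) (lit 0)))

/-- Compute the offsets. -/
def offsetC : Cmd :=
  .seq (.assign 10 (sum 5 1 (var 1))) (.seq (.assign 11 (add (add (lit 2) (var 1)) (var 1)))
    (.seq (.assign 12 (add (var 11) (var 10))) (.seq (.assign 13 (add (add (var 1) (var 1)) (var 10)))
      (.assign 14 (add (var 1) (var 1))))))

/-- Compute the ranks. -/
def rankC : Cmd :=
  .loop 3 1 (.store 1 (var 3) (add (sum 4 1 (ltE (get 0 (add (add (lit 2) (var 1)) (var 4)))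
    (get 0 (add (add (lit 2) (var 1)) (var 3))))) (lit 1)))

/-- Compute the parity of one priority. -/
def parityBody : Cmd :=
  .seq (.assign 15 (get 0 (add (add (lit 2) (var 1)) (var 3)))) (.seq (.parity 16 15)
    (.store 2 (var 3) (var 16)))

/-- Compute the parities of the priorities. -/
def parityC : Cmd := .loop 3 1 parityBody

/-- Compute an exponent whose power of two exceeds the number of vertices. -/
def exponentC : Cmd :=
  .seq (.assign 17 (lit 1)) (.seq (.assign 18 (lit 0)) (.loop 24 1 (.ite (leE (var 17) (var 1))
    (.seq (.assign 17 (add (var 17) (var 17))) (.assign 18 (add (var 18) (lit 1)))) skipC)))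

/-- Append a letter to the new word. -/
def pushC (e e₁ : Expr) : Cmd :=
  .seq (.assign 20 (add (var 20) (lit 1))) (.seq (.store 5 (var 20) e) (.store 6 (var 20) e₁))

/-- Append the old word with capped levels to the new word. -/
def capC : Cmd :=
  .loop 24 19 (pushC (sub (get 3 (add (var 24) (lit 1))) (sub (get 3 (add (var 24) (lit 1)))
    (var 21))) (get 4 (add (var 24) (lit 1))))

/-- Append one letter for each label to the new word. -/
def midC : Cmd := .seq (.loop 25 2 (pushC (var 21) (add (var 25) (lit 1)))) (pushC (var 21) (lit 0))

/-- Compute the new word from the old one. -/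
def blockC : Cmd :=
  .seq (.assign 20 (lit 0)) (.loop 23 14 (.seq
    (.assign 21 (add (sub (var 1) (var 23)) (sub (add (var 23) (lit 1)) (var 1))))
      (.seq capC midC)))

/-- Replace the old word by the new one. -/
def copyC : Cmd :=
  .loop 24 20 (.seq (.store 3 (add (var 24) (lit 1)) (get 5 (add (var 24) (lit 1))))
    (.store 4 (add (var 24) (lit 1)) (get 6 (add (var 24) (lit 1)))))

/-- One round of the construction of the word. -/
def roundC : Cmd := .seq blockC (.seq copyC (.assign 19 (var 20)))

/-- Construct the word. -/
def wordC : Cmd := .loop 22 18 roundC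

/-- Complete the table and compute the number of sweeps. -/
def tableC : Cmd :=
  .seq (.assign 8 (add (var 19) (lit 1))) (.seq (.assign 7 (add (var 8) (lit 1)))
    (.seq (.store 3 (var 8) (var 1)) (.seq (.store 3 (lit 0) (lit 0)) (.seq (.store 4 (lit 0) (lit 0))
      (.seq (.loop 3 1 (.store 7 (var 3) (lit 0)))
        (.assign 9 (add (sum 5 1 (var 8)) (lit 1))))))))

/-- Lift the measure at one vertex. -/
def liftC : Cmd :=
  .ite (andE (ltE xE (var 8)) failE) (.store 7 (var 3) (add xE (lit 1))) skipC

/-- Compute the least measure. -/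
def sweepsC : Cmd := .loop 22 9 (.loop 3 1 liftC)

/-- Write the output. -/
def outputC : Cmd :=
  .seq (.loop 3 1 (.seq (.store 8 (var 3) (ltE xE (var 8))) (.store 8 (add (var 1) (var 3)) firstE)))
    (.seq (.loop 3 14 (.store 0 (var 3) (get 8 (var 3)))) (.assign 0 (var 14)))

/-- The program. -/
def solveC : Cmd :=
  .seq headerC (.seq offsetC (.seq rankC (.seq parityC (.seq exponentC (.seq
    (.assign 19 (lit 0)) (.seq wordC (.seq tableC (.seq sweepsC outputC))))))))

theorem plain_headerC : headerC.plain := by decide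
theorem plain_offsetC : offsetC.plain := by decide
theorem plain_rankC : rankC.plain := by decide
theorem plain_exponentC : exponentC.plain := by decide
theorem plain_blockC : blockC.plain := by decide
theorem plain_copyC : copyC.plain := by decide
theorem plain_tableC : tableC.plain := by decide
theorem plain_sweepsC : sweepsC.plain := by decide
theorem plain_outputC : outputC.plain := by decide
theorem lims_sweepsC : ∀ r ∈ sweepsC.lims, r = 1 ∨ r = 2 ∨ r = 7 ∨ r = 9 := by decide
theorem lims_outputC : ∀ r ∈ outputC.lims, r = 1 ∨ r = 2 ∨ r = 7 ∨ r = 14 := by decide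
theorem lims_tableC : ∀ r ∈ tableC.lims, r = 1 := by decide
theorem lims_copyC : ∀ r ∈ copyC.lims, r = 20 := by decide
theorem lims_blockC : ∀ r ∈ blockC.lims, r = 2 ∨ r = 14 ∨ r = 19 := by decide
theorem lims_exponentC : ∀ r ∈ exponentC.lims, r = 1 := by decide
theorem lims_rankC : ∀ r ∈ rankC.lims, r = 1 := by decide
theorem lims_offsetC : ∀ r ∈ offsetC.lims, r = 1 := by decide
theorem lims_headerC : ∀ r ∈ headerC.lims, r = 1 := by decide

end RAM

/-! ### Invariants of the program state -/

open RAM.Expr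

namespace RAM

variable {𝔊 : PersParityGame}

/-- The number of groups, or zero if there are no vertices. -/
def numGroups (𝔊 : PersParityGame) : ℕ := if 𝔊.n = 0 then 0 else 𝔊.groups.length

theorem numGroups_eq (u : Fin 𝔊.n) : numGroups 𝔊 = 𝔊.groups.length :=
  if_neg (by have := u.2; omega)

/-- The input and the numbers derived from its header are available. -/
structure Base (𝔊 : PersParityGame) (s : State) : Prop where
  arr0 : s.arr 0 = 𝔊.inp
  r1 : s.reg 1 = 𝔊.n
  r2 : s.reg 2 = numGroups 𝔊
  r10 : s.reg 10 = 𝔊.n * 𝔊.n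
  r11 : s.reg 11 = 2 + 𝔊.n + 𝔊.n
  r12 : s.reg 12 = 2 + 𝔊.n + 𝔊.n + 𝔊.n * 𝔊.n
  r13 : s.reg 13 = 𝔊.n + 𝔊.n + 𝔊.n * 𝔊.n
  r14 : s.reg 14 = 𝔊.n + 𝔊.n

theorem Base.setReg {s : State} (h : Base 𝔊 s) {x : ℕ} (hx : x ∉ [1, 2, 10, 11, 12, 13, 14])
    (k : ℕ) : Base 𝔊 (s.setReg x k) := by
  simp only [List.mem_cons, List.not_mem_nil, or_false, not_or] at hx
  obtain ⟨h1, h2, h10, h11, h12, h13, h14⟩ := hx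
  refine ⟨h.arr0, ?_, ?_, ?_, ?_, ?_, ?_, ?_⟩ <;> rw [State.setReg_reg, if_neg (Ne.symm ‹_›)]
  exacts [h.r1, h.r2, h.r10, h.r11, h.r12, h.r13, h.r14]

theorem State.setArr_arr_of_ne {s : State} {a b : ℕ} (h : b ≠ a) (i k : ℕ) :
    (s.setArr a i k).arr b = s.arr b := by
  funext j
  simp [h]

theorem Base.setArr {s : State} (h : Base 𝔊 s) {a : ℕ} (ha : a ≠ 0) (i k : ℕ) :
    Base 𝔊 (s.setArr a i k) :=
  ⟨by rw [State.setArr_arr_of_ne ha.symm, h.arr0], h.r1, h.r2, h.r10, h.r11, h.r12, h.r13, h.r14⟩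

/-- Moreover the ranks and the parities are available. -/
structure Ranked (𝔊 : PersParityGame) (s : State) : Prop extends Base 𝔊 s where
  rank : ∀ u : Fin 𝔊.n, s.arr 1 u = 𝔊.rank u + 1
  odd : ∀ u : Fin 𝔊.n, s.arr 2 u = 𝔊.prio u % 2

theorem Ranked.setReg {s : State} (h : Ranked 𝔊 s) {x : ℕ} (hx : x ∉ [1, 2, 10, 11, 12, 13, 14])
    (k : ℕ) : Ranked 𝔊 (s.setReg x k) := ⟨h.toBase.setReg hx k, h.rank, h.odd⟩

theorem Ranked.setArr {s : State} (h : Ranked 𝔊 s) {a : ℕ} (ha : 3 ≤ a) (i k : ℕ) :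
    Ranked 𝔊 (s.setArr a i k) := by
  refine ⟨h.toBase.setArr (by omega) i k, fun u => ?_, fun u => ?_⟩
  · rw [State.setArr_arr_of_ne (by omega), h.rank]
  · rw [State.setArr_arr_of_ne (by omega), h.odd]

/-! ### Values of the expressions of the program -/

theorem eval_rowE (s : State) : rowE.eval s = s.reg 3 * s.reg 1 := by
  simp [rowE, Expr.eval]

theorem eval_compE {e : Expr} {s : State} {M x : ℕ} (h7 : s.reg 7 = M + 1)
    (he : ∀ k, e.eval (s.setReg 6 k) = x) (hx : x ≤ M) :
    (compE e).eval s = comp (s.arr 3) (s.arr 1 (s.reg 3)) x := by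
  have : ∀ k, (andE (leE (var 6) e) (leE (get 1 (var 3)) (get 3 (var 6)))).eval (s.setReg 6 k) =
      if k ≤ x ∧ s.arr 1 (s.reg 3) ≤ s.arr 3 k then 1 else 0 := by
    intro k
    simp only [andE, Expr.eval, eval_leE, he, State.setReg_reg, State.setReg_arr]
    by_cases h : k ≤ x <;> simp [h]
  rw [compE, Expr.eval]
  simp only [this, h7]
  rw [← Finset.card_filter, comp]
  congr 1
  ext k
  simp only [Finset.mem_filter, Finset.mem_range]
  omega

theorem sum_ite_lt {g m : ℕ} (c : ℕ) (h : g ≤ m) :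
    ∑ k ∈ Finset.range m, (if k < g then c else 0) = g * c := by
  rw [← Finset.sum_filter, show (Finset.range m).filter (· < g) = Finset.range g by
    ext k; simp; omega]
  simp

theorem eval_groupE {s : State} {l : ℕ} (hl : s.arr 4 (s.arr 7 (s.reg 3)) = l)
    (h : l - 1 ≤ s.reg 2) : groupE.eval s = s.reg 12 + (l - 1) * s.reg 13 := by
  have : ∀ k, (Expr.ite (ltE (var 6) (sub (get 4 xE) (lit 1))) (var 13) (lit 0)).eval
      (s.setReg 6 k) = if k < l - 1 then s.reg 13 else 0 := by
    intro k
    simp only [Expr.eval, eval_ltE, xE, State.setReg_reg, State.setReg_arr]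
    simp only [Nat.reduceEqDiff, if_true, if_false, hl, ne_eq, ite_eq_right_iff, one_ne_zero,
      imp_false, not_not]
  change s.reg 12 + ∑ k ∈ Finset.range (s.reg 2), (Expr.ite (ltE (var 6) (sub (get 4 xE) (lit 1)))
    (var 13) (lit 0)).eval (s.setReg 6 k) = _
  simp only [this]
  rw [sum_ite_lt _ h]

theorem tr_adjE {s : State} (h : Base 𝔊 s) {u v : Fin 𝔊.n} (hu : s.reg 3 = u) (hv : s.reg 4 = v) :
    adjE.Tr s ↔ 𝔊.graph.edge u v := by
  rw [adjE, tr_get, Expr.eval, Expr.eval, Expr.eval, Expr.eval, eval_rowE, h.arr0, h.r11, h.r1, hu,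
    hv, 𝔊.inp_edge, bit_ne_zero]

theorem tr_allowedE {s : State} (h : Base 𝔊 s) {u v : Fin 𝔊.n} (hu : s.reg 3 = u)
    (hv : s.reg 4 = v) {l : ℕ} (hl : s.arr 4 (s.arr 7 u) = l) (hl0 : l ≠ 0)
    (hlm : l ≤ 𝔊.groups.length) : allowedE.Tr s ↔ 𝔊.al (l - 1) (u, v) := by
  have hg : l - 1 < 𝔊.groups.length := by omega
  have hr2 := h.r2
  rw [numGroups_eq u] at hr2
  have hge : groupE.eval s =
      2 + 𝔊.n + 𝔊.n + 𝔊.n * 𝔊.n + (l - 1) * (𝔊.n + 𝔊.n + 𝔊.n * 𝔊.n) := by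
    rw [eval_groupE (l := l) (by rw [hu]; exact hl) (by omega), h.r12, h.r13]
  have hge' : ∀ k, groupE.eval (s.setReg 5 k) =
      2 + 𝔊.n + 𝔊.n + 𝔊.n * 𝔊.n + (l - 1) * (𝔊.n + 𝔊.n + 𝔊.n * 𝔊.n) := by
    intro k
    have hl5 : (s.setReg 5 k).arr 4 ((s.setReg 5 k).arr 7 ((s.setReg 5 k).reg 3)) = l := by
      simpa [hu] using hl
    have h25 : l - 1 ≤ (s.setReg 5 k).reg 2 := by
      change l - 1 ≤ s.reg 2
      omega
    rw [eval_groupE hl5 h25]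
    change s.reg 12 + (l - 1) * s.reg 13 = _
    rw [h.r12, h.r13]
  have hC : ∀ w : Fin 𝔊.n, (get 0 (add groupE (add (var 1) (add rowE (var 5))))).Tr
      (s.setReg 5 w) ↔ (u, w) ∈ 𝔊.groups[l - 1].C := by
    intro w
    rw [tr_get, Expr.eval, Expr.eval, Expr.eval, Expr.eval, Expr.eval, hge', eval_rowE]
    simp only [State.setReg_reg, State.setReg_arr, h.arr0]
    simp only [Nat.reduceEqDiff, if_true, if_false, hu, h.r1]
    rw [𝔊.inp_C hg, bit_ne_zero]
  have hS : (get 0 (add groupE (var 3))).Tr s ↔ u ∈ 𝔊.groups[l - 1].S := by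
    rw [tr_get, Expr.eval, Expr.eval, hge, hu, h.arr0, 𝔊.inp_S hg, bit_ne_zero]
  have hT : (get 0 (add groupE (add (var 1) (add (var 10) (var 3))))).Tr s ↔
      u ∈ 𝔊.groups[l - 1].T := by
    rw [tr_get, Expr.eval, Expr.eval, Expr.eval, Expr.eval, Expr.eval, Expr.eval, hge, hu, h.arr0,
      h.r1, h.r10, 𝔊.inp_T hg, bit_ne_zero]
  rw [allowedE, tr_andE, tr_andE, tr_notE, tr_notE, tr_sum, hS, hT]
  simp only [tr_andE, tr_notE, tr_eqE, Expr.eval, State.setReg_reg, h.r1]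
  simp only [Nat.reduceEqDiff, if_true, if_false, hv]
  constructor
  · rintro ⟨h1, h2, h3⟩
    refine ⟨hg, h1, h2, fun w hw => ?_⟩
    by_contra hne
    exact h3 ⟨w, w.2, fun h => hne (Fin.ext h), (hC w).2 hw⟩
  · rintro ⟨_, h1, h2, h3⟩
    refine ⟨h1, h2, ?_⟩
    rintro ⟨k, hk, hkv, hk'⟩
    exact hkv (congrArg Fin.val (h3 ⟨k, hk⟩ ((hC ⟨k, hk⟩).1 hk')))

/-- The table and a measure are available. -/
structure Tabled (𝔊 : PersParityGame) (M : ℕ) (lev lab : ℕ → ℕ) (μ : Fin 𝔊.n → ℕ) (s : State) :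
    Prop extends Ranked 𝔊 s where
  r7 : s.reg 7 = M + 1
  r8 : s.reg 8 = M
  arr3 : s.arr 3 = lev
  arr4 : s.arr 4 = lab
  arr7 : ∀ u : Fin 𝔊.n, s.arr 7 u = μ u
  le : ∀ u, μ u ≤ M
  lab_le : ∀ x < M, lab x ≤ 𝔊.groups.length

variable {M : ℕ} {lev lab : ℕ → ℕ} {μ : Fin 𝔊.n → ℕ}

theorem Tabled.setReg {s : State} (h : Tabled 𝔊 M lev lab μ s) {x : ℕ}
    (hx : x ∉ [1, 2, 10, 11, 12, 13, 14, 7, 8]) (k : ℕ) :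
    Tabled 𝔊 M lev lab μ (s.setReg x k) := by
  refine ⟨h.toRanked.setReg (fun hx' => hx ?_) k, ?_, ?_, h.arr3, h.arr4, h.arr7, h.le, h.lab_le⟩
  · simp only [List.mem_cons, List.not_mem_nil, or_false] at hx' ⊢; tauto
  · rw [State.setReg_reg, if_neg, h.r7]; rintro rfl; simp at hx
  · rw [State.setReg_reg, if_neg, h.r8]; rintro rfl; simp at hx

theorem Tabled.setArr {s : State} (h : Tabled 𝔊 M lev lab μ s) {a : ℕ} (ha : 8 ≤ a) (i k : ℕ) :
    Tabled 𝔊 M lev lab μ (s.setArr a i k) := by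
  refine ⟨h.toRanked.setArr (by omega) i k, h.r7, h.r8, ?_, ?_, fun u => ?_, h.le, h.lab_le⟩
  · rw [State.setArr_arr_of_ne (by omega), h.arr3]
  · rw [State.setArr_arr_of_ne (by omega), h.arr4]
  · rw [State.setArr_arr_of_ne (by omega), h.arr7]

/-- The restriction to `μ u < M` ensures that the label at the source is a genuine group number; the
label at the top position is never constrained. -/
theorem tr_okE {s : State} (h : Tabled 𝔊 M lev lab μ s) {u v : Fin 𝔊.n} (hu : s.reg 3 = u)
    (hv : s.reg 4 = v) (hM : μ u < M) : okE.Tr s ↔ 𝔊.OK lev lab u v (μ u) (μ v) := by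
  have hx : xE.eval s = μ u := by rw [xE, Expr.eval, Expr.eval, hu, h.arr7]
  have hy : yE.eval s = μ v := by rw [yE, Expr.eval, Expr.eval, hv, h.arr7]
  have hl : (get 4 xE).eval s = lab (μ u) := by rw [Expr.eval, hx, h.arr4]
  have hcx : (compE xE).eval s = comp lev (𝔊.rank u + 1) (μ u) := by
    rw [eval_compE h.r7 (x := μ u) (fun k => ?_) (h.le u), h.arr3, hu, h.rank]
    simp [xE, Expr.eval, hu, h.arr7]
  have hcy : (compE yE).eval s = comp lev (𝔊.rank u + 1) (μ v) := by
    rw [eval_compE h.r7 (x := μ v) (fun k => ?_) (h.le v), h.arr3, hu, h.rank]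
    simp [yE, Expr.eval, hv, h.arr7]
  have hlt : (get 4 xE).Tr s ↔ lab (μ u) ≠ 0 := by rw [Tr, hl]
  have hθ : (leE (get 1 (var 3)) (get 3 xE)).Tr s ↔ 𝔊.rank u + 1 ≤ lev (μ u) := by
    rw [tr_leE, Expr.eval, Expr.eval, Expr.eval, hx, hu, h.rank, h.arr3]
  rw [okE, tr_ite, tr_andE, tr_orE, tr_andE, tr_eqE, tr_ltE, hlt, hθ, tr_leE, Expr.eval, hcx, hcy,
    hx, hy, Expr.eval, Expr.eval, hu, h.odd, PersParityGame.OK, MoveOK, and_assoc]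
  refine or_congr (and_congr_right fun h1 => and_congr_right fun _ => or_congr Iff.rfl
    (and_congr_right fun _ => ?_)) Iff.rfl
  exact tr_allowedE h.toBase hu hv (by rw [h.arr7, h.arr4]) h1 (h.lab_le _ hM)

theorem tr_failE {s : State} (h : Tabled 𝔊 M lev lab μ s) {u : Fin 𝔊.n} (hu : s.reg 3 = u)
    (hM : μ u < M) : failE.Tr s ↔ ¬ 𝔊.Cond lev lab μ u := by
  have key : ∀ v : Fin 𝔊.n, (adjE.Tr (s.setReg 4 v) ↔ 𝔊.graph.edge u v) ∧
      (okE.Tr (s.setReg 4 v) ↔ 𝔊.OK lev lab u v (μ u) (μ v)) := by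
    intro v
    have h' := h.setReg (x := 4) (by decide) v
    exact ⟨tr_adjE h'.toBase (by simpa using hu) (by simp),
      tr_okE h' (by simpa using hu) (by simp) hM⟩
  have ho : (get 0 (add (lit 2) (var 3))).Tr s ↔ 𝔊.graph.owner u ≠ 0 := by
    rw [tr_get, Expr.eval, Expr.eval, Expr.eval, hu, h.arr0, 𝔊.inp_owner, ne_eq, ne_eq,
      Fin.ext_iff]
    rfl
  rw [failE, tr_ite, tr_notE, tr_sum, tr_sum, ho, h.r1, PersParityGame.Cond]
  simp only [tr_andE, tr_notE]
  have h1 : (∃ k < 𝔊.n, adjE.Tr (s.setReg 4 k) ∧ ¬ okE.Tr (s.setReg 4 k)) ↔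
      ∃ v, 𝔊.graph.edge u v ∧ ¬ 𝔊.OK lev lab u v (μ u) (μ v) := by
    constructor
    · rintro ⟨k, hk, ha, hb⟩
      exact ⟨⟨k, hk⟩, (key ⟨k, hk⟩).1.1 ha, fun h => hb ((key ⟨k, hk⟩).2.2 h)⟩
    · rintro ⟨v, ha, hb⟩
      exact ⟨v, v.2, (key v).1.2 ha, fun h => hb ((key v).2.1 h)⟩
  have h2 : (∃ k < 𝔊.n, adjE.Tr (s.setReg 4 k) ∧ okE.Tr (s.setReg 4 k)) ↔
      ∃ v, 𝔊.graph.edge u v ∧ 𝔊.OK lev lab u v (μ u) (μ v) := by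
    constructor
    · rintro ⟨k, hk, ha, hb⟩
      exact ⟨⟨k, hk⟩, (key ⟨k, hk⟩).1.1 ha, (key ⟨k, hk⟩).2.1 hb⟩
    · rintro ⟨v, ha, hb⟩
      exact ⟨v, v.2, (key v).1.2 ha, (key v).2.2 hb⟩
  rw [h1, h2]
  by_cases hown : 𝔊.graph.owner u = 0
  · simp [hown]
  · simp [hown]

/-- Search by summation: the number of indices `k` with no witness up to `k` is the least witness.
-/
theorem sum_not_exists_le {n : ℕ} {P : ℕ → Prop} (h : ∃ j < n, P j) :
    ∃ j < n, P j ∧ ∀ b : ℕ → ℕ, (∀ k < n, ((∃ j < n, j ≤ k ∧ P j) → b k = 0) ∧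
      ((¬ ∃ j < n, j ≤ k ∧ P j) → b k = 1)) → ∑ k ∈ Finset.range n, b k = j := by
  classical
  refine ⟨Nat.find h, (Nat.find_spec h).1, (Nat.find_spec h).2, fun b hb => ?_⟩
  rw [Finset.sum_congr rfl (g := fun k => if k < Nat.find h then 1 else 0)]
  · rw [sum_ite_lt _ (Nat.find_spec h).1.le, mul_one]
  · intro k hk
    obtain ⟨hb0, hb1⟩ := hb k (Finset.mem_range.1 hk)
    by_cases hlt : k < Nat.find h
    · rw [if_pos hlt, hb1]
      rintro ⟨j, hj, hjk, hP⟩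
      exact Nat.find_min h (hjk.trans_lt hlt) ⟨hj, hP⟩
    · rw [if_neg hlt, hb0]
      exact ⟨_, (Nat.find_spec h).1, not_lt.1 hlt, (Nat.find_spec h).2⟩

/-- Stability supplies a suitable move below the top, for either owner, and any move serves at the
top. The chosen `v` precedes the quantifier over states because the output loop changes the state
between evaluations. -/
theorem eval_firstE (hst : Stable (𝔊.Cond lev lab) M μ) (u : Fin 𝔊.n) :
    ∃ v : Fin 𝔊.n, 𝔊.graph.edge u v ∧ (μ u < M → 𝔊.OK lev lab u v (μ u) (μ v)) ∧
      ∀ s, Tabled 𝔊 M lev lab μ s → s.reg 3 = u → firstE.eval s = v := by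
  have key : ∀ s, Tabled 𝔊 M lev lab μ s → s.reg 3 = u → ∀ (k : ℕ) (v : Fin 𝔊.n),
      (goodE.Tr ((s.setReg 25 k).setReg 4 v) ↔
        𝔊.graph.edge u v ∧ (μ u < M → 𝔊.OK lev lab u v (μ u) (μ v))) := by
    intro s h hu k v
    have h' := (h.setReg (x := 25) (by decide) k).setReg (x := 4) (by decide) v
    have hu' : ((s.setReg 25 k).setReg 4 v).reg 3 = u := by simpa using hu
    rw [goodE, tr_andE, tr_orE, tr_leE, tr_adjE (v := v) h'.toBase hu' (by simp)]
    refine and_congr_right fun _ => ?_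
    rw [xE, Expr.eval, Expr.eval, Expr.eval, hu', h'.arr7, h'.r8]
    by_cases hM : μ u < M
    · rw [tr_okE (v := v) h' hu' (by simp) hM]
      simp [hM]
    · simp [hM]; omega
  have hex : ∃ v, 𝔊.graph.edge u v ∧ (μ u < M → 𝔊.OK lev lab u v (μ u) (μ v)) := by
    by_cases hM : μ u < M
    · by_cases ho : 𝔊.graph.owner u = 0
      · obtain ⟨v, h1, h2⟩ := (hst u hM).1 ho
        exact ⟨v, h1, fun _ => h2⟩
      · obtain ⟨v, hv⟩ := 𝔊.graph.exists_edge u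
        exact ⟨v, hv, fun _ => (hst u hM).2 ho v hv⟩
    · obtain ⟨v, hv⟩ := 𝔊.graph.exists_edge u
      exact ⟨v, hv, fun h => absurd h hM⟩
  obtain ⟨v₀, hv₀⟩ := hex
  obtain ⟨j, hj, ⟨hj', hP⟩, hsum⟩ := sum_not_exists_le (n := 𝔊.n) (P := fun j => ∃ hj : j < 𝔊.n,
    𝔊.graph.edge u ⟨j, hj⟩ ∧ (μ u < M → 𝔊.OK lev lab u ⟨j, hj⟩ (μ u) (μ ⟨j, hj⟩)))
    ⟨v₀, v₀.2, v₀.2, hv₀⟩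
  refine ⟨⟨j, hj⟩, hP.1, hP.2, fun s h hu => ?_⟩
  rw [firstE, Expr.eval, h.r1]
  refine hsum _ fun k hk => ?_
  have hiff : (sum 4 1 (andE (leE (var 4) (var 25)) goodE)).Tr (s.setReg 25 k) ↔
      ∃ j < 𝔊.n, j ≤ k ∧ ∃ hj : j < 𝔊.n, 𝔊.graph.edge u ⟨j, hj⟩ ∧
        (μ u < M → 𝔊.OK lev lab u ⟨j, hj⟩ (μ u) (μ ⟨j, hj⟩)) := by
    rw [tr_sum]
    simp only [tr_andE, tr_leE, Expr.eval, State.setReg_reg]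
    simp only [Nat.reduceEqDiff, if_true, if_false, h.r1]
    constructor
    · rintro ⟨j, hj, hjk, hg⟩
      exact ⟨j, hj, hjk, hj, (key s h hu k ⟨j, hj⟩).1 hg⟩
    · rintro ⟨j, hj, hjk, _, hg⟩
      exact ⟨j, hj, hjk, (key s h hu k ⟨j, hj⟩).2 hg⟩
  refine ⟨fun hh => ?_, fun hh => ?_⟩
  · rw [notE, Expr.eval, if_pos (show _ ≠ 0 from hiff.2 hh)]; rfl
  · rw [notE, Expr.eval, if_neg (show ¬ (_ ≠ 0) from fun hc => hh (hiff.1 hc))]; rfl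

/-! ### The sweeps and the output -/

theorem run_liftC {s : State} (h : Tabled 𝔊 M lev lab μ s) {u : Fin 𝔊.n} (hu : s.reg 3 = u) :
    Tabled 𝔊 M lev lab (liftAt (𝔊.Cond lev lab) M u μ) (liftC.run s) := by
  have hx : xE.eval s = μ u := by rw [xE, Expr.eval, Expr.eval, hu, h.arr7]
  have hiff : (andE (ltE xE (var 8)) failE).Tr s ↔ μ u < M ∧ ¬ 𝔊.Cond lev lab μ u := by
    rw [tr_andE, tr_ltE, hx, Expr.eval, h.r8]
    exact and_congr_right fun hM => tr_failE h hu hM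
  rw [liftC, Cmd.run]
  by_cases hc : (andE (ltE xE (var 8)) failE).Tr s
  · rw [if_pos (show _ ≠ 0 from hc), liftAt, if_pos (hiff.1 hc), Cmd.run]
    refine ⟨h.toRanked.setArr (by omega) _ _, h.r7, h.r8, ?_, ?_, fun v => ?_, fun v => ?_,
      h.lab_le⟩
    · rw [State.setArr_arr_of_ne (by omega), h.arr3]
    · rw [State.setArr_arr_of_ne (by omega), h.arr4]
    · rw [State.setArr_arr, Function.update_apply, Expr.eval, Expr.eval, hx, Expr.eval, hu]
      simp only [true_and, Fin.val_inj, h.arr7]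
    · rw [Function.update_apply]
      split_ifs
      · exact (hiff.1 hc).1
      · exact h.le v
  · rw [if_neg (show ¬ (_ ≠ 0) from hc), liftAt, if_neg (fun hh => hc (hiff.2 hh))]
    exact h.setReg (by decide) _

theorem run_sweep {s : State} (h : Tabled 𝔊 M lev lab μ s) :
    Tabled 𝔊 M lev lab (sweep (𝔊.Cond lev lab) M 𝔊.n μ) ((Cmd.loop 3 1 liftC).run s) := by
  have := Cmd.run_loop_induction (c := liftC) (i := 3) (r := 1) (s := s)
    (fun k s => Tabled 𝔊 M lev lab (sweep (𝔊.Cond lev lab) M k μ) s) h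
    (fun k hk s' hs' => by
      rw [h.r1] at hk
      rw [sweep, dif_pos hk]
      exact run_liftC (hs'.setReg (by decide) _) (u := ⟨k, hk⟩) (by simp))
  rwa [h.r1] at this

theorem run_sweepsC {s : State} (h : Tabled 𝔊 M lev lab 0 s) (h9 : s.reg 9 = 𝔊.n * M + 1) :
    Tabled 𝔊 M lev lab (leastMeasure (𝔊.Cond lev lab) M) (sweepsC.run s) := by
  have := Cmd.run_loop_induction (c := .loop 3 1 liftC) (i := 22) (r := 9) (s := s)
    (fun k s => Tabled 𝔊 M lev lab ((sweep (𝔊.Cond lev lab) M 𝔊.n)^[k] 0) s) h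
    (fun k hk s' hs' => by
      rw [Function.iterate_succ_apply']
      exact run_sweep (hs'.setReg (by decide) _))
  rwa [h9] at this

theorem run_outputC {s : State} (h : Tabled 𝔊 M lev lab μ s)
    (hst : Stable (𝔊.Cond lev lab) M μ) :
    ∃ f : Fin 𝔊.n → Fin 𝔊.n, (∀ u, 𝔊.graph.edge u (f u)) ∧
      (∀ u, μ u < M → 𝔊.OK lev lab u (f u) (μ u) (μ (f u))) ∧
      (outputC.run s).Outputs (encodeSet {u | μ u < M} ++ List.ofFn fun v => (f v : ℕ)) := by
  choose f hf hok hfE using eval_firstE hst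
  refine ⟨f, hf, hok, ?_⟩
  have hxE : ∀ s', Tabled 𝔊 M lev lab μ s' → ∀ u : Fin 𝔊.n, s'.reg 3 = u →
      (ltE xE (var 8)).eval s' = bit (μ u < M) := by
    intro s' h' u hu
    rw [eval_ltE, xE, Expr.eval, Expr.eval, Expr.eval, hu, h'.arr7, h'.r8, bit]
    split_ifs <;> rfl
  -- The output is assembled in array `8`, since evaluating `firstE` still needs the input in array
  -- `0`; the second loop copies it over.
  set s₁ := (Cmd.loop 3 1 (.seq (.store 8 (var 3) (ltE xE (var 8)))
    (.store 8 (add (var 1) (var 3)) firstE))).run s with hs₁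
  have h1 : Tabled 𝔊 M lev lab μ s₁ ∧ ∀ u : Fin 𝔊.n, (u : ℕ) < 𝔊.n →
      s₁.arr 8 u = bit (μ u < M) ∧ s₁.arr 8 (𝔊.n + u) = f u := by
    have := Cmd.run_loop_induction (c := .seq (.store 8 (var 3) (ltE xE (var 8)))
      (.store 8 (add (var 1) (var 3)) firstE)) (i := 3) (r := 1) (s := s)
      (fun k s => Tabled 𝔊 M lev lab μ s ∧ ∀ u : Fin 𝔊.n, (u : ℕ) < k →
        s.arr 8 u = bit (μ u < M) ∧ s.arr 8 (𝔊.n + u) = f u)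
      ⟨h, fun u hu => absurd hu (Nat.not_lt_zero _)⟩
      (fun k hk s' hs' => by
        rw [h.r1] at hk
        have h0 := hs'.1.setReg (x := 3) (by decide) k
        have hu0 : (s'.setReg 3 k).reg 3 = (⟨k, hk⟩ : Fin 𝔊.n) := by simp
        set s₂ := (s'.setReg 3 k).setArr 8 ((var 3).eval (s'.setReg 3 k))
          (bit (μ ⟨k, hk⟩ < M)) with hs₂
        have h2 : Tabled 𝔊 M lev lab μ s₂ := h0.setArr (by omega) _ _
        have hrun : ((Cmd.store 8 (var 3) (ltE xE (var 8))).seq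
            (.store 8 (add (var 1) (var 3)) firstE)).run (s'.setReg 3 k) =
            s₂.setArr 8 ((add (var 1) (var 3)).eval s₂) (f ⟨k, hk⟩) := by
          have : (Cmd.store 8 (var 3) (ltE xE (var 8))).run (s'.setReg 3 k) = s₂ := by
            rw [Cmd.run, hxE _ h0 _ hu0]
          rw [Cmd.run, this, Cmd.run, hfE ⟨k, hk⟩ s₂ h2 hu0]
        rw [hrun]
        refine ⟨h2.setArr (by omega) _ _, fun u hu => ?_⟩
        have hv3 : (var 3).eval (s'.setReg 3 k) = k := hu0
        have hv13 : (add (var 1) (var 3)).eval s₂ = 𝔊.n + k := by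
          rw [Expr.eval, Expr.eval, Expr.eval, h2.r1]
          rfl
        rw [State.setArr_arr, State.setArr_arr, hv13, hs₂, State.setArr_arr, State.setArr_arr, hv3,
          State.setReg_arr]
        have hun := u.2
        rcases Nat.lt_succ_iff_lt_or_eq.1 hu with hlt | heq
        · simp only [true_and]
          rw [if_neg (by omega), if_neg (by omega), if_neg (by omega), if_neg (by omega)]
          exact hs'.2 u hlt
        · obtain rfl : u = ⟨k, hk⟩ := Fin.ext heq
          simp only [true_and]
          rw [if_neg (by omega)]
          exact ⟨if_pos trivial, if_pos trivial⟩)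
    rwa [h.r1] at this
  obtain ⟨h1, hout⟩ := h1
  have h2 := Cmd.run_loop_induction (c := .store 0 (var 3) (get 8 (var 3))) (i := 3) (r := 14)
    (s := s₁) (fun k s => s.reg 14 = 𝔊.n + 𝔊.n ∧ s.arr 8 = s₁.arr 8 ∧ ∀ j < k,
      s.arr 0 j = s₁.arr 8 j) ⟨h1.r14, rfl, fun j hj => absurd hj (Nat.not_lt_zero _)⟩
    (fun k hk s' hs' => by
      rw [Cmd.run, Expr.eval, Expr.eval, Expr.eval]
      refine ⟨hs'.1, ?_, fun j hj => ?_⟩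
      · rw [State.setArr_arr_of_ne (by omega)]; exact hs'.2.1
      · rw [State.setArr_arr]
        simp only [State.setReg_reg, if_true, State.setReg_arr, true_and, hs'.2.1]
        split_ifs with hjk
        · rw [hjk]
        · exact hs'.2.2 j (by omega))
  rw [h1.r14] at h2
  obtain ⟨h14, -, h0⟩ := h2
  change (State.setReg _ 0 (((Cmd.loop 3 14 (.store 0 (var 3) (get 8 (var 3)))).run s₁).reg
    14)).Outputs _
  rw [h14]
  have hlen : (encodeSet {u | μ u < M} ++ List.ofFn fun v => (f v : ℕ)).length = 𝔊.n + 𝔊.n := by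
    rw [List.length_append, length_encodeSet, List.length_ofFn]
  refine ⟨by rw [hlen]; simp, fun i hi => ?_⟩
  rw [hlen] at hi
  rw [State.setReg_arr, h0 i hi]
  by_cases hin : i < 𝔊.n
  · rw [List.getD_append _ _ _ _ (by rw [length_encodeSet]; exact hin)]
    exact ((hout ⟨i, hin⟩ hin).1).trans (getD_encodeSet {u | μ u < M} ⟨i, hin⟩).symm
  · obtain ⟨j, rfl⟩ := Nat.exists_eq_add_of_le (not_lt.1 hin)
    have hj : j < 𝔊.n := by omega
    have := List.getD_append_add (encodeSet {u | μ u < M}) (List.ofFn fun v => (f v : ℕ)) j 0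
    rw [length_encodeSet] at this
    rw [this, (hout ⟨j, hj⟩ hj).2, List.getD_eq_getElem _ _ (by simpa using hj), List.getElem_ofFn]

end RAM

open RAM.Expr

namespace RAM

variable {𝔊 : PersParityGame}

/-! ### Numbers, ranks and parities -/

theorem base_offsetC (𝔊 : PersParityGame) :
    Base 𝔊 (offsetC.run (headerC.run (State.input 𝔊.encode))) := by
  have h0 := 𝔊.inp_zero
  have h1 := 𝔊.inp_one
  have ha : (State.input 𝔊.encode).arr 0 = 𝔊.inp := rfl
  have hr1 : (headerC.run (State.input 𝔊.encode)).reg 1 = 𝔊.n := by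
    simp [headerC, Cmd.run, Expr.eval, ha, h0]
  have hr2 : (headerC.run (State.input 𝔊.encode)).reg 2 = numGroups 𝔊 := by
    by_cases hn : 𝔊.n = 0 <;> simp [headerC, Cmd.run, Expr.eval, ha, h0, h1, numGroups, hn]
  have har : (headerC.run (State.input 𝔊.encode)).arr 0 = 𝔊.inp := rfl
  generalize headerC.run (State.input 𝔊.encode) = s at *
  constructor <;> simp [offsetC, Cmd.run, Expr.eval, hr1, hr2, har]

theorem eval_get_prio {s : State} (h : Base 𝔊 s) {r : ℕ} {u : Fin 𝔊.n} (hu : s.reg r = u) :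
    (get 0 (add (add (lit 2) (var 1)) (var r))).eval s = 𝔊.prio u := by
  rw [Expr.eval, Expr.eval, Expr.eval, Expr.eval, Expr.eval, Expr.eval, h.arr0, h.r1, hu,
    𝔊.inp_prio]

theorem eval_rankE {s : State} (h : Base 𝔊 s) {u : Fin 𝔊.n} (hu : s.reg 3 = u) :
    (sum 4 1 (ltE (get 0 (add (add (lit 2) (var 1)) (var 4)))
      (get 0 (add (add (lit 2) (var 1)) (var 3))))).eval s = 𝔊.rank u := by
  rw [Expr.eval, h.r1, Finset.sum_range, PersParityGame.rank, Finset.card_filter]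
  refine Finset.sum_congr rfl fun v _ => ?_
  have h' := h.setReg (x := 4) (by decide) v
  rw [eval_ltE, eval_get_prio (u := v) h' (by simp), eval_get_prio (u := u) h' (by simpa using hu)]

theorem run_rankC {s : State} (h : Base 𝔊 s) :
    Base 𝔊 (rankC.run s) ∧ ∀ u : Fin 𝔊.n, (rankC.run s).arr 1 u = 𝔊.rank u + 1 := by
  have := Cmd.run_loop_induction (i := 3) (r := 1) (s := s)
    (c := .store 1 (var 3) (add (sum 4 1 (ltE (get 0 (add (add (lit 2) (var 1)) (var 4)))
      (get 0 (add (add (lit 2) (var 1)) (var 3))))) (lit 1)))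
    (fun k s => Base 𝔊 s ∧ ∀ u : Fin 𝔊.n, (u : ℕ) < k → s.arr 1 u = 𝔊.rank u + 1)
    ⟨h, fun u hu => absurd hu (Nat.not_lt_zero _)⟩
    (fun k hk s' hs' => by
      rw [h.r1] at hk
      have h0 := hs'.1.setReg (x := 3) (by decide) k
      have he := eval_rankE h0 (u := ⟨k, hk⟩) (by simp)
      rw [Cmd.run, Expr.eval, Expr.eval, he, Expr.eval]
      refine ⟨h0.setArr (by omega) _ _, fun u hu => ?_⟩
      rw [State.setArr_arr, State.setReg_reg, if_pos rfl, State.setReg_arr]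
      rcases Nat.lt_succ_iff_lt_or_eq.1 hu with hlt | heq
      · rw [if_neg (by omega)]
        exact hs'.2 u hlt
      · obtain rfl : u = ⟨k, hk⟩ := Fin.ext heq
        exact if_pos ⟨rfl, rfl⟩)
  rw [h.r1] at this
  exact ⟨this.1, fun u => this.2 u u.2⟩

/-- The loop invariant of `parityC`. -/
def ParityInv (𝔊 : PersParityGame) (k : ℕ) (s : State) : Prop :=
  Base 𝔊 s ∧ (∀ u : Fin 𝔊.n, s.arr 1 u = 𝔊.rank u + 1) ∧
    ∀ u : Fin 𝔊.n, (u : ℕ) < k → s.arr 2 u = 𝔊.prio u % 2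

theorem ParityInv.step {k : ℕ} (hk : k < 𝔊.n) {s : State} (h : ParityInv 𝔊 k s) :
    ParityInv 𝔊 (k + 1) (parityBody.run (s.setReg 3 k)) := by
  obtain ⟨hb, hr, hp⟩ := h
  have h0 := hb.setReg (x := 3) (by decide) k
  have he := eval_get_prio h0 (r := 3) (u := ⟨k, hk⟩) (by simp)
  have h1 := h0.setReg (x := 15) (by decide) (𝔊.prio ⟨k, hk⟩)
  have h2 := h1.setReg (x := 16) (by decide) (𝔊.prio ⟨k, hk⟩ % 2)
  have hrun : parityBody.run (s.setReg 3 k) =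
      (((s.setReg 3 k).setReg 15 (𝔊.prio ⟨k, hk⟩)).setReg 16 (𝔊.prio ⟨k, hk⟩ % 2)).setArr 2 k
        (𝔊.prio ⟨k, hk⟩ % 2) := by
    rw [parityBody, Cmd.run, Cmd.run, Cmd.run, he, Cmd.run, Cmd.run]
    simp [Expr.eval]
  rw [hrun]
  refine ⟨h2.setArr (by omega) _ _, fun u => ?_, fun u hu => ?_⟩
  · rw [State.setArr_arr_of_ne (by omega)]
    exact hr u
  · rw [State.setArr_arr]
    rcases Nat.lt_succ_iff_lt_or_eq.1 hu with hlt | heq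
    · rw [if_neg (by omega)]
      exact hp u hlt
    · obtain rfl : u = ⟨k, hk⟩ := Fin.ext heq
      exact if_pos ⟨rfl, rfl⟩

theorem run_parityC {s : State} (h : Base 𝔊 s)
    (hr : ∀ u : Fin 𝔊.n, s.arr 1 u = 𝔊.rank u + 1) : Ranked 𝔊 (parityC.run s) := by
  have := Cmd.run_loop_induction (c := parityBody) (i := 3) (r := 1) (s := s) (ParityInv 𝔊)
    ⟨h, hr, fun u hu => absurd hu (Nat.not_lt_zero _)⟩
    (fun k hk s' hs' => hs'.step (by rwa [h.r1] at hk))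
  rw [h.r1] at this
  exact ⟨this.1, this.2.1, fun u => this.2.2 u u.2⟩

theorem run_exponentC {s : State} (h : Ranked 𝔊 s) : Ranked 𝔊 (exponentC.run s) ∧
    𝔊.n < 2 ^ (exponentC.run s).reg 18 ∧ (exponentC.run s).reg 18 ≤ Nat.log 2 𝔊.n + 1 := by
  set s₁ := (s.setReg 17 1).setReg 18 0 with hs₁
  have h1 : Ranked 𝔊 s₁ := (h.setReg (by decide) _).setReg (by decide) _
  -- Either the power has already passed `n`, or the exponent has grown in every round. After `n`
  -- rounds the second case gives the bound by `n < 2 ^ n`.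
  have := Cmd.run_loop_induction (i := 24) (r := 1) (s := s₁)
    (c := .ite (leE (var 17) (var 1))
    (.seq (.assign 17 (add (var 17) (var 17))) (.assign 18 (add (var 18) (lit 1)))) skipC)
    (fun k s => Ranked 𝔊 s ∧ s.reg 17 = 2 ^ s.reg 18 ∧ s.reg 18 ≤ Nat.log 2 𝔊.n + 1 ∧
      (𝔊.n < s.reg 17 ∨ k ≤ s.reg 18))
    ⟨h1, by simp [hs₁], by simp [hs₁], Or.inr (Nat.zero_le _)⟩
    (fun k hk s' hs' => by
      obtain ⟨hR, h17, h18, hor⟩ := hs'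
      have hR' := hR.setReg (x := 24) (by decide) k
      have e1 : (s'.setReg 24 k).reg 1 = 𝔊.n := hR'.r1
      have e17 : (s'.setReg 24 k).reg 17 = s'.reg 17 := by simp
      have e18 : (s'.setReg 24 k).reg 18 = s'.reg 18 := by simp
      generalize s'.setReg 24 k = s'' at *
      rw [Cmd.run, eval_leE, Expr.eval, Expr.eval, e1, e17]
      by_cases hle : s'.reg 17 ≤ 𝔊.n
      · rw [if_pos hle, if_pos one_ne_zero, Cmd.run, Cmd.run, Cmd.run, Expr.eval, Expr.eval, e17]
        refine ⟨(hR'.setReg (by decide) _).setReg (by decide) _, ?_, ?_, ?_⟩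
        · simp [Expr.eval, e18, h17, pow_succ]; omega
        · have hn : 𝔊.n ≠ 0 := by
            have : 0 < s'.reg 17 := by rw [h17]; positivity
            omega
          have := Nat.le_log_of_pow_le (b := 2) (by omega) (h17 ▸ hle)
          simp [Expr.eval, e18, this]
        · right
          simp [Expr.eval, e18]
          omega
      · rw [if_neg hle, if_neg (by omega), skipC, Cmd.run]
        refine ⟨hR'.setReg (by decide) _, ?_, ?_, ?_⟩
        · simp [e17, e18, h17]
        · simp [e18, h18]
        · left; simp [e17]; omega)
  have hr1 : s₁.reg 1 = 𝔊.n := h1.r1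
  rw [hr1] at this
  have hrun : exponentC.run s = (Cmd.loop 24 1 (.ite (leE (var 17) (var 1))
    (.seq (.assign 17 (add (var 17) (var 17))) (.assign 18 (add (var 18) (lit 1)))) skipC)).run s₁ :=
    rfl
  rw [← hrun] at this
  obtain ⟨hR, h17, h18, hor⟩ := this
  refine ⟨hR, ?_, h18⟩
  rcases hor with hor | hor
  · rwa [← h17]
  · exact hor.trans_lt Nat.lt_two_pow_self

/-! ### The universal word -/

/-- The levels and labels of `w` are in the arrays `a` and `b`, starting from index one. -/
def Stored (a b : ℕ) (w : List (ℕ × ℕ)) (s : State) : Prop :=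
  ∀ j < w.length, (s.arr a (j + 1), s.arr b (j + 1)) = w.getD j (0, 0)

theorem Stored.congr {a b : ℕ} {w : List (ℕ × ℕ)} {s s' : State} (h : Stored a b w s)
    (ha : s'.arr a = s.arr a) (hb : s'.arr b = s.arr b) : Stored a b w s' := by
  intro j hj
  rw [ha, hb, h j hj]

theorem Stored.push {a b : ℕ} (hab : a ≠ b) {w : List (ℕ × ℕ)} {s : State} (h : Stored a b w s)
    (l : ℕ × ℕ) :
    Stored a b (w ++ [l]) ((s.setArr a (w.length + 1) l.1).setArr b (w.length + 1) l.2) := by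
  intro j hj
  rw [List.length_append, List.length_singleton] at hj
  simp only [State.setArr_arr, hab, hab.symm, false_and, true_and, if_false]
  rcases Nat.lt_succ_iff_lt_or_eq.1 hj with hlt | rfl
  · rw [if_neg (by omega), if_neg (by omega), h j hlt, List.getD_append _ _ _ _ hlt]
  · rw [if_pos rfl, if_pos rfl, List.getD_append_right _ _ _ _ le_rfl]
    simp

theorem List.take_succ_getD {α : Type*} {w : List α} {j : ℕ} (hj : j < w.length) (d : α) :
    w.take (j + 1) = w.take j ++ [w.getD j d] := by
  rw [List.getD_eq_getElem _ _ hj, List.take_concat_get']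

/-- The word `w` is available. -/
structure Worded (𝔊 : PersParityGame) (w : List (ℕ × ℕ)) (s : State) : Prop extends
    Ranked 𝔊 s where
  r19 : s.reg 19 = w.length
  stored : Stored 3 4 w s

theorem Worded.setReg {w : List (ℕ × ℕ)} {s : State} (h : Worded 𝔊 w s) {x : ℕ}
    (hx : x ∉ [1, 2, 10, 11, 12, 13, 14, 19]) (k : ℕ) : Worded 𝔊 w (s.setReg x k) := by
  refine ⟨h.toRanked.setReg (fun hx' => hx ?_) k, ?_, h.stored.congr rfl rfl⟩
  · simp only [List.mem_cons, List.not_mem_nil, or_false] at hx' ⊢; tauto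
  · rw [State.setReg_reg, if_neg, h.r19]; rintro rfl; simp at hx

/-- The word `w` and an initial segment `w'` of the next word are available. -/
structure Build (𝔊 : PersParityGame) (w w' : List (ℕ × ℕ)) (s : State) : Prop extends
    Worded 𝔊 w s where
  r20 : s.reg 20 = w'.length
  stored' : Stored 5 6 w' s

variable {w w' : List (ℕ × ℕ)}

theorem Build.setReg {s : State} (h : Build 𝔊 w w' s) {x : ℕ}
    (hx : x ∉ [1, 2, 10, 11, 12, 13, 14, 19, 20]) (k : ℕ) : Build 𝔊 w w' (s.setReg x k) := by
  refine ⟨h.toWorded.setReg (fun hx' => hx ?_) k, ?_, h.stored'.congr rfl rfl⟩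
  · simp only [List.mem_cons, List.not_mem_nil, or_false] at hx' ⊢; tauto
  · rw [State.setReg_reg, if_neg, h.r20]; rintro rfl; simp at hx

/-- The expressions are evaluated after the length has been incremented, and `e'` even after `e` has
been stored. Hence their values must not depend on register `20` or array `5`. -/
theorem run_pushC {s : State} (h : Build 𝔊 w w' s) {e e' : Expr} {x y : ℕ}
    (he : ∀ s', (∀ r ≠ 20, s'.reg r = s.reg r) → (∀ a, a ≠ 5 → s'.arr a = s.arr a) →
      e.eval s' = x ∧ e'.eval s' = y) :
    Build 𝔊 w (w' ++ [(x, y)]) ((pushC e e').run s) ∧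
      ∀ r ≠ 20, ((pushC e e').run s).reg r = s.reg r := by
  have hrun : (pushC e e').run s =
      ((s.setReg 20 (w'.length + 1)).setArr 5 (w'.length + 1) x).setArr 6 (w'.length + 1) y := by
    have h1 := (he (s.setReg 20 (w'.length + 1)) (fun r hr => by simp [hr]) (fun _ _ => rfl)).1
    have h2 := (he ((s.setReg 20 (w'.length + 1)).setArr 5 (w'.length + 1) x)
      (fun r hr => by simp [hr]) (fun _ ha => State.setArr_arr_of_ne ha _ _)).2
    have h3 : (add (var 20) (lit 1)).eval s = w'.length + 1 := by
      simp [Expr.eval, h.r20]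
    have h4 : (var 20).eval (s.setReg 20 (w'.length + 1)) = w'.length + 1 := by simp [Expr.eval]
    have h5 : (Cmd.store 5 (var 20) e).run (s.setReg 20 (w'.length + 1)) =
        (s.setReg 20 (w'.length + 1)).setArr 5 (w'.length + 1) x := by rw [Cmd.run, h4, h1]
    rw [pushC, Cmd.run, Cmd.run, h3, Cmd.run, h5, Cmd.run, h2]
    exact congrArg (fun i => State.setArr _ 6 i y) h4
  rw [hrun]
  refine ⟨⟨⟨(((h.toRanked.setReg (by decide) _).setArr (by omega) _ _).setArr (by omega) _ _), ?_,
    h.stored.congr ?_ ?_⟩, by simp, ?_⟩, fun r hr => by simp [hr]⟩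
  · simpa using h.r19
  · rw [State.setArr_arr_of_ne (by omega), State.setArr_arr_of_ne (by omega), State.setReg_arr]
  · rw [State.setArr_arr_of_ne (by omega), State.setArr_arr_of_ne (by omega), State.setReg_arr]
  · exact (h.stored'.congr (s' := s.setReg 20 (w'.length + 1)) rfl rfl).push (by omega) (x, y)

theorem run_capC {s : State} (h : Build 𝔊 w w' s) {c : ℕ} (hc : s.reg 21 = c) :
    Build 𝔊 w (w' ++ capWord c w) (capC.run s) ∧ (capC.run s).reg 21 = c := by
  have := Cmd.run_loop_induction (i := 24) (r := 19) (s := s)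
    (c := pushC (sub (get 3 (add (var 24) (lit 1))) (sub (get 3 (add (var 24) (lit 1)))
      (var 21))) (get 4 (add (var 24) (lit 1))))
    (fun k s => Build 𝔊 w (w' ++ capWord c (w.take k)) s ∧ s.reg 21 = c)
    ⟨by simpa [capWord] using h, hc⟩
    (fun k hk s' hs' => by
      rw [h.r19] at hk
      have h0 := hs'.1.setReg (x := 24) (by decide) k
      have h21 : (s'.setReg 24 k).reg 21 = c := by simpa using hs'.2
      have h24 : (s'.setReg 24 k).reg 24 = k := by simp
      have hst := h0.stored k hk
      rw [List.take_succ_getD hk (0, 0), capWord, List.map_append, ← capWord, ← List.append_assoc]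
      have := run_pushC h0 (e := sub (get 3 (add (var 24) (lit 1)))
        (sub (get 3 (add (var 24) (lit 1))) (var 21))) (e' := get 4 (add (var 24) (lit 1)))
        (x := min (w.getD k (0, 0)).1 c) (y := (w.getD k (0, 0)).2) (fun s'' hr ha => by
          simp only [Expr.eval, hr 24 (by omega), hr 21 (by omega), ha 3 (by omega),
            ha 4 (by omega), h21, h24, ← hst]
          exact ⟨Nat.sub_sub_eq_min _ _, trivial⟩)
      exact ⟨this.1, by rw [this.2 21 (by omega), h21]⟩)
  rw [h.r19, List.take_length] at this
  exact this

theorem run_midC {s : State} (h : Build 𝔊 w w' s) {c : ℕ} (hc : s.reg 21 = c) :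
    Build 𝔊 w (w' ++ midWord (numGroups 𝔊) c) (midC.run s) := by
  have := Cmd.run_loop_induction (i := 25) (r := 2) (s := s)
    (c := pushC (var 21) (add (var 25) (lit 1)))
    (fun k s => Build 𝔊 w (w' ++ (List.range k).map fun g => (c, g + 1)) s ∧ s.reg 21 = c)
    ⟨by simpa using h, hc⟩
    (fun k hk s' hs' => by
      have h0 := hs'.1.setReg (x := 25) (by decide) k
      have h21 : (s'.setReg 25 k).reg 21 = c := by simpa using hs'.2
      have h25 : (s'.setReg 25 k).reg 25 = k := by simp
      rw [List.range_succ, List.map_append, ← List.append_assoc]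
      have := run_pushC h0 (e := var 21) (e' := add (var 25) (lit 1)) (x := c) (y := k + 1)
        (fun s'' hr ha => by
          simp only [Expr.eval, hr 25 (by omega), hr 21 (by omega), h21, h25, and_self])
      exact ⟨this.1, by rw [this.2 21 (by omega), h21]⟩)
  rw [h.r2] at this
  rw [midWord, ← List.append_assoc]
  exact (run_pushC this.1 (e := var 21) (e' := lit 0) (x := c) (y := 0) (fun s'' hr ha => by
    simp only [Expr.eval, hr 21 (by omega), this.2, and_self])).1

/-- With truncated subtraction the level formula runs through `n, …, 1, 1, …, n`, which turns the
recursion into a single loop. -/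
theorem blockWord_eq_flatMap (m : ℕ) (w : List (ℕ × ℕ)) (n : ℕ) :
    blockWord m w n = (List.range (n + n)).flatMap fun t =>
      capWord (n - t + (t + 1 - n)) w ++ midWord m (n - t + (t + 1 - n)) := by
  induction n with
  | zero => rfl
  | succ n ih =>
    rw [show n + 1 + (n + 1) = (n + n + 1) + 1 by ring, List.range_succ, List.flatMap_append,
      List.range_succ_eq_map, List.flatMap_cons, List.flatMap_map, blockWord, ih]
    simp only [List.flatMap_cons, List.flatMap_nil, List.append_nil]
    have h1 : n + 1 - 0 + (0 + 1 - (n + 1)) = n + 1 := by omega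
    have h2 : n + 1 - (n + n + 1) + (n + n + 1 + 1 - (n + 1)) = n + 1 := by omega
    have h3 : ∀ t, n + 1 - Nat.succ t + (Nat.succ t + 1 - (n + 1)) = n - t + (t + 1 - n) := by
      intro t; omega
    rw [h1, h2]
    simp only [h3]

theorem run_blockC {s : State} (h : Worded 𝔊 w s) :
    Build 𝔊 w (blockWord (numGroups 𝔊) w 𝔊.n) (blockC.run s) := by
  have h1 : Build 𝔊 w [] (s.setReg 20 0) :=
    ⟨h.setReg (by decide) _, by simp, fun j hj => absurd hj (Nat.not_lt_zero _)⟩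
  have := Cmd.run_loop_induction (i := 23) (r := 14) (s := s.setReg 20 0)
    (c := .seq (.assign 21 (add (sub (var 1) (var 23)) (sub (add (var 23) (lit 1)) (var 1))))
      (.seq capC midC))
    (fun k s => Build 𝔊 w ((List.range k).flatMap fun t => capWord (𝔊.n - t + (t + 1 - 𝔊.n)) w ++
      midWord (numGroups 𝔊) (𝔊.n - t + (t + 1 - 𝔊.n))) s) h1
    (fun k hk s' hs' => by
      have h0 := hs'.setReg (x := 23) (by decide) k
      have he : (add (sub (var 1) (var 23)) (sub (add (var 23) (lit 1)) (var 1))).eval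
          (s'.setReg 23 k) = 𝔊.n - k + (k + 1 - 𝔊.n) := by
        simp [Expr.eval, hs'.r1]
      have h2 := h0.setReg (x := 21) (by decide) (𝔊.n - k + (k + 1 - 𝔊.n))
      rw [List.range_succ, List.flatMap_append, List.flatMap_singleton, ← List.append_assoc,
        Cmd.run, Cmd.run, he, Cmd.run]
      obtain ⟨h3, h21⟩ := run_capC h2 (c := 𝔊.n - k + (k + 1 - 𝔊.n)) (by simp)
      exact run_midC h3 h21)
  rw [h1.r14, ← blockWord_eq_flatMap] at this
  exact this

theorem run_copyC {s : State} (h : Build 𝔊 w w' s) :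
    Worded 𝔊 w' ((copyC.run s).setReg 19 ((copyC.run s).reg 20)) := by
  have := Cmd.run_loop_induction (i := 24) (r := 20) (s := s)
    (c := .seq (.store 3 (add (var 24) (lit 1)) (get 5 (add (var 24) (lit 1))))
      (.store 4 (add (var 24) (lit 1)) (get 6 (add (var 24) (lit 1)))))
    (fun k s => Ranked 𝔊 s ∧ s.reg 20 = w'.length ∧ Stored 5 6 w' s ∧ Stored 3 4 (w'.take k) s)
    ⟨h.toRanked, h.r20, h.stored', fun j hj => by simp at hj⟩
    (fun k hk s' hs' => by
      rw [h.r20] at hk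
      obtain ⟨hR, h20, hst, htk⟩ := hs'
      have hl5 : s'.arr 5 (k + 1) = (w'.getD k (0, 0)).1 := congrArg Prod.fst (hst k hk)
      have hl6 : s'.arr 6 (k + 1) = (w'.getD k (0, 0)).2 := congrArg Prod.snd (hst k hk)
      have hlen : (w'.take k).length = k := by rw [List.length_take]; omega
      have hrun : (Cmd.seq (.store 3 (add (var 24) (lit 1)) (get 5 (add (var 24) (lit 1))))
          (.store 4 (add (var 24) (lit 1)) (get 6 (add (var 24) (lit 1))))).run (s'.setReg 24 k) =
          ((s'.setReg 24 k).setArr 3 ((w'.take k).length + 1) (w'.getD k (0, 0)).1).setArr 4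
            ((w'.take k).length + 1) (w'.getD k (0, 0)).2 := by
        rw [hlen, ← hl5, ← hl6]
        simp [Cmd.run, Expr.eval]
      rw [hrun]
      refine ⟨((hR.setReg (by decide) _).setArr (by omega) _ _).setArr (by omega) _ _,
        by simpa using h20, hst.congr ?_ ?_, ?_⟩
      · rw [State.setArr_arr_of_ne (by omega), State.setArr_arr_of_ne (by omega), State.setReg_arr]
      · rw [State.setArr_arr_of_ne (by omega), State.setArr_arr_of_ne (by omega), State.setReg_arr]
      · rw [List.take_succ_getD hk (0, 0)]
        exact (htk.congr (s' := s'.setReg 24 k) rfl rfl).push (by omega) _)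
  rw [h.r20, List.take_length] at this
  obtain ⟨hR, h20, -, hst⟩ := this
  refine ⟨Ranked.mk ⟨hR.arr0, ?_, ?_, ?_, ?_, ?_, ?_, ?_⟩ hR.rank hR.odd, ?_,
    hst.congr rfl rfl⟩
  exacts [hR.r1, hR.r2, hR.r10, hR.r11, hR.r12, hR.r13, hR.r14, by rw [State.setReg_reg, if_pos rfl]; exact h20]

theorem run_roundC {s : State} (h : Worded 𝔊 w s) :
    Worded 𝔊 (blockWord (numGroups 𝔊) w 𝔊.n) (roundC.run s) :=
  run_copyC (run_blockC h)

theorem run_wordC {s : State} (h : Worded 𝔊 [] s) {i : ℕ} (hi : s.reg 18 = i) :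
    Worded 𝔊 (univWord (numGroups 𝔊) 𝔊.n i) (wordC.run s) := by
  have := Cmd.run_loop_induction (i := 22) (r := 18) (s := s) (c := roundC)
    (fun k s => Worded 𝔊 (univWord (numGroups 𝔊) 𝔊.n k) s) h
    (fun k _ s' hs' => run_roundC (hs'.setReg (by decide) _))
  rwa [hi] at this

theorem run_tableC {s : State} (h : Worded 𝔊 w s) (hw : ∀ l ∈ w, l.2 ≤ 𝔊.groups.length) :
    ∃ lev lab, 𝔊.Table lev lab w ∧ Tabled 𝔊 (w.length + 1) lev lab 0 (tableC.run s) ∧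
      (tableC.run s).reg 9 = 𝔊.n * (w.length + 1) + 1 := by
  -- Here `M` is `w.length + 1`: position `0` gets level and label `0`, and position `M` gets level
  -- `n`.
  set s₁ := ((((s.setReg 8 (w.length + 1)).setReg 7 (w.length + 1 + 1)).setArr 3 (w.length + 1)
    𝔊.n).setArr 3 0 0).setArr 4 0 0 with hs₁
  have hR : Ranked 𝔊 s₁ := ((((h.toRanked.setReg (by decide) _).setReg (by decide) _).setArr
    (by omega) _ _).setArr (by omega) _ _).setArr (by omega) _ _
  have hrun : tableC.run s = ((Cmd.seq (.loop 3 1 (.store 7 (var 3) (lit 0)))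
      (.assign 9 (add (sum 5 1 (var 8)) (lit 1)))).run s₁) := by
    simp [tableC, Cmd.run, Expr.eval, hs₁, h.r19, h.r1]
  have htab : 𝔊.Table (s₁.arr 3) (s₁.arr 4) w := by
    have key : ∀ x ≤ w.length, (s₁.arr 3 x, s₁.arr 4 x) = ((0, 0) :: w).getD x (0, 0) := by
      intro x hx
      rcases x with _ | x
      · simp [hs₁]
      · have := h.stored x (by omega)
        have hne : x ≠ w.length := by omega
        simpa [hs₁, hne] using this
    refine ⟨fun x hx => ?_, fun x hx => ?_, ?_, hw⟩
    · rw [wlev, ← key x hx]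
    · rw [wlab, ← key x hx]
    · simp [hs₁]
  have := Cmd.run_loop_induction (i := 3) (r := 1) (s := s₁) (c := .store 7 (var 3) (lit 0))
    (fun k s => Ranked 𝔊 s ∧ s.reg 7 = w.length + 1 + 1 ∧ s.reg 8 = w.length + 1 ∧
      s.arr 3 = s₁.arr 3 ∧ s.arr 4 = s₁.arr 4 ∧ ∀ u < k, s.arr 7 u = 0)
    ⟨hR, by simp [hs₁], by simp [hs₁], rfl, rfl, fun u hu => absurd hu (Nat.not_lt_zero _)⟩
    (fun k hk s' hs' => by
      obtain ⟨h1, h7, h8, h3, h4, h0⟩ := hs'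
      rw [Cmd.run, Expr.eval, Expr.eval, State.setReg_reg, if_pos rfl]
      refine ⟨(h1.setReg (by decide) _).setArr (by omega) _ _, by simpa using h7, by simpa using h8,
        ?_, ?_, fun u hu => ?_⟩
      · rw [State.setArr_arr_of_ne (by omega), State.setReg_arr, h3]
      · rw [State.setArr_arr_of_ne (by omega), State.setReg_arr, h4]
      · rw [State.setArr_arr, State.setReg_arr]
        split_ifs with huk
        · rfl
        · exact h0 u (by omega))
  rw [hR.r1] at this
  rw [hrun, Cmd.run]
  set s₂ := (Cmd.loop 3 1 (.store 7 (var 3) (lit 0))).run s₁ with hs₂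
  obtain ⟨h1, h7, h8, h3, h4, h0⟩ := this
  have he : (add (sum 5 1 (var 8)) (lit 1)).eval s₂ = 𝔊.n * (w.length + 1) + 1 := by
    simp [Expr.eval, h8, h1.r1]
  rw [Cmd.run, he]
  refine ⟨_, _, htab, ⟨h1.setReg (by decide) _, by simpa using h7, by simpa using h8, h3, h4,
    fun u => h0 u u.2, fun u => Nat.zero_le _, fun x hx => htab.lab_le' (by omega)⟩, by simp⟩

/-- Without vertices there are no blocks, so the word is empty whatever the number of labels. -/
theorem univWord_numGroups (𝔊 : PersParityGame) (i : ℕ) :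
    univWord (numGroups 𝔊) 𝔊.n i = univWord 𝔊.groups.length 𝔊.n i := by
  unfold numGroups
  split_ifs with hn
  · generalize 𝔊.groups.length = m
    rw [hn]
    cases i <;> rfl
  · rfl

end RAM

open RAM.Expr

/-! ### The length of the universal word -/

theorem length_blockWord (m : ℕ) (w : List (ℕ × ℕ)) (n : ℕ) :
    (blockWord m w n).length = (n + n) * (w.length + m + 1) := by
  induction n with
  | zero => simp [blockWord]
  | succ n ih =>
    simp only [blockWord, List.length_append, ih, capWord, midWord, List.length_map,
      List.length_range, List.length_singleton]
    ring

/-- One round takes length `L` to `2 * n * (L + m + 1)`. The strict bound absorbs the summand `1`,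
and the factor `2 * N * (N + 1)` is below `(N + 2) ^ 3`. -/
theorem length_univWord_lt {m n N : ℕ} (hm : m ≤ N) (hn : n ≤ N) (i : ℕ) :
    (univWord m n i).length < (N + 2) ^ (3 * i) := by
  induction i with
  | zero => simp [univWord]
  | succ i ih =>
    rw [univWord, length_blockWord, show 3 * (i + 1) = 3 * i + 3 by ring, pow_add]
    generalize (univWord m n i).length = L at *
    generalize (N + 2) ^ (3 * i) = A at *
    have h1 : (n + n) * (L + m + 1) ≤ (N + N) * (A * (N + 1)) := by
      refine Nat.mul_le_mul (by omega) ?_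
      have : L + 1 + N ≤ (L + 1) * (N + 1) := by nlinarith [Nat.zero_le (L * N)]
      have : (L + 1) * (N + 1) ≤ A * (N + 1) := Nat.mul_le_mul_right _ ih
      omega
    have h2 : (N + N) * (A * (N + 1)) < A * (N + 2) ^ 3 := by
      have hA : 0 < A := by omega
      have : (N + N) * (N + 1) < (N + 2) ^ 3 := by
        ring_nf
        have := Nat.zero_le (N ^ 3)
        have := Nat.zero_le (N ^ 2)
        omega
      calc (N + N) * (A * (N + 1)) = A * ((N + N) * (N + 1)) := by ring
        _ < A * (N + 2) ^ 3 := Nat.mul_lt_mul_of_pos_left this hA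
    omega

namespace RAM

/-! ### The running time of the program -/

theorem Cmd.time_seq_le {c c' : Cmd} {s : State} {X a b : ℕ} (h : c.time s ≤ (X + 2) ^ a)
    (h' : c'.time (c.run s) ≤ (X + 2) ^ b) : (c.seq c').time s ≤ (X + 2) ^ (a + b + 1) :=
  (Nat.add_le_add h h').trans (pow_add_pow_le (by omega) a b)

/-- The cost of `parity` depends on the bit length of a stored value and not on loop limits, so the
general bound for plain commands does not apply and the invariant is used. -/
theorem time_parityC : ∃ a, ∀ (𝔊 : PersParityGame) (X : ℕ) (s : State), Base 𝔊 s →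
    (∀ u : Fin 𝔊.n, s.arr 1 u = 𝔊.rank u + 1) → 𝔊.n ≤ X → (∀ u, (𝔊.prio u).size ≤ X) →
    parityC.time s ≤ (X + 2) ^ a := by
  refine ⟨6 + 11, fun 𝔊 X s h hr hn hp => ?_⟩
  refine Cmd.time_loop_le (ParityInv 𝔊) ⟨h, hr, fun u hu => absurd hu (Nat.not_lt_zero _)⟩
    (fun k hk s' hs' => hs'.step (by rwa [h.r1] at hk)) (by rw [h.r1]; exact hn)
    (fun k hk s' hs' => ?_)
  rw [h.r1] at hk
  have he := eval_get_prio (hs'.1.setReg (x := 3) (by decide) k) (r := 3) (u := ⟨k, hk⟩) (by simp)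
  have hs := hp ⟨k, hk⟩
  have ht : parityBody.time (s'.setReg 3 k) =
      (𝔊.prio ⟨k, hk⟩).size * (5 * (𝔊.prio ⟨k, hk⟩).size + 10) + 15 := by
    simp only [parityBody, Cmd.time, Cmd.run, he, Expr.time, State.setReg_reg, if_true]
    ring
  rw [ht]
  generalize (𝔊.prio ⟨k, hk⟩).size = p at *
  have h1 : p * (5 * p + 10) + 15 ≤ X * (5 * X + 10) + 15 := by gcongr
  have h2 : 2 ^ 4 ≤ (X + 2) ^ 4 := Nat.pow_le_pow_left (by omega) 4
  calc _ ≤ X * (5 * X + 10) + 15 := h1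
    _ ≤ (X + 2) ^ 2 * 2 ^ 4 := by ring_nf; nlinarith [Nat.zero_le (X ^ 2)]
    _ ≤ (X + 2) ^ 2 * (X + 2) ^ 4 := Nat.mul_le_mul_left _ h2
    _ = (X + 2) ^ 6 := by ring

/-- The rounds reassign the lengths in registers `19` and `20`, which bound their own loops. The
invariant controls these lengths; within a round the two parts are plain. -/
theorem time_wordC : ∃ a, ∀ (𝔊 : PersParityGame) (X : ℕ) (s : State) (i : ℕ), Worded 𝔊 [] s →
    s.reg 18 = i → i ≤ X → numGroups 𝔊 ≤ X → 𝔊.n + 𝔊.n ≤ X →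
    (∀ j ≤ i, (univWord (numGroups 𝔊) 𝔊.n j).length ≤ X) → wordC.time s ≤ (X + 2) ^ a := by
  obtain ⟨a, ha⟩ := blockC.exists_time_le plain_blockC
  obtain ⟨b, hb⟩ := copyC.exists_time_le plain_copyC
  refine ⟨a + (b + 1 + 1) + 1 + 11, fun 𝔊 X s i h hi hiX hm hn hw => ?_⟩
  refine Cmd.time_loop_le (fun k s => Worded 𝔊 (univWord (numGroups 𝔊) 𝔊.n k) s) h
    (fun k _ s' hs' => run_roundC (hs'.setReg (by decide) _)) (by omega) (fun k hk s' hs' => ?_)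
  have h0 := hs'.setReg (x := 22) (by decide) k
  have h1 := run_blockC h0
  refine Cmd.time_seq_le (ha X _ fun r hr => ?_) (Cmd.time_seq_le (hb X _ fun r hr => ?_) ?_)
  · rcases lims_blockC r hr with rfl | rfl | rfl
    · rw [h0.r2]; exact hm
    · rw [h0.r14]; exact hn
    · rw [h0.r19]; exact hw k (by omega)
  · rw [lims_copyC r hr, h1.r20]
    exact hw (k + 1) (by omega)
  · rw [pow_one]
    simp only [Cmd.time, Expr.time]
    omega

/-- A single number `X` dominates all loop limits and the bit lengths of the priorities; the time is
polynomial in `X`, with an exponent independent of the game. -/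
theorem exists_time_solveC_le : ∃ a, ∀ (𝔊 : PersParityGame) (X : ℕ),
    numGroups 𝔊 ≤ X → 𝔊.n + 𝔊.n ≤ X → (∀ u, (𝔊.prio u).size ≤ X) →
    (∀ j ≤ Nat.log 2 𝔊.n + 1, 𝔊.n * ((univWord (numGroups 𝔊) 𝔊.n j).length + 1) + 1 ≤ X ∧
      (univWord (numGroups 𝔊) 𝔊.n j).length + 2 ≤ X ∧ j ≤ X) →
    ∃ out ∈ 𝔊.solutions, (solveC.run (State.input 𝔊.encode)).Outputs out ∧
      solveC.time (State.input 𝔊.encode) ≤ (X + 2) ^ a := by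
  obtain ⟨a₁, t₁⟩ := headerC.exists_time_le plain_headerC
  obtain ⟨a₂, t₂⟩ := offsetC.exists_time_le plain_offsetC
  obtain ⟨a₃, t₃⟩ := rankC.exists_time_le plain_rankC
  obtain ⟨a₄, t₄⟩ := time_parityC
  obtain ⟨a₅, t₅⟩ := exponentC.exists_time_le plain_exponentC
  obtain ⟨a₇, t₇⟩ := time_wordC
  obtain ⟨a₈, t₈⟩ := tableC.exists_time_le plain_tableC
  obtain ⟨a₉, t₉⟩ := sweepsC.exists_time_le plain_sweepsC
  obtain ⟨a₁₀, t₁₀⟩ := outputC.exists_time_le plain_outputC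
  refine ⟨a₁ + (a₂ + (a₃ + (a₄ + (a₅ + (1 + (a₇ + (a₈ + (a₉ + a₁₀ + 1) + 1) + 1) + 1) + 1) + 1) + 1)
    + 1) + 1, fun 𝔊 X hm hn hp hX => ?_⟩
  have hn' : 𝔊.n ≤ X := by omega
  have hh : (headerC.run (State.input 𝔊.encode)).reg 1 = 𝔊.n := (base_offsetC 𝔊).r1
  have h2 := base_offsetC 𝔊
  obtain ⟨h3, h3'⟩ := run_rankC h2
  have h4 := run_parityC h3 h3'
  obtain ⟨h5, hi, hi'⟩ := run_exponentC h4
  have h6 : Worded 𝔊 [] ((Cmd.assign 19 (lit 0)).run (exponentC.run (parityC.run (rankC.run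
      (offsetC.run (headerC.run (State.input 𝔊.encode))))))) :=
    ⟨h5.setReg (by decide) _, rfl, fun j hj => absurd hj (Nat.not_lt_zero _)⟩
  obtain ⟨i, hi6⟩ : ∃ i, (exponentC.run (parityC.run (rankC.run
    (offsetC.run (headerC.run (State.input 𝔊.encode)))))).reg 18 = i := ⟨_, rfl⟩
  rw [hi6] at hi hi'
  have h7 := run_wordC h6 hi6
  obtain ⟨lev, lab, htab, h8, h9⟩ := run_tableC h7 (by
    rw [univWord_numGroups]
    exact PersParityGame.univWord_lab_le _ _ _)
  have h10 := run_sweepsC h8 h9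
  obtain ⟨f, hf, hok, hout⟩ := run_outputC h10 stable_leastMeasure
  rw [univWord_numGroups] at htab
  refine ⟨_, htab.solution hi (by rw [univWord_numGroups]) rfl hf hok, hout, ?_⟩
  obtain ⟨hX9, hX7, hXi⟩ := hX i hi'
  refine Cmd.time_seq_le (t₁ X _ fun r hr => ?_) <|
    Cmd.time_seq_le (t₂ X _ fun r hr => ?_) <| Cmd.time_seq_le (t₃ X _ fun r hr => ?_) <|
    Cmd.time_seq_le (t₄ 𝔊 X _ h3 h3' hn' hp) <| Cmd.time_seq_le (t₅ X _ fun r hr => ?_) <|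
    Cmd.time_seq_le ?_ <|
    Cmd.time_seq_le (t₇ 𝔊 X _ i h6 hi6 hXi hm hn fun j hj => ?_) <|
    Cmd.time_seq_le (t₈ X _ fun r hr => ?_) <|
    Cmd.time_seq_le (t₉ X _ fun r hr => ?_) (t₁₀ X _ fun r hr => ?_)
  · rw [lims_headerC r hr]
    exact Nat.zero_le _
  · rw [lims_offsetC r hr, hh]
    exact hn'
  · rw [lims_rankC r hr, h2.r1]
    exact hn'
  · rw [lims_exponentC r hr, h4.r1]
    exact hn'
  · rw [pow_one]
    simp only [Cmd.time, Expr.time]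
    omega
  · have := (hX j (hj.trans hi')).2.1
    omega
  · rw [lims_tableC r hr]
    rw [h7.r1]; exact hn'
  · rcases lims_sweepsC r hr with rfl | rfl | rfl | rfl
    · rw [h8.r1]; exact hn'
    · rw [h8.r2]; exact hm
    · rw [h8.r7]; exact hX7
    · rw [h9]; exact hX9
  · rcases lims_outputC r hr with rfl | rfl | rfl | rfl
    · rw [h10.r1]; exact hn'
    · rw [h10.r2]; exact hm
    · rw [h10.r7]; exact hX7
    · rw [h10.r14]; exact hn

theorem numGroups_le_bitLength (𝔊 : PersParityGame) : numGroups 𝔊 ≤ bitLength 𝔊.encode := by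
  unfold numGroups
  split_ifs with hn
  · exact Nat.zero_le _
  · exact 𝔊.groups_le_bitLength hn

end RAM

/-! ### Assembling the quasi-polynomial bound -/

theorem mainTheorem2 :
    RAM.SolvableInQP PersParityGame.encode PersParityGame.solutions := by
  obtain ⟨a, ha⟩ := RAM.exists_time_solveC_le
  -- The time is at most `2 ^ (18 * a * ℓ ^ 2)`. The constant must dominate the factor `18 * a`, and
  -- as an exponent of `ℓ` it must be at least `2`.
  refine RAM.solvableInQP_of_cmd RAM.solveC (18 * a + 2) fun 𝔊 => ?_
  have hm := RAM.numGroups_le_bitLength 𝔊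
  have hn := 𝔊.n_le_bitLength
  have hp := 𝔊.prio_size_le
  set N := RAM.bitLength 𝔊.encode with hN
  set I := Nat.log 2 𝔊.n + 1 with hI
  set ℓ := Nat.log 2 (N + 2) with hℓ
  have hℓ1 : 1 ≤ ℓ := Nat.log_pos (by omega) (by omega)
  have hIℓ : I ≤ ℓ + 1 := Nat.add_le_add_right (Nat.log_mono_right (by omega)) 1
  have hIn : I ≤ N + 1 := Nat.add_le_add_right ((Nat.log_le_self _ _).trans hn) 1
  have hA : 1 ≤ (N + 2) ^ (3 * I) := Nat.one_le_pow _ _ (by omega)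
  have hX : 2 * (N + 2) ^ (3 * I) * (N + 2) ≤ (N + 2) ^ (3 * I + 2) := by
    rw [pow_add, pow_two, ← mul_assoc, mul_comm 2]
    exact Nat.mul_le_mul_right _ (Nat.mul_le_mul_left _ (by omega))
  have hX' : (N + 2) ^ (3 * I + 2) + 2 ≤ 2 ^ (18 * ℓ ^ 2) := by
    have h1 : (N + 2) ^ (3 * I + 2) + 2 ≤ (N + 2) ^ (3 * I + 3) := by
      have hB : 2 ≤ (N + 2) ^ (3 * I + 2) := by nlinarith
      rw [pow_succ _ (3 * I + 2)]
      nlinarith [Nat.zero_le ((N + 2) ^ (3 * I + 2) * N)]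
    have h2 : N + 2 ≤ 2 ^ (ℓ + 1) := (Nat.lt_pow_succ_log_self (by omega) _).le
    calc _ ≤ (N + 2) ^ (3 * I + 3) := h1
      _ ≤ (2 ^ (ℓ + 1)) ^ (3 * I + 3) := Nat.pow_le_pow_left h2 _
      _ = 2 ^ ((ℓ + 1) * (3 * I + 3)) := by rw [pow_mul]
      _ ≤ 2 ^ (18 * ℓ ^ 2) := by
        refine Nat.pow_le_pow_right (by omega) ?_
        -- Uses `1 ≤ ℓ` and `I ≤ ℓ + 1`.
        calc (ℓ + 1) * (3 * I + 3) ≤ (2 * ℓ) * (9 * ℓ) := Nat.mul_le_mul (by omega) (by omega)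
          _ = 18 * ℓ ^ 2 := by ring
  -- The power with exponent `3 * I` bounds the word length. The two extra factors `N + 2` leave
  -- room for the number of sweeps `n * M + 1` and the small additive terms.
  obtain ⟨out, hout, ho, ht⟩ := ha 𝔊 ((N + 2) ^ (3 * I + 2)) (by nlinarith) (by nlinarith)
    (fun u => (hp u).trans (by nlinarith)) (fun j hj => by
      have h1 := length_univWord_lt hm hn j
      have h2 : (N + 2) ^ (3 * j) ≤ (N + 2) ^ (3 * I) :=
        Nat.pow_le_pow_right (by omega) (by omega)
      generalize (univWord (RAM.numGroups 𝔊) 𝔊.n j).length = L at *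
      have h3 : 𝔊.n * (L + 1) ≤ N * (N + 2) ^ (3 * I) := Nat.mul_le_mul hn (h1.trans_le h2)
      refine ⟨by nlinarith, by nlinarith, by nlinarith⟩)
  refine ⟨out, hout, ho, ht.trans ?_⟩
  calc ((N + 2) ^ (3 * I + 2) + 2) ^ a ≤ (2 ^ (18 * ℓ ^ 2)) ^ a := Nat.pow_le_pow_left hX' a
    _ = 2 ^ (18 * a * ℓ ^ 2) := by rw [← pow_mul]; congr 1; ring
    _ ≤ 2 ^ ((18 * a + 2) * ℓ ^ (18 * a + 2)) := by
      refine Nat.pow_le_pow_right (by omega) (Nat.mul_le_mul (by omega) ?_)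
      exact Nat.pow_le_pow_right hℓ1 (by omega)
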